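/- **Conventions.** Let $\mathbb F$ be a field and let $x_0,x_1,x_2,\dots$ be variables. A (noncommutative algebraic) formula over $\mathbb F$ is a rooted ordered tree of fan-in at most two whose leaves are labelled by variables or elements of $\mathbb F$ and whose inner nodes are plus gates or product gates; it computes a noncommutative polynomial in $\mathbb F\langle x_0,x_1,\dots\rangle$ in the obvious way (a product gate multiplies its left polynomial by its right polynomial, in this order; a gate with one child computes the polynomial of that child). The size $|\Phi|$ of a formula is the number of its nodes. Let $\preceq$ be a linear order on the variables. For a commutative polynomial $f=\sum_j b_j\mathcal M_j$ let $\llbracket f\rrbracket=\sum_j b_j\llbracket\mathcal M_j\rrbracket$, where $\llbracket\mathcal M_j\rrbracket$ is the noncommutative product of the variables of $\mathcal M_j$ (with multiplicity) in $\preceq$-nondecreasing order. A noncommutative polynomial is *ordered* if it equals $\llbracket f\rrbracket$ for some $f$. A formula is *ordered* if each of its subformulas computes an ordered polynomial. An ordered formula is *syntactic ordered* if at each product gate with two children every variable in the left subformula is $\preceq$ every variable in the right subformula. The field is assumed to be efficiently represented: each $a\in\mathbb F$ has a representation size $\ell(a)\in\mathbb N$, and there is a polynomial $q$ such that for every $N\in\mathbb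 Z[y_1,\dots,y_k]$ and all $a_1,\dots,a_k\in\mathbb F$, $\ell(N(a_1,\dots,a_k))\le q(\deg N+b(N)+\sum_i\ell(a_i))$, where $b(N)$ is the bit length of the sum of the absolute values of the coefficients of $N$. (Examples: $\mathbb Q$ with bit lengths, every finite field, and every field with $\ell=0$, which means that field operations have unit cost.) Algorithms are programs of a first-order functional language on binary trees whose leaves are empty or hold a field element, with the constants $0,1\in\mathbb F$; constructing, decomposing and testing trees, conditionals, local definitions and function calls cost one step each, and producing a constant of $\mathbb F$, an operation $+,-,\cdot,/$ of $\mathbb F$ (with $a/0=0$) or a test applied to a field element in addition costs the representation sizes of the field elements involved. The length of an input is the number of nodes of the tree that codes it (variable indices being written in binary) plus the representation sizes of its field elements. **Proposition.** There are an algorithm and a polynomial $p$ such that, given any formula $\Phi$ over $\mathbb F$ and any linear order $\preceq$ on its variables (presented as the increasing list of the variables of $\Phi$), the algorithm halts within $p(\text{length of the input})$ steps, and * if $\Phi$ is not an ordered formula, it returns $\mathsf{false}$; * if $\Phi$ is an ordered formula, it returns a syntactic ordered formula $\Psi$ with $|\Psi|=|\Phi|$ that computes the same noncommutative (ordered) polynomial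 as $\Phi$. Moreover $\Psi$ is obtained from $\Phi$ by finitely many steps, each of which replaces a subformula $G$ of the current formula by $G(0/x)$ (every leaf labelled $x$ in $G$ becomes the constant $0$), for a variable $x$ that does not occur in the polynomial computed by $G$. -/

import Mathlib

namespace OrderedFormulas

/-! ## Noncommutative formulas -/

/-- Labels of inner nodes: plus gates and product gates. -/
inductive GateOp where
  | plus
  | times

/-- Noncommutative algebraic formulas over `F` with variables from `V`: ordered trees of fan-in at
most two whose leaves carry a variable or a field element and whose inner nodes carry `+` or `×`. -/
inductive NCFormula (F V : Type*) where
  | var (x : V)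
  | const (a : F)
  | unary (op : GateOp) (f : NCFormula F V)
  | binary (op : GateOp) (f g : NCFormula F V)

/-- Noncommutative polynomials `F⟨V⟩`: the monoid algebra of the free monoid of words over `V`. -/
abbrev NCPoly (F V : Type*) [Field F] := MonoidAlgebra F (FreeMonoid V)

/-- The variable `x` occurs in the noncommutative polynomial `h`, that is, in one of its monomials
with nonzero coefficient. -/
def OccursIn {F V : Type*} [Field F] (x : V) (h : NCPoly F V) : Prop :=
  ∃ w : FreeMonoid V, h.coeff w ≠ 0 ∧ x ∈ w.toList

namespace NCFormula

variable {F V : Type*}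

/-- The number of nodes of the tree. -/
def size : NCFormula F V → ℕ
  | var _ => 1
  | const _ => 1
  | unary _ f => f.size + 1
  | binary _ f g => f.size + g.size + 1

/-- The variables that label leaves of the formula. -/
def vars [DecidableEq V] : NCFormula F V → Finset V
  | var x => {x}
  | const _ => ∅
  | unary _ f => f.vars
  | binary _ f g => f.vars ∪ g.vars

/-- The noncommutative polynomial computed by the formula. -/
noncomputable def poly [Field F] : NCFormula F V → NCPoly F V
  | var x => MonoidAlgebra.single (FreeMonoid.of x) 1
  | const a => MonoidAlgebra.single 1 a
  | unary _ f => f.poly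
  | binary .plus f g => f.poly + g.poly
  | binary .times f g => f.poly * g.poly

/-- `G.IsSubformula Φ`: the formula `G` is rooted at some node of `Φ`. -/
inductive IsSubformula (G : NCFormula F V) : NCFormula F V → Prop
  | refl : IsSubformula G G
  | unary {op f} : IsSubformula G f → IsSubformula G (.unary op f)
  | left {op f g} : IsSubformula G f → IsSubformula G (.binary op f g)
  | right {op f g} : IsSubformula G g → IsSubformula G (.binary op f g)

/-- `Φ.zeroVar x` is `Φ(0/x)`: every leaf labelled `x` is relabelled by the constant `0`. -/
def zeroVar [DecidableEq V] [Zero F] (x : V) : NCFormula F V → NCFormula F V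
  | var y => if y = x then const 0 else var y
  | const a => const a
  | unary op f => unary op (f.zeroVar x)
  | binary op f g => binary op (f.zeroVar x) (g.zeroVar x)

/-- One elementary zeroing step: some subformula `G` is replaced by `G(0/x)`, where the variable `x`
does not occur in the polynomial computed by `G`. -/
inductive ZeroStep [DecidableEq V] [Field F] : NCFormula F V → NCFormula F V → Prop
  | here (G : NCFormula F V) (x : V) (hx : ¬ OccursIn x G.poly) : ZeroStep G (G.zeroVar x)
  | unary {op f f'} : ZeroStep f f' → ZeroStep (.unary op f) (.unary op f')
  | left {op f f' g} : ZeroStep f f' → ZeroStep (.binary op f g) (.binary op f' g)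
  | right {op f g g'} : ZeroStep g g' → ZeroStep (.binary op f g) (.binary op f g')

/-- `Ψ` is obtained from `Φ` by finitely many (possibly no) zeroing steps. -/
def ZeroesOutTo [DecidableEq V] [Field F] (Φ Ψ : NCFormula F V) : Prop :=
  Relation.ReflTransGen ZeroStep Φ Ψ

end NCFormula

/-! ## Ordered polynomials and ordered formulas -/

section Ordered

variable {F V : Type*} [Field F]

/-- The word of a commutative monomial: its variables, with multiplicity, multiplied in
nondecreasing order. -/
noncomputable def orderedWord (ord : LinearOrder V) (m : V →₀ ℕ) : FreeMonoid V :=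
  FreeMonoid.ofList (m.toMultiset.sort ord.le)

/-- The noncommutative polynomial `⟦f⟧` of a commutative polynomial `f`. -/
noncomputable def orderedLift (ord : LinearOrder V) (f : MvPolynomial V F) : NCPoly F V :=
  ∑ m ∈ f.support, MonoidAlgebra.single (orderedWord ord m) (f.coeff m)

/-- Ordered polynomials: the image of `⟦·⟧`. -/
def IsOrderedPoly (ord : LinearOrder V) (h : NCPoly F V) : Prop :=
  ∃ f : MvPolynomial V F, orderedLift ord f = h

namespace NCFormula

/-- Ordered formulas: every subformula computes an ordered polynomial. -/
def IsOrdered (ord : LinearOrder V) (Φ : NCFormula F V) : Prop :=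
  ∀ G : NCFormula F V, G.IsSubformula Φ → IsOrderedPoly ord G.poly

/-- Syntactic ordered formulas: ordered formulas such that at every product gate all variables of the
left subformula are less than or equal to all variables of the right subformula. -/
def IsSyntacticOrdered [DecidableEq V] (ord : LinearOrder V) (Φ : NCFormula F V) : Prop :=
  Φ.IsOrdered ord ∧
    ∀ f g : NCFormula F V, (NCFormula.binary .times f g).IsSubformula Φ →
      ∀ x ∈ f.vars, ∀ y ∈ g.vars, ord.le x y

end NCFormula

end Ordered

/-! ## The model of computation

Programs of a first-order Lisp with field arithmetic. A program is a finite list of mutually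
recursive functions of one argument. The data are binary trees whose leaves are empty or hold a
field element, and every elementary operation takes one step, an arithmetic operation in addition
the representation sizes of the field elements it involves. Up to polynomials this is Turing machine
time (with sharing, a data value is a pointer), for field elements written as strings of length
`len a` on which the arithmetic operations take polynomial time. For `len = 0` it is the model in
which every field operation takes one step. -/

/-- Data: binary trees with leaves that are empty or carry a field element. -/
inductive Data (F : Type*) where
  | nil
  | elt (a : F)
  | pair (u v : Data F)

inductive ArithOp where
  | add
  | sub
  | mul
  | div

inductive TestOp where
  | isPair
  | isElt
  | isZero

namespace Data

variable {F : Type*}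

/-- The number of nodes of the tree plus the sizes of the field elements in it. -/
def size (len : F → ℕ) : Data F → ℕ
  | nil => 1
  | elt a => 1 + len a
  | pair u v => 1 + u.size len + v.size len

def head : Data F → Data F
  | pair u _ => u
  | _ => nil

def tail : Data F → Data F
  | pair _ v => v
  | _ => nil

/-- The size of the field element at a leaf (what an arithmetic operation has to read or write). -/
def eltSize (len : F → ℕ) : Data F → ℕ
  | elt a => len a
  | _ => 0

/-- Truth values: `nil` is false, every other value is true. -/
def ofBool : Bool → Data F
  | false => nil
  | true => pair nil nil

/-- Field arithmetic on leaves; the result is `nil` if an operand is not a field element. -/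
def arith [Field F] : ArithOp → Data F → Data F → Data F
  | .add, elt a, elt b => elt (a + b)
  | .sub, elt a, elt b => elt (a - b)
  | .mul, elt a, elt b => elt (a * b)
  | .div, elt a, elt b => elt (a / b)
  | _, _, _ => nil

open Classical in
noncomputable def test [Field F] : TestOp → Data F → Data F
  | .isPair, pair _ _ => ofBool true
  | .isElt, elt _ => ofBool true
  | .isZero, elt a => ofBool (decide (a = 0))
  | _, _ => ofBool false

def ofList : List (Data F) → Data F
  | [] => nil
  | d :: l => pair d (ofList l)

/-- Natural numbers are coded in binary. -/
def ofNat (n : ℕ) : Data F := ofList (n.bits.map ofBool)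

end Data

/-- Expressions: local variables (counted from the innermost), the constants `nil`, `0`, `1`, tree
operations, arithmetic, tests, a conditional, local definitions, and calls of the `k`-th function of
the program. -/
inductive Expr where
  | loc (i : ℕ)
  | nil
  | zero
  | one
  | pair (e₁ e₂ : Expr)
  | head (e : Expr)
  | tail (e : Expr)
  | arith (op : ArithOp) (e₁ e₂ : Expr)
  | test (op : TestOp) (e : Expr)
  | cond (c e₁ e₂ : Expr)
  | letIn (e₁ e₂ : Expr)
  | call (k : ℕ) (e : Expr)

/-- A program: the bodies of its functions. The function number `0` is the main one. -/
abbrev Program := List Expr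

/-- `Eval len P env e v t`: in the environment `env` the expression `e` evaluates (call by value) to
`v` at a total cost of exactly `t` steps. -/
inductive Eval {F : Type*} [Field F] (len : F → ℕ) (P : Program) :
    List (Data F) → Expr → Data F → ℕ → Prop
  | loc (env i) : Eval len P env (.loc i) (env.getD i .nil) 1
  | nil (env) : Eval len P env .nil .nil 1
  | zero (env) : Eval len P env .zero (.elt 0) (1 + len 0)
  | one (env) : Eval len P env .one (.elt 1) (1 + len 1)
  | pair {env e₁ e₂ v₁ v₂ t₁ t₂} : Eval len P env e₁ v₁ t₁ → Eval len P env e₂ v₂ t₂ →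
      Eval len P env (.pair e₁ e₂) (.pair v₁ v₂) (t₁ + t₂ + 1)
  | head {env e v t} : Eval len P env e v t → Eval len P env (.head e) v.head (t + 1)
  | tail {env e v t} : Eval len P env e v t → Eval len P env (.tail e) v.tail (t + 1)
  | arith {env op e₁ e₂ v₁ v₂ t₁ t₂} : Eval len P env e₁ v₁ t₁ → Eval len P env e₂ v₂ t₂ →
      Eval len P env (.arith op e₁ e₂) (Data.arith op v₁ v₂)
        (t₁ + t₂ + 1 + v₁.eltSize len + v₂.eltSize len + (Data.arith op v₁ v₂).eltSize len)
  | test {env op e v t} : Eval len P env e v t →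
      Eval len P env (.test op e) (Data.test op v) (t + 1 + v.eltSize len)
  | condTrue {env c e₁ e₂ b v t₁ t₂} : Eval len P env c b t₁ → b ≠ .nil →
      Eval len P env e₁ v t₂ → Eval len P env (.cond c e₁ e₂) v (t₁ + t₂ + 1)
  | condFalse {env c e₁ e₂ v t₁ t₂} : Eval len P env c .nil t₁ →
      Eval len P env e₂ v t₂ → Eval len P env (.cond c e₁ e₂) v (t₁ + t₂ + 1)
  | letIn {env e₁ e₂ v₁ v₂ t₁ t₂} : Eval len P env e₁ v₁ t₁ →
      Eval len P (v₁ :: env) e₂ v₂ t₂ → Eval len P env (.letIn e₁ e₂) v₂ (t₁ + t₂ + 1)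
  | call {env k e body v w t₁ t₂} : Eval len P env e v t₁ → P[k]? = some body →
      Eval len P [v] body w t₂ → Eval len P env (.call k e) w (t₁ + t₂ + 1)

/-- Evaluation is deterministic, in its value and in its cost. -/
theorem Eval.deterministic {F : Type*} [Field F] {len : F → ℕ} {P : Program}
    {env : List (Data F)} {e : Expr} {v v' : Data F} {t t' : ℕ}
    (h : Eval len P env e v t) (h' : Eval len P env e v' t') : v = v' ∧ t = t' := by
  induction h generalizing v' t' with
  | loc | nil | zero | one => cases h'; exact ⟨rfl, rfl⟩
  | pair _ _ ih₁ ih₂ | arith _ _ ih₁ ih₂ =>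
    cases h'
    rename_i h₁ h₂
    obtain ⟨rfl, rfl⟩ := ih₁ h₁
    obtain ⟨rfl, rfl⟩ := ih₂ h₂
    exact ⟨rfl, rfl⟩
  | head _ ih | tail _ ih | test _ ih =>
    cases h'
    rename_i h₁
    obtain ⟨rfl, rfl⟩ := ih h₁
    exact ⟨rfl, rfl⟩
  | condTrue _ hb _ ih₁ ih₂ =>
    cases h' with
    | condTrue h₁ _ h₂ =>
      obtain ⟨rfl, rfl⟩ := ih₁ h₁
      obtain ⟨rfl, rfl⟩ := ih₂ h₂
      exact ⟨rfl, rfl⟩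
    | condFalse h₁ _ => exact absurd (ih₁ h₁).1 hb
  | condFalse _ _ ih₁ ih₂ =>
    cases h' with
    | condTrue h₁ hb _ => exact absurd (ih₁ h₁).1.symm hb
    | condFalse h₁ h₂ =>
      obtain ⟨-, rfl⟩ := ih₁ h₁
      obtain ⟨rfl, rfl⟩ := ih₂ h₂
      exact ⟨rfl, rfl⟩
  | letIn _ _ ih₁ ih₂ =>
    cases h' with
    | letIn h₁ h₂ =>
      obtain ⟨rfl, rfl⟩ := ih₁ h₁
      obtain ⟨rfl, rfl⟩ := ih₂ h₂
      exact ⟨rfl, rfl⟩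
  | call _ hb _ ih₁ ih₂ =>
    cases h' with
    | call h₁ hb' h₂ =>
      obtain ⟨rfl, rfl⟩ := ih₁ h₁
      obtain rfl := Option.some.inj (hb.symm.trans hb')
      obtain ⟨rfl, rfl⟩ := ih₂ h₂
      exact ⟨rfl, rfl⟩

/-- On the input `x` the program `P` halts with the output `y` after exactly `t` steps. -/
def Program.Runs {F : Type*} [Field F] (len : F → ℕ) (P : Program) (x y : Data F) (t : ℕ) : Prop :=
  Eval len P [x] (.call 0 (.loc 0)) y t

/-- `len` measures the sizes of the elements in an efficient representation of the field `F`: the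
value of a polynomial with integer coefficients at elements of `F` has a size that is polynomially
bounded in the degree, the bit length of the coefficients, and the sizes of these elements. Examples
are the rationals with the bit length of reduced fractions, every finite field, and, for
every field, `len = 0`. -/
def EfficientlyRepresented {F : Type*} [Field F] (len : F → ℕ) : Prop :=
  ∃ q : Polynomial ℕ, ∀ (k : ℕ) (a : Fin k → F) (N : MvPolynomial (Fin k) ℤ),
    len (MvPolynomial.aeval a N) ≤
      q.eval (N.totalDegree + Nat.size (∑ m ∈ N.support, (N.coeff m).natAbs) + ∑ i, len (a i))

/-! ## Inputs and outputs -/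

def GateOp.encode {F : Type*} : GateOp → Data F
  | .plus => Data.ofNat 0
  | .times => Data.ofNat 1

def NCFormula.encode {F : Type*} : NCFormula F ℕ → Data F
  | .var i => .pair (Data.ofNat 0) (Data.ofNat i)
  | .const a => .pair (Data.ofNat 1) (.elt a)
  | .unary op f => .pair (Data.ofNat 2) (.pair op.encode f.encode)
  | .binary op f g => .pair (Data.ofNat 3) (.pair op.encode (.pair f.encode g.encode))

/-- The input: the formula, and the linear order on its variables, given as the increasing list of
these variables. -/
def encodeInput {F : Type*} (Φ : NCFormula F ℕ) (ord : LinearOrder ℕ) : Data F :=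
  .pair Φ.encode (Data.ofList ((Φ.vars.sort ord.le).map Data.ofNat))

/-- The output: `nil` for the answer false, otherwise a formula. -/
def encodeOutput {F : Type*} : Option (NCFormula F ℕ) → Data F
  | none => .nil
  | some Ψ => Ψ.encode

end OrderedFormulas

/-! A polynomial is ordered exactly if every word in its support is nondecreasing, so sums of
ordered polynomials are ordered and only product gates matter. If `f` and `g` are ordered, then `f *
g` is ordered iff every variable occurring in `f` is at most every variable occurring in `g`
(`isOrderedPoly_mul_iff`): a violating pair of words gives a concatenation whose coefficient has
only one nonvanishing contribution, so nothing can cancel. Hence `process` works bottom-up. At a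
product gate it rejects if some variable of the right polynomial strictly precedes one of the left
polynomial. Otherwise it sets to 0, in each factor, the variables that do not occur in the
polynomial of that factor. This changes neither polynomial nor size, and afterwards the variables
labelling leaves are those that occur, so the order of the polynomials becomes an order of the
formulas (`process_sound`, `process_complete`).

What has to be decided is occurrence. Since `x` occurs in `G` iff `G - G(0/x)` is not zero, a zero
test for noncommutative formulas suffices. The position automaton of a formula has one state
coordinate per variable leaf and one for the entrance. Its transitions are linear, and the
coefficient of a word is a linear functional of the state that the word reaches
(`series_eq_output`). The polynomial vanishes iff this functional vanishes on the span of the states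
reached by words of length at most the size of the formula. A basis of reached states is found by
repeatedly inserting the successors of the basis vectors (`poly_eq_zero_iff`).

The field elements must stay short. Basis vectors are stored as states actually reached, whose
entries are integer polynomials of controlled degree and coefficients in the constants of the input.
The elimination is fraction-free: its reduced rows are combinations of these states with cofactors
as coefficients (`IsReduced.eq_sum`), so they are controlled in the same way, and
`EfficientlyRepresented` bounds their lengths. The rest verifies the program: a weakest precondition
calculus that carries cost bounds reduces each function to the mathematical operation it implements.
-/

namespace OrderedFormulas

/-! ### Coefficients of noncommutative polynomials; products of ordered polynomials -/

section Series

variable {F V : Type*} [Field F]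

/-- The coefficient function of a noncommutative polynomial, on words given as lists. -/
noncomputable def series (h : NCPoly F V) (w : List V) : F := h.coeff (FreeMonoid.ofList w)

theorem series_ext {g h : NCPoly F V} (H : ∀ w, series g w = series h w) : g = h := by
  apply MonoidAlgebra.ext
  ext w
  exact H w.toList

theorem series_add (g h : NCPoly F V) (w : List V) : series (g + h) w = series g w + series h w := by
  simp [series]

/-- The factorizations of a word are its cuts, and a cut is determined by the length of its prefix.
-/
theorem series_mul (g h : NCPoly F V) (w : List V) :
    series (g * h) w =
      ∑ i ∈ Finset.range (w.length + 1), series g (w.take i) * series h (w.drop i) := by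
  classical
  unfold series
  rw [MonoidAlgebra.coeff_mul_antidiag g h _ ((Finset.range (w.length + 1)).image
    fun i => (FreeMonoid.ofList (w.take i), FreeMonoid.ofList (w.drop i)))]
  · rw [Finset.sum_image]
    intro i hi j hj hij
    have h1 : w.take i = w.take j := FreeMonoid.ofList.injective (Prod.ext_iff.1 hij).1
    have h2 := congrArg List.length h1
    simp only [Finset.coe_range, Set.mem_Iio] at hi hj
    simp only [List.length_take] at h2
    omega
  · rintro ⟨p, q⟩
    simp only [Finset.mem_image, Finset.mem_range, Prod.mk.injEq]
    constructor
    · rintro ⟨i, -, rfl, rfl⟩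
      rw [← FreeMonoid.ofList_append, List.take_append_drop]
    · intro hpq
      have hw : w = p.toList ++ q.toList := by
        have := congrArg FreeMonoid.toList hpq
        simpa using this.symm
      refine ⟨p.toList.length, ?_, ?_, ?_⟩
      · rw [hw]; simp
      · rw [hw]; simp
      · rw [hw]; simp

theorem occursIn_iff (x : V) (h : NCPoly F V) : OccursIn x h ↔ ∃ w, series h w ≠ 0 ∧ x ∈ w :=
  ⟨fun ⟨w, h1, h2⟩ => ⟨w.toList, h1, h2⟩, fun ⟨w, h1, h2⟩ => ⟨FreeMonoid.ofList w, h1, h2⟩⟩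

theorem series_orderedLift (ord : LinearOrder V) (f : MvPolynomial V F) (w : List V)
    [Decidable (w.Pairwise ord.le)] :
    series (orderedLift ord f) w =
      if w.Pairwise ord.le then f.coeff (Multiset.toFinsupp (w : Multiset V)) else 0 := by
  classical
  have key : ∀ m : V →₀ ℕ, orderedWord ord m = FreeMonoid.ofList w ↔
      w.Pairwise ord.le ∧ m = Multiset.toFinsupp (w : Multiset V) := by
    intro m
    unfold orderedWord
    rw [FreeMonoid.ofList.injective.eq_iff]
    constructor
    · rintro rfl
      refine ⟨Multiset.pairwise_sort _ _, ?_⟩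
      rw [Multiset.sort_eq, Finsupp.toMultiset_toFinsupp]
    · rintro ⟨h, rfl⟩
      rw [Multiset.toFinsupp_toMultiset]
      have h1 := Multiset.pairwise_sort (w : Multiset V) ord.le
      have h2 : (Multiset.sort (w : Multiset V) ord.le).Perm w := by
        rw [← Multiset.coe_eq_coe, Multiset.sort_eq]
      exact List.Perm.eq_of_pairwise (fun a b _ _ => ord.le_antisymm a b) h1 h h2
  unfold series orderedLift
  simp only [MonoidAlgebra.coeff_sum, MonoidAlgebra.coeff_single, Finsupp.finsetSum_apply,
    Finsupp.single_apply, key]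
  split_ifs with hw
  · simp only [hw, true_and, Finset.sum_ite_eq', MvPolynomial.mem_support_iff]
    by_cases h : f.coeff (Multiset.toFinsupp (w : Multiset V)) = 0 <;> simp [h]
  · simp [hw]

/-- A nondecreasing word is determined by the multiset of its letters. So sending each word of the
support to its commutative monomial merges no coefficients, and lifting back recovers `h`. -/
theorem isOrderedPoly_iff (ord : LinearOrder V) (h : NCPoly F V) :
    IsOrderedPoly ord h ↔ ∀ w, series h w ≠ 0 → w.Pairwise ord.le := by
  classical
  constructor
  · rintro ⟨f, rfl⟩ w hw
    rw [series_orderedLift] at hw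
    by_contra hc
    simp [hc] at hw
  · intro H
    refine ⟨∑ w ∈ h.coeff.support, MvPolynomial.monomial
      (Multiset.toFinsupp (w.toList : Multiset V)) (h.coeff w), ?_⟩
    apply series_ext
    intro w
    rw [series_orderedLift]
    split_ifs with hw
    · rw [MvPolynomial.coeff_sum]
      simp only [MvPolynomial.coeff_monomial]
      rw [Finset.sum_eq_single (FreeMonoid.ofList w)]
      · simp [series]
      · intro b hb hne
        rw [if_neg]
        intro hbw
        apply hne
        have h1 : (b.toList : Multiset V) = w := Multiset.toFinsupp.injective hbw
        have h2 : b.toList.Pairwise ord.le := H b.toList (by simpa [series] using hb)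
        have h3 := List.Perm.eq_of_pairwise (fun a b _ _ => ord.le_antisymm a b) h2 hw
          (Multiset.coe_eq_coe.1 h1)
        rw [← h3]; rfl
      · intro hb
        simp only [Finsupp.mem_support_iff, not_not] at hb
        simp [hb]
    · by_contra hc
      exact hw (H w (fun h0 => hc h0.symm))

/-- The combinatorial core: for ordered factors no cancellation can hide a descent from `f` to `g`.
If `x` in the word `u` of `f` and `y` in the word `v` of `g` form a descent, every cut of `u ++ v`
other than the one between `u` and `v` contributes 0. -/
theorem isOrderedPoly_mul_iff {ord : LinearOrder V} {f g : NCPoly F V} (hf : IsOrderedPoly ord f)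
    (hg : IsOrderedPoly ord g) :
    IsOrderedPoly ord (f * g) ↔ ∀ x y, OccursIn x f → OccursIn y g → ord.le x y := by
  rw [isOrderedPoly_iff] at *
  simp only [occursIn_iff]
  constructor
  · rintro H x y ⟨u, hu, hx⟩ ⟨v, hv, hy⟩
    by_contra hxy
    have hne : series (f * g) (u ++ v) ≠ 0 := by
      rw [series_mul, Finset.sum_eq_single u.length]
      · simp [hu, hv]
      · intro i hi hne
        rcases lt_or_gt_of_ne hne with h | h
        -- A shorter prefix leaves the last letter of `u` together with `y` in a word of `g`. Then
        -- `x` is at most that letter and that letter at most `y`.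
        · by_contra hc
          have h2 := hg _ (right_ne_zero_of_mul hc)
          rw [List.drop_append_of_le_length h.le, List.pairwise_append] at h2
          have hu0 : u ≠ [] := List.ne_nil_of_mem hx
          have hlast : u.getLast hu0 ∈ u.drop i := by
            rw [List.getLast_eq_getElem, List.mem_drop_iff_getElem]
            exact ⟨u.length - 1 - i, by omega, by congr 1; omega⟩
          have hxl : ord.le x (u.getLast hu0) := by
            have h3 := hf _ hu
            rw [← List.dropLast_append_getLast hu0] at h3 hx
            rcases List.mem_append.1 hx with hx | hx
            · exact (List.pairwise_append.1 h3).2.2 x hx _ (by simp)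
            · rw [List.mem_singleton.1 hx]
          exact hxy (ord.le_trans _ _ _ hxl (h2.2.2 _ hlast y hy))
        -- A longer prefix puts `x` and the first letter `z` of `v` into one word of `f`, so `x` is
        -- at most `z` and `z` is at most `y`.
        · by_contra hc
          have h2 := hf _ (left_ne_zero_of_mul hc)
          obtain ⟨z, v', rfl⟩ := List.exists_cons_of_ne_nil (List.ne_nil_of_mem hy)
          have hi' : i - u.length = (i - u.length - 1) + 1 := by omega
          rw [List.take_append, List.take_of_length_le h.le, List.pairwise_append, hi',
            List.take_succ_cons] at h2
          have h3 := h2.2.2 x hx z (by simp)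
          rcases List.mem_cons.1 hy with rfl | hy
          · exact hxy h3
          · exact hxy (ord.le_trans _ _ _ h3 ((List.pairwise_cons.1 (hg _ hv)).1 y hy))
      · simp
    exact hxy ((List.pairwise_append.1 (H _ hne)).2.2 x hx y hy)
  · intro H w hw
    rw [series_mul] at hw
    obtain ⟨i, -, hi⟩ := Finset.exists_ne_zero_of_sum_ne_zero hw
    rw [← List.take_append_drop i w, List.pairwise_append]
    have h1 := left_ne_zero_of_mul hi
    have h2 := right_ne_zero_of_mul hi
    exact ⟨hf _ h1, hg _ h2, fun x hx y hy => H x y ⟨_, h1, hx⟩ ⟨_, h2, hy⟩⟩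

end Series

end OrderedFormulas

namespace OrderedFormulas

/-! ### Supports of formulas, zeroing of variables, and inheritance of order -/

namespace NCFormula

section Leaves

variable {F V : Type*}

/-- All leaves of the formula satisfy the given conditions on variables and constants. -/
def AllLeaves (pv : V → Prop) (pc : F → Prop) : NCFormula F V → Prop
  | var x => pv x
  | const a => pc a
  | unary _ f => f.AllLeaves pv pc
  | binary _ f g => f.AllLeaves pv pc ∧ g.AllLeaves pv pc

theorem AllLeaves.mono {pv pv' : V → Prop} {pc pc' : F → Prop} {G : NCFormula F V}
    (h : G.AllLeaves pv pc) (hv : ∀ x, pv x → pv' x) (hc : ∀ a, pc a → pc' a) :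
    G.AllLeaves pv' pc' := by
  induction G with
  | var y => exact hv _ h
  | const a => exact hc _ h
  | unary op f ih => exact ih h
  | binary op f g ihf ihg => exact ⟨ihf h.1, ihg h.2⟩

theorem AllLeaves.of_mem_vars [DecidableEq V] {pv : V → Prop} {pc : F → Prop} {G : NCFormula F V}
    (h : G.AllLeaves pv pc) {x : V} (hx : x ∈ G.vars) : pv x := by
  induction G with
  | var y => rw [vars, Finset.mem_singleton] at hx; exact hx ▸ h
  | const a => simp [vars] at hx
  | unary op f ih => exact ih h hx
  | binary op f g ihf ihg =>
    rcases Finset.mem_union.1 hx with hx | hx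
    · exact ihf h.1 hx
    · exact ihg h.2 hx

end Leaves

section Basic

variable {F V : Type*} [Field F]

theorem series_var [DecidableEq V] (x : V) (w : List V) :
    series (NCFormula.var x : NCFormula F V).poly w = if w = [x] then 1 else 0 := by
  classical
  simp only [series, poly, MonoidAlgebra.coeff_single, Finsupp.single_apply]
  congr 1
  rw [← FreeMonoid.ofList_singleton, FreeMonoid.ofList.injective.eq_iff]
  exact propext eq_comm

theorem series_const [DecidableEq V] (a : F) (w : List V) :
    series (NCFormula.const a : NCFormula F V).poly w = if w = [] then a else 0 := by
  classical
  simp only [series, poly, MonoidAlgebra.coeff_single, Finsupp.single_apply]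
  congr 1
  rw [← FreeMonoid.ofList_nil, FreeMonoid.ofList.injective.eq_iff]
  exact propext eq_comm

theorem mem_vars_of_series_ne_zero [DecidableEq V] (G : NCFormula F V) {w : List V}
    (hw : series G.poly w ≠ 0) {x : V} (hx : x ∈ w) : x ∈ G.vars := by
  induction G generalizing w with
  | var y => rw [series_var] at hw; simp_all [vars]
  | const a => rw [series_const] at hw; simp_all
  | unary op f ih => exact ih hw hx
  | binary op f g ihf ihg =>
    rw [vars, Finset.mem_union]
    cases op with
    | plus =>
      rw [poly, series_add] at hw
      by_cases h : series f.poly w = 0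
      · rw [h, zero_add] at hw; exact .inr (ihg hw hx)
      · exact .inl (ihf h hx)
    | times =>
      rw [poly, series_mul] at hw
      obtain ⟨i, -, hi⟩ := Finset.exists_ne_zero_of_sum_ne_zero hw
      rw [← List.take_append_drop i w, List.mem_append] at hx
      exact hx.imp (ihf (left_ne_zero_of_mul hi)) (ihg (right_ne_zero_of_mul hi))

theorem mem_vars_of_occursIn [DecidableEq V] (G : NCFormula F V) {x : V}
    (hx : OccursIn x G.poly) : x ∈ G.vars := by
  obtain ⟨w, h1, h2⟩ := (occursIn_iff _ _).1 hx
  exact mem_vars_of_series_ne_zero G h1 h2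

/-- The degree is at most the number of nodes; this limits the words that the zero test has to
consider. -/
theorem length_le_of_series_ne_zero (G : NCFormula F V) {w : List V}
    (hw : series G.poly w ≠ 0) : w.length ≤ G.size := by
  classical
  induction G generalizing w with
  | var y => rw [series_var] at hw; simp_all [size]
  | const a => rw [series_const] at hw; simp_all
  | unary op f ih => exact (ih hw).trans (Nat.le_succ _)
  | binary op f g ihf ihg =>
    rw [size]
    cases op with
    | plus =>
      rw [poly, series_add] at hw
      by_cases h : series f.poly w = 0
      · rw [h, zero_add] at hw; have := ihg hw; omega
      · have := ihf h; omega
    | times =>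
      rw [poly, series_mul] at hw
      obtain ⟨i, -, hi⟩ := Finset.exists_ne_zero_of_sum_ne_zero hw
      have h1 := ihf (left_ne_zero_of_mul hi)
      have h2 := ihg (right_ne_zero_of_mul hi)
      rw [← List.take_append_drop i w, List.length_append]
      omega

/-- A word contains `x` iff, for any cut, one of its two parts does; hence deleting the words with
`x` commutes with products as well as with sums. -/
theorem series_zeroVar [DecidableEq V] (x : V) (G : NCFormula F V) (w : List V) :
    series (G.zeroVar x).poly w = if x ∈ w then 0 else series G.poly w := by
  induction G generalizing w with
  | var y =>
    rw [zeroVar]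
    by_cases hy : y = x
    · subst hy
      rw [if_pos rfl, series_const, series_var]
      split_ifs <;> simp_all
    · rw [if_neg hy, series_var]
      split_ifs <;> simp_all
  | const a =>
    rw [zeroVar, series_const]
    split_ifs <;> simp_all
  | unary op f ih => exact ih w
  | binary op f g ihf ihg =>
    cases op with
    | plus =>
      rw [zeroVar, poly, poly, series_add, series_add, ihf, ihg]
      split_ifs <;> simp
    | times =>
      rw [zeroVar, poly, poly, series_mul, series_mul]
      split_ifs with h
      · apply Finset.sum_eq_zero
        intro i _
        rw [ihf, ihg]
        rw [← List.take_append_drop i w, List.mem_append] at h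
        rcases h with h | h <;> simp [h]
      · apply Finset.sum_congr rfl
        intro i _
        rw [ihf, ihg, if_neg fun h' => h (List.mem_of_mem_take h'),
          if_neg fun h' => h (List.mem_of_mem_drop h')]

/-- This justifies the zeroing steps and at the same time turns occurrence of a variable into an
identity test. -/
theorem poly_zeroVar_eq_iff [DecidableEq V] (x : V) (G : NCFormula F V) :
    (G.zeroVar x).poly = G.poly ↔ ¬ OccursIn x G.poly := by
  rw [occursIn_iff]
  push Not
  constructor
  · intro h w hw hx
    apply hw
    rw [← h, series_zeroVar, if_pos hx]
  · intro h
    apply series_ext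
    intro w
    rw [series_zeroVar]
    split_ifs with hx
    · by_contra hc
      exact h w (Ne.symm hc) hx
    · rfl

theorem size_zeroVar [DecidableEq V] (x : V) (G : NCFormula F V) : (G.zeroVar x).size = G.size := by
  induction G with
  | var y => rw [zeroVar]; split_ifs <;> rfl
  | const a => rfl
  | unary op f ih => simp [zeroVar, size, ih]
  | binary op f g ihf ihg => simp [zeroVar, size, ihf, ihg]

theorem vars_zeroVar [DecidableEq V] (x : V) (G : NCFormula F V) :
    (G.zeroVar x).vars = G.vars.erase x := by
  induction G with
  | var y => rw [zeroVar]; split_ifs with h <;> simp [vars, h]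
             exact (Finset.erase_eq_of_notMem (by simpa using Ne.symm h)).symm
  | const a => simp [zeroVar, vars]
  | unary op f ih => simp [zeroVar, vars, ih]
  | binary op f g ihf ihg => simp [zeroVar, vars, ihf, ihg, Finset.erase_union_distrib]

theorem AllLeaves.zeroVar [DecidableEq V] {pv : V → Prop} {pc : F → Prop} (h0 : pc 0) (x : V)
    {G : NCFormula F V} (h : G.AllLeaves pv pc) : (G.zeroVar x).AllLeaves pv pc := by
  induction G with
  | var y => rw [NCFormula.zeroVar]; split_ifs <;> assumption
  | const a => exact h
  | unary op f ih => exact ih h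
  | binary op f g ihf ihg => exact ⟨ihf h.1, ihg h.2⟩

theorem isOrdered_unary {ord : LinearOrder V} {op : GateOp} {f : NCFormula F V} :
    (unary op f).IsOrdered ord ↔ f.IsOrdered ord := by
  constructor
  · exact fun h G hG => h G (.unary hG)
  · intro h G hG
    cases hG with
    | refl => exact h f .refl
    | unary hG => exact h G hG

theorem isOrdered_binary {ord : LinearOrder V} {op : GateOp} {f g : NCFormula F V} :
    (binary op f g).IsOrdered ord ↔
      IsOrderedPoly ord (binary op f g).poly ∧ f.IsOrdered ord ∧ g.IsOrdered ord := by
  constructor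
  · exact fun h => ⟨h _ .refl, fun G hG => h G (.left hG), fun G hG => h G (.right hG)⟩
  · rintro ⟨h, hf, hg⟩ G hG
    cases hG with
    | refl => exact h
    | left hG => exact hf G hG
    | right hG => exact hg G hG

theorem isSyntacticOrdered_unary [DecidableEq V] {ord : LinearOrder V} {op : GateOp}
    {f : NCFormula F V} :
    (unary op f).IsSyntacticOrdered ord ↔ f.IsSyntacticOrdered ord := by
  unfold IsSyntacticOrdered
  rw [isOrdered_unary]
  refine and_congr_right fun _ => ⟨fun h g₁ g₂ hg => h g₁ g₂ (.unary hg), fun h g₁ g₂ hg => ?_⟩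
  cases hg with
  | unary hg => exact h g₁ g₂ hg

theorem isSyntacticOrdered_binary [DecidableEq V] {ord : LinearOrder V} {op : GateOp}
    {f g : NCFormula F V} :
    (binary op f g).IsSyntacticOrdered ord ↔
      IsOrderedPoly ord (binary op f g).poly ∧
      (op = .times → ∀ x ∈ f.vars, ∀ y ∈ g.vars, ord.le x y) ∧
      f.IsSyntacticOrdered ord ∧ g.IsSyntacticOrdered ord := by
  unfold IsSyntacticOrdered
  rw [isOrdered_binary]
  constructor
  · rintro ⟨⟨h, hf, hg⟩, H⟩
    refine ⟨h, ?_, ⟨hf, fun g₁ g₂ hs => H _ _ (.left hs)⟩, ⟨hg, fun g₁ g₂ hs => H _ _ (.right hs)⟩⟩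
    rintro rfl
    exact H f g .refl
  · rintro ⟨h, H, ⟨hf, Hf⟩, ⟨hg, Hg⟩⟩
    refine ⟨⟨h, hf, hg⟩, fun g₁ g₂ hs => ?_⟩
    cases hs with
    | refl => exact H rfl
    | left hs => exact Hf _ _ hs
    | right hs => exact Hg _ _ hs

theorem isOrderedPoly_zeroVar [DecidableEq V] {ord : LinearOrder V} {G : NCFormula F V}
    (h : IsOrderedPoly ord G.poly) (x : V) : IsOrderedPoly ord (G.zeroVar x).poly := by
  rw [isOrderedPoly_iff] at *
  intro w hw
  rw [series_zeroVar] at hw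
  exact h w fun h0 => hw (by simp [h0])

/-- Zeroing only removes words from supports and variables from leaves, at every node. So cleaning a
factor preserves what has been achieved at the gates below it. -/
theorem IsSyntacticOrdered.zeroVar [DecidableEq V] {ord : LinearOrder V} {G : NCFormula F V}
    (h : G.IsSyntacticOrdered ord) (x : V) : (G.zeroVar x).IsSyntacticOrdered ord := by
  induction G with
  | var y =>
    refine ⟨fun G hG => ?_, fun f g hs => ?_⟩
    · have h1 := isOrderedPoly_zeroVar (h.1 _ .refl) x
      revert hG h1
      rw [NCFormula.zeroVar]
      split_ifs <;> · rintro ⟨⟩ h1; exact h1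
    · revert hs
      rw [NCFormula.zeroVar]
      split_ifs <;> · rintro ⟨⟩
  | const a => exact h
  | unary op f ih =>
    rw [NCFormula.zeroVar]
    rw [isSyntacticOrdered_unary] at *
    exact ih h
  | binary op f g ihf ihg =>
    have h1 := isOrderedPoly_zeroVar (h.1 _ .refl) x
    rw [NCFormula.zeroVar] at *
    rw [isSyntacticOrdered_binary] at *
    refine ⟨h1, fun hop y hy z hz => ?_, ihf h.2.2.1, ihg h.2.2.2⟩
    rw [vars_zeroVar] at hy hz
    exact h.2.1 hop y (Finset.mem_of_mem_erase hy) z (Finset.mem_of_mem_erase hz)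

end Basic

/-! ### From ordered to syntactic ordered formulas -/

section OrderedToSyntactic

variable {F : Type*} [Field F]

theorem ZeroesOutTo.unary {op : GateOp} {f f' : NCFormula F ℕ} (h : f.ZeroesOutTo f') :
    (unary op f).ZeroesOutTo (.unary op f') :=
  Relation.ReflTransGen.lift _ (fun _ _ h => ZeroStep.unary h) _ _ h

theorem ZeroesOutTo.binary {op : GateOp} {f f' g g' : NCFormula F ℕ} (h : f.ZeroesOutTo f')
    (h' : g.ZeroesOutTo g') : (binary op f g).ZeroesOutTo (.binary op f' g') :=
  (Relation.ReflTransGen.lift (fun f => NCFormula.binary op f g) (fun _ _ h => ZeroStep.left h) _ _ h).trans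
    (Relation.ReflTransGen.lift (fun g => NCFormula.binary op f' g) (fun _ _ h => ZeroStep.right h) _ _ h')

open Classical in
/-- Replace by `0` those variables of the list that do not occur in the polynomial. -/
noncomputable def clean : List ℕ → NCFormula F ℕ → NCFormula F ℕ
  | [], G => G
  | x :: X, G => clean X (if OccursIn x G.poly then G else G.zeroVar x)

/-- Every zeroing preserves the polynomial, so each later test still concerns the polynomial of the
original `G`. A variable of `X` remaining at a leaf has passed its test, as zeroing never brings a
variable back. -/
theorem clean_spec (X : List ℕ) (G : NCFormula F ℕ) :
    (clean X G).poly = G.poly ∧ (clean X G).size = G.size ∧ (clean X G).vars ⊆ G.vars ∧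
    (∀ x ∈ X, x ∈ (clean X G).vars → OccursIn x G.poly) ∧ G.ZeroesOutTo (clean X G) ∧
    (∀ ord, G.IsSyntacticOrdered ord → (clean X G).IsSyntacticOrdered ord) ∧
    (∀ pv pc, pc 0 → G.AllLeaves pv pc → (clean X G).AllLeaves pv pc) := by
  induction X generalizing G with
  | nil => simp [clean, ZeroesOutTo, Relation.ReflTransGen.refl]
  | cons x X ih =>
    rw [clean]
    split_ifs with hx
    · obtain ⟨h1, h2, h3, h4, h5, h6, h7⟩ := ih G
      refine ⟨h1, h2, h3, fun y hy hy' => ?_, h5, h6, h7⟩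
      rcases List.mem_cons.1 hy with rfl | hy
      · exact hx
      · exact h4 y hy hy'
    · obtain ⟨h1, h2, h3, h4, h5, h6, h7⟩ := ih (G.zeroVar x)
      have hp := (poly_zeroVar_eq_iff x G).2 hx
      rw [vars_zeroVar] at h3
      refine ⟨h1.trans hp, h2.trans (size_zeroVar x G), h3.trans (Finset.erase_subset _ _),
        fun y hy hy' => ?_, .head (.here G x hx) h5,
        fun ord h => h6 ord (h.zeroVar x), fun pv pc h0 h => h7 pv pc h0 (h.zeroVar h0 x)⟩
      rcases List.mem_cons.1 hy with rfl | hy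
      · exact absurd (h3 hy') (Finset.notMem_erase _ _)
      · exact hp ▸ h4 y hy hy'

/-- No variable of the second polynomial precedes, in the list, a variable of the first one. -/
def NoDescent (L : List ℕ) (f g : NCFormula F ℕ) : Prop :=
  L.Pairwise fun y x => OccursIn y g.poly → ¬ OccursIn x f.poly

/-- The machine sees the order only as the list `L`; since `L` is strictly increasing, its positions
express `ord` on the variables in question. -/
theorem noDescent_iff {ord : LinearOrder ℕ} {L : List ℕ}
    (hL : L.Pairwise fun a b => ord.le a b ∧ a ≠ b) {f g : NCFormula F ℕ}
    (hf : ∀ x ∈ f.vars, x ∈ L) (hg : ∀ x ∈ g.vars, x ∈ L) :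
    NoDescent L f g ↔ ∀ x y, OccursIn x f.poly → OccursIn y g.poly → ord.le x y := by
  unfold NoDescent
  constructor
  · intro h x y hx hy
    by_cases hxy : x = y
    · exact hxy ▸ ord.le_refl x
    -- `List.Pairwise.forall` needs a symmetric relation, so the alternative with `a` and `b`
    -- exchanged is added.
    have h1 := (h.and hL).imp (S := fun a b =>
      (((OccursIn a g.poly → ¬ OccursIn b f.poly) ∧ ord.le a b) ∨
        ((OccursIn b g.poly → ¬ OccursIn a f.poly) ∧ ord.le b a))) fun {a b} hab =>
      .inl ⟨hab.1, hab.2.1⟩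
    have : Std.Symm fun a b => ((OccursIn a g.poly → ¬ OccursIn b f.poly) ∧ ord.le a b) ∨
        ((OccursIn b g.poly → ¬ OccursIn a f.poly) ∧ ord.le b a) := ⟨fun _ _ hab => hab.symm⟩
    have h2 := h1.forall
      (hf x (f.mem_vars_of_occursIn hx)) (hg y (g.mem_vars_of_occursIn hy)) hxy
    rcases h2 with h2 | h2
    · exact h2.2
    · exact absurd hx (h2.1 hy)
  · intro H
    exact hL.imp fun {y x} hyx hy hx => hyx.2 (ord.le_antisymm _ _ hyx.1 (H x y hx hy))

open Classical in
/-- The transformation of ordered formulas to syntactic ordered formulas; `none` if the formula is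
not ordered. -/
noncomputable def process (L : List ℕ) : NCFormula F ℕ → Option (NCFormula F ℕ)
  | var x => some (var x)
  | const a => some (const a)
  | unary op f => (process L f).map (unary op)
  | binary .plus f g => (process L f).bind fun f' => (process L g).map fun g' => binary .plus f' g'
  | binary .times f g => (process L f).bind fun f' => (process L g).bind fun g' =>
      if NoDescent L f' g' then some (binary .times (clean L f') (clean L g')) else none

/-- The clause on leaves serves the cost analysis: the constants of the new formula are old ones or
0, so the size bounds made for the input remain valid for every intermediate formula. -/
theorem process_sound {L : List ℕ} {G G' : NCFormula F ℕ} (h : process L G = some G') :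
    G'.poly = G.poly ∧ G'.size = G.size ∧ G'.vars ⊆ G.vars ∧ G.ZeroesOutTo G' ∧
    (∀ pv pc, pc 0 → G.AllLeaves pv pc → G'.AllLeaves pv pc) := by
  induction G generalizing G' with
  | var x => cases h; exact ⟨rfl, rfl, subset_rfl, .refl, fun _ _ _ h => h⟩
  | const x => cases h; exact ⟨rfl, rfl, subset_rfl, .refl, fun _ _ _ h => h⟩
  | unary op f ih =>
    rw [process, Option.map_eq_some_iff] at h
    obtain ⟨f', hf, rfl⟩ := h
    obtain ⟨h1, h2, h3, h4, h5⟩ := ih hf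
    exact ⟨h1, by simp [size, h2], h3, h4.unary, h5⟩
  | binary op f g ihf ihg =>
    cases op with
    | plus =>
      simp only [process, Option.bind_eq_some_iff, Option.map_eq_some_iff] at h
      obtain ⟨f', hf, g', hg, rfl⟩ := h
      obtain ⟨h1, h2, h3, h4, h5⟩ := ihf hf
      obtain ⟨k1, k2, k3, k4, k5⟩ := ihg hg
      exact ⟨by simp [poly, h1, k1], by simp [size, h2, k2], Finset.union_subset_union h3 k3,
        h4.binary k4, fun pv pc h0 h => ⟨h5 pv pc h0 h.1, k5 pv pc h0 h.2⟩⟩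
    | times =>
      simp only [process, Option.bind_eq_some_iff, Option.ite_none_right_eq_some,
        Option.some.injEq] at h
      obtain ⟨f', hf, g', hg, -, rfl⟩ := h
      obtain ⟨h1, h2, h3, h4, h5⟩ := ihf hf
      obtain ⟨k1, k2, k3, k4, k5⟩ := ihg hg
      obtain ⟨c1, c2, c3, -, c5, -, c7⟩ := clean_spec L f'
      obtain ⟨d1, d2, d3, -, d5, -, d7⟩ := clean_spec L g'
      exact ⟨by simp [poly, h1, k1, c1, d1], by simp [size, h2, k2, c2, d2],
        Finset.union_subset_union (c3.trans h3) (d3.trans k3),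
        ZeroesOutTo.binary (h4.trans c5) (k4.trans d5),
        fun pv pc h0 h => ⟨c7 pv pc h0 (h5 pv pc h0 h.1), d7 pv pc h0 (k5 pv pc h0 h.2)⟩⟩

/-- The test at a product gate is exact by `isOrderedPoly_mul_iff`, applied to `f` and `g`, which
have the same polynomials as the processed factors. Both directions are proved in one induction
because exactness presupposes that the factors are ordered. -/
theorem process_complete {ord : LinearOrder ℕ} {L : List ℕ}
    (hL : L.Pairwise fun a b => ord.le a b ∧ a ≠ b) {G : NCFormula F ℕ}
    (hG : ∀ x ∈ G.vars, x ∈ L) :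
    (G.IsOrdered ord → ∃ G', process L G = some G') ∧
    (∀ G', process L G = some G' → G.IsOrdered ord ∧ G'.IsSyntacticOrdered ord) := by
  induction G with
  | var x =>
    refine ⟨fun _ => ⟨_, rfl⟩, ?_⟩
    rintro _ ⟨⟩
    have h : (var x : NCFormula F ℕ).IsOrdered ord := by
      rintro _ ⟨⟩
      rw [isOrderedPoly_iff]
      intro w hw
      rw [series_var] at hw
      simp only [ne_eq, ite_eq_right_iff, one_ne_zero, imp_false, not_not] at hw
      simp [hw]
    exact ⟨h, h, by rintro _ _ ⟨⟩⟩
  | const a =>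
    refine ⟨fun _ => ⟨_, rfl⟩, ?_⟩
    rintro _ ⟨⟩
    have h : (const a : NCFormula F ℕ).IsOrdered ord := by
      rintro _ ⟨⟩
      rw [isOrderedPoly_iff]
      intro w hw
      rw [series_const] at hw
      simp only [ne_eq, ite_eq_right_iff, not_forall] at hw
      simp [hw.1]
    exact ⟨h, h, by rintro _ _ ⟨⟩⟩
  | unary op f ih =>
    obtain ⟨h1, h2⟩ := ih hG
    rw [isOrdered_unary]
    constructor
    · intro h
      obtain ⟨f', hf⟩ := h1 h
      exact ⟨_, by rw [process, hf]; rfl⟩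
    · intro G' h
      rw [process, Option.map_eq_some_iff] at h
      obtain ⟨f', hf, rfl⟩ := h
      rw [isSyntacticOrdered_unary]
      exact h2 f' hf
  | binary op f g ihf ihg =>
    have hGf : ∀ x ∈ f.vars, x ∈ L := fun x hx => hG x (Finset.mem_union_left _ hx)
    have hGg : ∀ x ∈ g.vars, x ∈ L := fun x hx => hG x (Finset.mem_union_right _ hx)
    obtain ⟨h1, h2⟩ := ihf hGf
    obtain ⟨k1, k2⟩ := ihg hGg
    rw [isOrdered_binary]
    cases op with
    | plus =>
      constructor
      · rintro ⟨-, hf, hg⟩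
        obtain ⟨f', hf⟩ := h1 hf
        obtain ⟨g', hg⟩ := k1 hg
        exact ⟨_, by rw [process, hf, hg]; rfl⟩
      · intro G' h
        have hs := process_sound h
        simp only [process, Option.bind_eq_some_iff, Option.map_eq_some_iff] at h
        obtain ⟨f', hf, g', hg, rfl⟩ := h
        have hp : IsOrderedPoly ord (binary .plus f g).poly := by
          have hf1 := (h2 f' hf).1 f .refl
          have hg1 := (k2 g' hg).1 g .refl
          rw [isOrderedPoly_iff] at *
          intro w hw
          rw [poly, series_add] at hw
          by_cases h0 : series f.poly w = 0
          · exact hg1 w fun h' => hw (by rw [h0, h', add_zero])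
          · exact hf1 w h0
        refine ⟨⟨hp, (h2 f' hf).1, (k2 g' hg).1⟩, ?_⟩
        rw [isSyntacticOrdered_binary, hs.1]
        exact ⟨hp, nofun, (h2 f' hf).2, (k2 g' hg).2⟩
    | times =>
      constructor
      · rintro ⟨hp, hf0, hg0⟩
        obtain ⟨f', hf⟩ := h1 hf0
        obtain ⟨g', hg⟩ := k1 hg0
        have sf := process_sound hf
        have sg := process_sound hg
        refine ⟨binary .times (clean L f') (clean L g'), ?_⟩
        · rw [process, hf, hg]
          simp only [Option.bind_some]
          rw [if_pos]
          rw [noDescent_iff hL (fun x hx => hGf x (sf.2.2.1 hx)) (fun x hx => hGg x (sg.2.2.1 hx)),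
            sf.1, sg.1]
          exact (isOrderedPoly_mul_iff (hf0 f .refl) (hg0 g .refl)).1 hp
      · intro G' h
        have hs := process_sound h
        simp only [process, Option.bind_eq_some_iff, Option.ite_none_right_eq_some,
          Option.some.injEq] at h
        obtain ⟨f', hf, g', hg, hd, rfl⟩ := h
        have sf := process_sound hf
        have sg := process_sound hg
        have hf1 := h2 f' hf
        have hg1 := k2 g' hg
        rw [noDescent_iff hL (fun x hx => hGf x (sf.2.2.1 hx))
          (fun x hx => hGg x (sg.2.2.1 hx))] at hd
        have hp : IsOrderedPoly ord (binary .times f g).poly := by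
          rw [poly, isOrderedPoly_mul_iff (hf1.1 f .refl) (hg1.1 g .refl)]
          rwa [sf.1, sg.1] at hd
        obtain ⟨c1, -, c3, c4, -, c6, -⟩ := clean_spec L f'
        obtain ⟨d1, -, d3, d4, -, d6, -⟩ := clean_spec L g'
        refine ⟨⟨hp, hf1.1, hg1.1⟩, ?_⟩
        rw [isSyntacticOrdered_binary, hs.1]
        -- After cleaning, a variable at a leaf of a factor occurs in its polynomial, so the tested
        -- condition `hd` applies to it.
        refine ⟨hp, fun _ x hx y hy => hd x y ?_ ?_, c6 _ hf1.2, d6 _ hg1.2⟩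
        · exact c4 x (hGf x (sf.2.2.1 (c3 hx))) hx
        · exact d4 y (hGg y (sg.2.2.1 (d3 hy))) hy

end OrderedToSyntactic

end NCFormula

end OrderedFormulas

/-! ### The position automaton of a formula -/

namespace OrderedFormulas

/-- Binary trees some of whose leaves are marked. -/
inductive Shape where
  | empty
  | leaf
  | node (s t : Shape)

/-- The marked leaves of a tree. -/
inductive Leaf : Shape → Type
  | here : Leaf .leaf
  | inl {s t : Shape} (l : Leaf s) : Leaf (.node s t)
  | inr {s t : Shape} (l : Leaf t) : Leaf (.node s t)

namespace Shape

def numLeaves : Shape → ℕ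
  | empty => 0
  | leaf => 1
  | node s t => s.numLeaves + t.numLeaves

/-- The number of nodes of the tree. -/
def size : Shape → ℕ
  | empty => 1
  | leaf => 1
  | node s t => s.size + t.size + 1

theorem numLeaves_le_size (s : Shape) : s.numLeaves ≤ s.size := by
  induction s with
  | empty => simp [numLeaves]
  | leaf => simp [numLeaves, size]
  | node s t ihs iht => simp only [numLeaves, size]; omega

end Shape

namespace Leaf

/-- The position of a leaf in the list of leaves. -/
def index : {s : Shape} → Leaf s → ℕ
  | _, here => 0
  | _, inl l => l.index
  | _, inr (s := s) l => s.numLeaves + l.index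

theorem index_lt {s : Shape} (l : Leaf s) : l.index < s.numLeaves := by
  induction l with
  | here => exact Nat.one_pos
  | inl l ih => exact Nat.lt_of_lt_of_le ih (Nat.le_add_right _ _)
  | inr l ih => exact Nat.add_lt_add_left ih _

theorem index_injective {s : Shape} : Function.Injective (index : Leaf s → ℕ) := by
  intro l
  induction l with
  | here => intro l' _; cases l'; rfl
  | inl l ih =>
    intro l' h
    cases l' with
    | inl l' => exact congrArg _ (ih h)
    | inr l' => have := l.index_lt; simp only [index] at h; omega
  | inr l ih =>
    intro l' h
    cases l' with
    | inl l' => have := l'.index_lt; simp only [index] at h; omega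
    | inr l' => exact congrArg _ (ih (Nat.add_left_cancel h))

def join {A : Type*} {s t : Shape} (u : Leaf s → A) (v : Leaf t → A) : Leaf (.node s t) → A
  | inl l => u l
  | inr l => v l

end Leaf

/-- The convolution of two functions on words. -/
def conv {V F : Type*} [Field F] (φ ψ : List V → F) (w : List V) : F :=
  ∑ i ∈ Finset.range (w.length + 1), φ (w.take i) * ψ (w.drop i)

section Conv

variable {V F : Type*} [Field F]

theorem conv_nil (φ ψ : List V → F) : conv φ ψ [] = φ [] * ψ [] := by
  simp [conv]

/-- The product rule for left derivatives of series: either the letter is taken from `φ`, or `φ`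
contributes the empty word and the letter is taken from `ψ`. -/
theorem conv_cons (φ ψ : List V → F) (x : V) (w : List V) :
    conv φ ψ (x :: w) = conv (fun w => φ (x :: w)) ψ w + φ [] * ψ (x :: w) := by
  unfold conv
  rw [List.length_cons, Finset.sum_range_succ']
  simp

theorem conv_add (φ φ' ψ : List V → F) : conv (φ + φ') ψ = conv φ ψ + conv φ' ψ := by
  funext w
  simp [conv, add_mul, Finset.sum_add_distrib]

theorem conv_smul (c : F) (φ ψ : List V → F) : conv (c • φ) ψ = c • conv φ ψ := by
  funext w
  simp [conv, mul_assoc, Finset.mul_sum]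

theorem series_mul_eq_conv (g h : NCPoly F V) : series (g * h) = conv (series g) (series h) := by
  funext w
  exact series_mul g h w

end Conv

namespace NCFormula

section Automaton

variable {F : Type*}

/-- The tree of positions of the formula; the variable leaves are marked. -/
def shape : NCFormula F ℕ → Shape
  | var _ => .leaf
  | const _ => .empty
  | unary _ f => f.shape
  | binary _ f g => .node f.shape g.shape

theorem size_shape_le (G : NCFormula F ℕ) : G.shape.size ≤ G.size := by
  induction G with
  | var x => exact le_rfl
  | const a => exact le_rfl
  | unary op f ih => exact ih.trans (Nat.le_succ _)
  | binary op f g ihf ihg => simp only [shape, Shape.size, size]; omega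

variable [Field F]

/-- One step of the position automaton of the formula. The formula is entered with weight `a`, and
`v` gives the weight of having just read each variable leaf. The result consists of the weights
of reading each leaf as the next letter, if this letter is `x`, and of the weight of leaving the
formula without reading a letter. -/
def step : (G : NCFormula F ℕ) → ℕ → (Leaf G.shape → F) → F → (Leaf G.shape → F) × F
  | var y, x, v, a => (fun _ => if x = y then a else 0, v .here)
  | const c, _, _, a => (fun _ => 0, a * c)
  | unary _ f, x, v, a => f.step x v a
  | binary .plus f g, x, v, a =>
    (Leaf.join (f.step x (fun l => v (.inl l)) a).1 (g.step x (fun l => v (.inr l)) a).1,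
      (f.step x (fun l => v (.inl l)) a).2 + (g.step x (fun l => v (.inr l)) a).2)
  | binary .times f g, x, v, a =>
    (Leaf.join (f.step x (fun l => v (.inl l)) a).1
        (g.step x (fun l => v (.inr l)) (f.step x (fun l => v (.inl l)) a).2).1,
      (g.step x (fun l => v (.inr l)) (f.step x (fun l => v (.inl l)) a).2).2)

/-- The series of the words that remain to be read. -/
noncomputable def residual : (G : NCFormula F ℕ) → (Leaf G.shape → F) → F → List ℕ → F
  | var y, v, a => fun w => (if w = [y] then a else 0) + if w = [] then v .here else 0
  | const c, _, a => fun w => if w = [] then a * c else 0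
  | unary _ f, v, a => f.residual v a
  | binary .plus f g, v, a =>
    f.residual (fun l => v (.inl l)) a + g.residual (fun l => v (.inr l)) a
  | binary .times f g, v, a =>
    conv (f.residual (fun l => v (.inl l)) a) (series g.poly) +
      g.residual (fun l => v (.inr l)) 0

/-- Entering with weight `a` adds `a` complete readings of the formula to those already in progress.
-/
theorem residual_eq (G : NCFormula F ℕ) (v : Leaf G.shape → F) (a : F) :
    G.residual v a = G.residual v 0 + a • series G.poly := by
  induction G with
  | var y => funext w; simp [residual, series_var]; ring
  | const c => funext w; simp [residual, series_const]
  | unary op f ih => exact ih v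
  | binary op f g ihf ihg =>
    cases op with
    | plus =>
      have hp : series (binary .plus f g).poly = series f.poly + series g.poly := by
        funext w; exact series_add _ _ w
      rw [residual, ihf, ihg, residual, hp, smul_add]
      abel
    | times =>
      rw [residual, ihf, residual, poly, series_mul_eq_conv, conv_add, conv_smul]
      abel

theorem residual_zero_zero (G : NCFormula F ℕ) : G.residual 0 0 = 0 := by
  induction G with
  | var y =>
    funext w
    have h : (0 : Leaf (var y : NCFormula F ℕ).shape → F) .here = 0 := rfl
    simp only [residual, h, ite_self, add_zero, Pi.zero_apply]
  | const c => funext w; simp [residual]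
  | unary op f ih => exact ih
  | binary op f g ihf ihg =>
    have hf : f.residual (fun l => (0 : Leaf (binary op f g).shape → F) (.inl l)) 0 = 0 := ihf
    have hg : g.residual (fun l => (0 : Leaf (binary op f g).shape → F) (.inr l)) 0 = 0 := ihg
    cases op with
    | plus => rw [residual, hf, hg, add_zero]
    | times => rw [residual, hf, hg, add_zero]; funext w; simp [conv]

theorem step_snd (G : NCFormula F ℕ) (x : ℕ) (v : Leaf G.shape → F) (a : F) :
    (G.step x v a).2 = G.residual v a [] := by
  induction G generalizing a with
  | var y => simp [step, residual]
  | const c => simp [step, residual]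
  | unary op f ih => exact ih v a
  | binary op f g ihf ihg =>
    cases op with
    | plus => simp only [step, residual, ihf, ihg, Pi.add_apply]
    | times =>
      simp only [step, residual, ihf, ihg, Pi.add_apply, conv_nil]
      rw [residual_eq g]
      simp [add_comm]

/-- `step` realizes the left derivative of the residual series. The entering weight drops to 0
because, once a letter is read, every reading sits at a leaf. -/
theorem residual_cons (G : NCFormula F ℕ) (x : ℕ) (v : Leaf G.shape → F) (a : F) (w : List ℕ) :
    G.residual v a (x :: w) = G.residual (G.step x v a).1 0 w := by
  induction G generalizing a w with
  | var y =>
    by_cases hw : w = [] <;> by_cases hx : x = y <;> simp [step, residual, hw, hx]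
  | const c => simp [residual]
  | unary op f ih => exact ih v a w
  | binary op f g ihf ihg =>
    cases op with
    | plus => simp only [step, residual, ihf, ihg, Pi.add_apply, Leaf.join]
    | times =>
      simp only [step, residual, Pi.add_apply, conv_cons, Leaf.join, ihf, ← step_snd f x]
      -- The value of the left residual at the empty word is the weight of leaving `f`, by
      -- `step_snd`. By `residual_eq` the corresponding term of `conv_cons` amounts to entering `g`
      -- with this weight.
      have h := congrFun (residual_eq g (fun l => v (.inr l))
        (f.step x (fun l => v (.inl l)) a).2) (x :: w)
      simp only [Pi.add_apply, Pi.smul_apply, smul_eq_mul] at h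
      rw [← ihg, h]
      ring

/-- Additivity and homogeneity go into one identity, jointly in `v` and `a`, because at a product
gate an output of `f` becomes an input of `g`. -/
theorem step_linear (G : NCFormula F ℕ) (x : ℕ) (c : F) (v v' : Leaf G.shape → F) (a a' : F) :
    G.step x (c • v + v') (c * a + a') =
      (c • (G.step x v a).1 + (G.step x v' a').1, c * (G.step x v a).2 + (G.step x v' a').2) := by
  induction G generalizing a a' with
  | var y =>
    refine Prod.ext ?_ rfl
    funext l
    simp only [step, Pi.add_apply, Pi.smul_apply, smul_eq_mul]
    split_ifs <;> simp
  | const b =>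
    refine Prod.ext ?_ ?_
    · funext l; cases l
    · simp only [step]; ring
  | unary op f ih => exact ih v v' a a'
  | binary op f g ihf ihg =>
    have hf := ihf (fun l => v (.inl l)) (fun l => v' (.inl l))
    have hg := ihg (fun l => v (.inr l)) (fun l => v' (.inr l))
    have el : (fun l => (c • v + v') (.inl l) : Leaf f.shape → F) =
      c • (fun l => v (.inl l)) + fun l => v' (.inl l) := rfl
    have er : (fun l => (c • v + v') (.inr l) : Leaf g.shape → F) =
      c • (fun l => v (.inr l)) + fun l => v' (.inr l) := rfl
    cases op with
    | plus =>
      simp only [step, el, er, hf, hg]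
      refine Prod.ext ?_ ?_
      · funext l; cases l <;> rfl
      · simp only; ring
    | times =>
      simp only [step, el, er, hf, hg]
      refine Prod.ext ?_ ?_
      · funext l; cases l <;> rfl
      · simp only

/-- The states of the position automaton: the entering weight, and the weights of the leaves. -/
abbrev State (G : NCFormula F ℕ) := Leaf (.node .leaf G.shape) → F

def mkState (G : NCFormula F ℕ) (a : F) (v : Leaf G.shape → F) : G.State :=
  Leaf.join (fun _ => a) v

/-- Reading the letter `x`. -/
def next (G : NCFormula F ℕ) (x : ℕ) : G.State →ₗ[F] G.State where
  toFun s := G.mkState 0 (G.step x (fun l => s (.inr l)) (s (.inl .here))).1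
  map_add' s t := by
    have h := congrArg Prod.fst (G.step_linear x 1 (fun l => s (.inr l)) (fun l => t (.inr l))
      (s (.inl .here)) (t (.inl .here)))
    simp only [one_smul, one_mul] at h
    change G.mkState 0 (G.step x ((fun l => s (.inr l)) + fun l => t (.inr l)) _).1 = _
    rw [Pi.add_apply, h]
    funext l
    cases l <;> simp [mkState, Leaf.join]
  map_smul' c s := by
    have h := congrArg Prod.fst (G.step_linear x c (fun l => s (.inr l)) 0 (s (.inl .here)) 0)
    have h0 := congrArg Prod.fst (G.step_linear x 0 0 0 0 0)
    simp only [zero_smul, mul_zero, zero_add, add_zero] at h h0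
    have h1 := congrArg Prod.fst (G.step_linear x 1 0 0 0 0)
    simp only [one_smul, mul_zero, add_zero] at h1
    -- With all arguments 0 and `c = 1`, linearity reads `t = t + t`.
    have h2 : (G.step x 0 0).1 = 0 := by simpa using h1
    change G.mkState 0 (G.step x (c • fun l => s (.inr l)) _).1 = _
    rw [Pi.smul_apply, smul_eq_mul, h, h2]
    funext l
    cases l <;> simp [mkState, Leaf.join]

/-- The weight of the empty word. -/
def output (G : NCFormula F ℕ) : G.State →ₗ[F] F where
  -- The letter 0 is arbitrary: by `step_snd` the weight of leaving does not depend on the letter.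
  toFun s := (G.step 0 (fun l => s (.inr l)) (s (.inl .here))).2
  map_add' s t := by
    have h := congrArg Prod.snd (G.step_linear 0 1 (fun l => s (.inr l)) (fun l => t (.inr l))
      (s (.inl .here)) (t (.inl .here)))
    simp only [one_smul, one_mul] at h
    exact h
  map_smul' c s := by
    have h := congrArg Prod.snd (G.step_linear 0 c (fun l => s (.inr l)) 0 (s (.inl .here)) 0)
    have h2 : (G.step 0 0 0).2 = 0 := by rw [step_snd, residual_zero_zero]; rfl
    simp only [add_zero, h2] at h
    exact h

/-- The state reached from the initial state by reading a word. -/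
def reach (G : NCFormula F ℕ) (w : List ℕ) : G.State :=
  w.foldl (fun s x => G.next x s) (G.mkState 1 fun _ => 0)

theorem reach_concat (G : NCFormula F ℕ) (w : List ℕ) (x : ℕ) :
    G.reach (w ++ [x]) = G.next x (G.reach w) := by
  simp [reach]

/-- By induction on the word, the output after reading `w` from a state is the residual series of
that state at `w`. The initial state has entering weight 1 and nothing in progress, so its residual
is the series of the polynomial. -/
theorem series_eq_output (G : NCFormula F ℕ) (w : List ℕ) :
    series G.poly w = G.output (G.reach w) := by
  have key : ∀ (w : List ℕ) (s : G.State),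
      G.output (w.foldl (fun s x => G.next x s) s) =
        G.residual (fun l => s (.inr l)) (s (.inl .here)) w := by
    intro w
    induction w with
    | nil => intro s; exact step_snd _ _ _ _
    | cons x w ih => intro s; rw [List.foldl_cons, ih, residual_cons]; rfl
  rw [reach, key]
  change _ = G.residual (fun _ => 0) 1 w
  rw [residual_eq]
  have h : G.residual (fun _ => 0) 0 = 0 := G.residual_zero_zero
  rw [h]
  simp

end Automaton

end NCFormula

end OrderedFormulas

namespace OrderedFormulas

/-! ### Fraction-free elimination -/

section Elimination

variable {F κ : Type*} [Field F]

/-- Fraction-free Gauss-Jordan elimination: the vectors `R i` are combinations of the vectors `V i`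
with the pivots `p i`, and `d` is the determinant of the pivot minor. -/
structure IsReduced {n : ℕ} (p : Fin n → κ) (V R : Fin n → κ → F) (d : F) : Prop where
  det : d = (Matrix.of fun i j => V i (p j)).det
  ne : d ≠ 0
  mem : ∀ i, R i ∈ Submodule.span F (Set.range V)
  eval : ∀ i l, R i (p l) = if i = l then d else 0

/-- The reduced rows have no freedom: the coefficient row `c` of `R i` satisfies `c M = d e_i` for
the pivot matrix `M`, and multiplying by the adjugate and cancelling `d = det M` gives `c`. So the
coefficients are cofactors, whatever divisions the algorithm made. The bound on the sizes of the
entries rests on this. -/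
theorem IsReduced.eq_sum {n : ℕ} {p : Fin n → κ} {V R : Fin n → κ → F} {d : F}
    (h : IsReduced p V R d) (i : Fin n) :
    R i = ∑ k, (Matrix.of fun i j => V i (p j)).adjugate i k • V k := by
  obtain ⟨c, hc⟩ := (Submodule.mem_span_range_iff_exists_fun F).1 (h.mem i)
  set M : Matrix (Fin n) (Fin n) F := Matrix.of fun i j => V i (p j) with hM
  have h1 : Matrix.vecMul c M = d • Pi.single i 1 := by
    funext l
    have h2 := h.eval i l
    rw [← hc] at h2
    simp only [Finset.sum_apply, Pi.smul_apply, smul_eq_mul] at h2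
    simp only [Matrix.vecMul, dotProduct, hM, Matrix.of_apply, h2, Pi.smul_apply, smul_eq_mul,
      Pi.single_apply, mul_ite, mul_one, mul_zero, eq_comm]
  have h3 : d • c = d • Matrix.vecMul (Pi.single i 1) M.adjugate := by
    rw [← Matrix.smul_vecMul, ← h1, Matrix.vecMul_vecMul, Matrix.mul_adjugate, ← h.det,
      Matrix.vecMul_smul, Matrix.vecMul_one]
  have h4 : c = Matrix.vecMul (Pi.single i 1) M.adjugate := by
    have := congrArg (fun x => d⁻¹ • x) h3
    simpa only [smul_smul, inv_mul_cancel₀ h.ne, one_smul] using this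
  rw [← hc, h4]
  simp

theorem IsReduced.injective {n : ℕ} {p : Fin n → κ} {V R : Fin n → κ → F} {d : F}
    (h : IsReduced p V R d) : Function.Injective p := by
  intro i j hij
  have h1 := h.eval i i
  rw [hij, h.eval i j, if_pos rfl] at h1
  by_contra hne
  rw [if_neg hne] at h1
  exact h.ne h1.symm

theorem isReduced_empty (p : Fin 0 → κ) (V R : Fin 0 → κ → F) : IsReduced p V R 1 :=
  ⟨by simp, one_ne_zero, fun i => i.elim0, fun i => i.elim0⟩

/-- The multiple of `v` reduced with respect to the rows. -/
def remainder {n : ℕ} (p : Fin n → κ) (R : Fin n → κ → F) (d : F) (v : κ → F) : κ → F :=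
  d • v - ∑ i, v (p i) • R i

theorem IsReduced.remainder_eval {n : ℕ} {p : Fin n → κ} {V R : Fin n → κ → F} {d : F}
    (h : IsReduced p V R d) (v : κ → F) (l : Fin n) : remainder p R d v (p l) = 0 := by
  simp [remainder, h.eval, mul_comm]

theorem IsReduced.mem_of_remainder {n : ℕ} {p : Fin n → κ} {V R : Fin n → κ → F} {d : F}
    (h : IsReduced p V R d) {v : κ → F} (hv : remainder p R d v = 0) :
    v ∈ Submodule.span F (Set.range V) := by
  rw [remainder, sub_eq_zero] at hv
  have h1 : v = d⁻¹ • ∑ i, v (p i) • R i := by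
    rw [← hv, smul_smul, inv_mul_cancel₀ h.ne, one_smul]
  rw [h1]
  exact Submodule.smul_mem _ _ (Submodule.sum_mem _ fun i _ => Submodule.smul_mem _ _ (h.mem i))

/-- The new pivot entry `w j` is the new pivot minor. Replacing the first row of the new pivot
matrix by `w`, that is, by `d` times this row plus a combination of the others, multiplies the
determinant by `d`. As `w` vanishes at the old pivots, expansion along that row gives `w j * d`.
Cancelling `d` proves the claim. -/
theorem IsReduced.cons {n : ℕ} {p : Fin n → κ} {V R : Fin n → κ → F} {d : F}
    (h : IsReduced p V R d) {v w : κ → F} (hw : w = remainder p R d v) {j : κ} (hj : w j ≠ 0) :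
    IsReduced (Fin.cons j p : Fin (n + 1) → κ) (Fin.cons v V : Fin (n + 1) → κ → F)
      (Fin.cons w fun i l => (w j * R i l - R i j * w l) / d : Fin (n + 1) → κ → F) (w j) := by
  have hle : Submodule.span F (Set.range V) ≤
      Submodule.span F (Set.range (Fin.cons v V : Fin (n + 1) → κ → F)) := by
    apply Submodule.span_mono
    rintro _ ⟨i, rfl⟩
    exact ⟨i.succ, by simp⟩
  have hvm : v ∈ Submodule.span F (Set.range (Fin.cons v V : Fin (n + 1) → κ → F)) :=
    Submodule.subset_span ⟨0, by simp⟩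
  have hsum : ∑ i, v (p i) • R i ∈ Submodule.span F (Set.range V) :=
    Submodule.sum_mem _ fun i _ => Submodule.smul_mem _ _ (h.mem i)
  have hwm : w ∈ Submodule.span F (Set.range (Fin.cons v V : Fin (n + 1) → κ → F)) := by
    rw [hw]
    exact Submodule.sub_mem _ (Submodule.smul_mem _ _ hvm) (hle hsum)
  have hwp : ∀ l, w (p l) = 0 := fun l => by rw [hw]; exact h.remainder_eval v l
  refine ⟨?_, hj, ?_, ?_⟩
  · set M' : Matrix (Fin (n + 1)) (Fin (n + 1)) F := Matrix.of fun i l =>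
      (Fin.cons v V : Fin (n + 1) → κ → F) i ((Fin.cons j p : Fin (n + 1) → κ) l) with hM'
    obtain ⟨c, hc⟩ := (Submodule.mem_span_range_iff_exists_fun F).1 hsum
    have hrow : (fun l => w ((Fin.cons j p : Fin (n + 1) → κ) l)) =
        ∑ k, (Fin.cons d (fun k => - c k) : Fin (n + 1) → F) k • M' k := by
      funext l
      rw [hw, remainder, ← hc, Fin.sum_univ_succ]
      simp [hM', Finset.sum_apply, sub_eq_add_neg]
    have h1 := Matrix.det_updateRow_sum M' 0 (Fin.cons d (fun k => - c k) : Fin (n + 1) → F)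
    rw [← hrow, Fin.cons_zero, Matrix.det_succ_row_zero, Fin.sum_univ_succ] at h1
    simp only [Matrix.updateRow_self, Fin.cons_zero, Fin.cons_succ, hwp, mul_zero, zero_mul,
      Finset.sum_const_zero, add_zero, Fin.val_zero, pow_zero, one_mul, smul_eq_mul] at h1
    have h2 : ((M'.updateRow 0 fun l => w ((Fin.cons j p : Fin (n + 1) → κ) l)).submatrix
        Fin.succ (Fin.succAbove 0)) = Matrix.of fun i j => V i (p j) := by
      ext i l
      simp [hM']
    rw [h2, ← h.det, mul_comm] at h1
    exact mul_left_cancel₀ h.ne h1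
  · intro i
    refine Fin.cases ?_ (fun i => ?_) i
    · simpa using hwm
    · have : (Fin.cons w (fun i l => (w j * R i l - R i j * w l) / d) : Fin (n + 1) → κ → F) i.succ
          = (w j / d) • R i - (R i j / d) • w := by
        funext l
        simp only [Fin.cons_succ, Pi.sub_apply, Pi.smul_apply, smul_eq_mul]
        ring
      rw [this]
      exact Submodule.sub_mem _ (Submodule.smul_mem _ _ (hle (h.mem i)))
        (Submodule.smul_mem _ _ hwm)
  · intro i l
    refine Fin.cases ?_ (fun i => ?_) i <;> refine Fin.cases ?_ (fun l => ?_) l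
    · simp
    · simp [hwp, (Fin.succ_ne_zero l).symm]
    · simp [mul_comm]
    · have := h.ne
      simp only [Fin.cons_succ, hwp, h.eval, Fin.succ_inj]
      split_ifs <;> field_simp <;> simp

end Elimination

/-- A row of the elimination: the pivot, the original vector, and the reduced vector. -/
structure Row (F : Type*) (s : Shape) where
  piv : Leaf s
  orig : Leaf s → F
  red : Leaf s → F

section Rows

variable {F : Type*} [Field F] {s : Shape}

/-- The rows and the pivot minor come from fraction-free elimination. -/
def RowsReduced (d : F) (rows : List (Row F s)) : Prop :=
  ∃ (n : ℕ) (p : Fin n → Leaf s) (V R : Fin n → Leaf s → F),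
    rows = List.ofFn (fun i => ⟨p i, V i, R i⟩) ∧ IsReduced p V R d

open Classical in
/-- The first leaf at which the vector does not vanish. -/
noncomputable def findLeaf : (s : Shape) → (Leaf s → F) → Option (Leaf s)
  | .empty, _ => none
  | .leaf, v => if v .here = 0 then none else some .here
  | .node s t, v =>
    match findLeaf s fun l => v (.inl l) with
    | some l => some (.inl l)
    | none => (findLeaf t fun l => v (.inr l)).map .inr

theorem findLeaf_some {s : Shape} {v : Leaf s → F} {j : Leaf s} (h : findLeaf s v = some j) :
    v j ≠ 0 := by
  induction s with
  | empty => cases j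
  | leaf => cases j; rw [findLeaf] at h; split_ifs at h with h0; exact h0
  | node s t ihs iht =>
    rw [findLeaf] at h
    split at h
    · rename_i l hl
      cases h
      exact ihs hl
    · obtain ⟨l, hl, rfl⟩ := Option.map_eq_some_iff.1 h
      exact iht hl

theorem findLeaf_none {s : Shape} {v : Leaf s → F} (h : findLeaf s v = none) : v = 0 := by
  funext l
  induction l with
  | here => rw [findLeaf] at h; split_ifs at h with h0; exact h0
  | inl l ih =>
    rw [findLeaf] at h
    split at h
    · cases h
    · rename_i hl
      exact ih hl
  | inr l ih =>
    rw [findLeaf] at h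
    split at h
    · cases h
    · exact ih (Option.map_eq_none_iff.1 h)

/-- The factors and denominators 1, and the summand `0 * v l` in `remainderOf`, bring all vector
operations into the shape `(α u - β v) / δ`, which one function of the program computes. -/
def reduceBy (v : Leaf s → F) (rows : List (Row F s)) (acc : Leaf s → F) : Leaf s → F :=
  rows.foldl (fun acc r l => (1 * acc l - v r.piv * r.red l) / 1) acc

def updateRow (j : Leaf s) (w : Leaf s → F) (d : F) (r : Row F s) : Row F s :=
  ⟨r.piv, r.orig, fun l => (w j * r.red l - r.red j * w l) / d⟩

/-- The remainder of `v`. -/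
def remainderOf (v : Leaf s → F) (S : F × List (Row F s)) : Leaf s → F :=
  reduceBy v S.2 fun l => (S.1 * v l - 0 * v l) / 1

/-- Insertion of a vector to the elimination. -/
noncomputable def insertRow (v : Leaf s → F) (S : F × List (Row F s)) : F × List (Row F s) :=
  match findLeaf s (remainderOf v S) with
  | none => S
  | some j =>
    (remainderOf v S j, ⟨j, v, remainderOf v S⟩ :: S.2.map (updateRow j (remainderOf v S) S.1))

theorem reduceBy_ofFn {n : ℕ} (p : Fin n → Leaf s) (V R : Fin n → Leaf s → F) (v acc : Leaf s → F) :
    reduceBy v (List.ofFn fun i => ⟨p i, V i, R i⟩) acc = acc - ∑ i, v (p i) • R i := by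
  induction n generalizing acc with
  | zero => simp [reduceBy]
  | succ n ih =>
    have h := ih (fun i => p i.succ) (fun i => V i.succ) (fun i => R i.succ)
      (fun l => (1 * acc l - v (p 0) * R 0 l) / 1)
    rw [reduceBy] at h ⊢
    rw [List.ofFn_succ, List.foldl_cons, h, Fin.sum_univ_succ]
    funext l
    simp [sub_sub]

theorem remainderOf_eq {n : ℕ} (p : Fin n → Leaf s) (V R : Fin n → Leaf s → F) (v : Leaf s → F)
    (d : F) : remainderOf v (d, List.ofFn fun i => ⟨p i, V i, R i⟩) = remainder p R d v := by
  rw [remainderOf, reduceBy_ofFn, remainder]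
  congr 1
  funext l
  simp

theorem RowsReduced.insertRow {S : F × List (Row F s)} (h : RowsReduced S.1 S.2) (v : Leaf s → F) :
    RowsReduced (insertRow v S).1 (insertRow v S).2 := by
  obtain ⟨d, rows⟩ := S
  obtain ⟨n, p, V, R, rfl, hR⟩ := h
  rw [OrderedFormulas.insertRow]
  split
  · exact ⟨n, p, V, R, rfl, hR⟩
  · rename_i j hj
    have hj' := findLeaf_some hj
    refine ⟨n + 1, _, _, _, ?_, hR.cons (remainderOf_eq p V R v d) hj'⟩
    rw [List.ofFn_succ, List.map_ofFn]
    rfl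

theorem insertRow_orig {P : (Leaf s → F) → Prop} {S : F × List (Row F s)}
    (h : ∀ r ∈ S.2, P r.orig) {v : Leaf s → F} (hv : P v) : ∀ r ∈ (insertRow v S).2, P r.orig := by
  rw [insertRow]
  split
  · exact h
  · intro r hr
    rcases List.mem_cons.1 hr with rfl | hr
    · exact hv
    · obtain ⟨r, hr', rfl⟩ := List.mem_map.1 hr
      exact h r hr'

/-- The space spanned by the original vectors. -/
def rowSpan (rows : List (Row F s)) : Submodule F (Leaf s → F) :=
  Submodule.span F {v | ∃ r ∈ rows, r.orig = v}

theorem rowSpan_le_insertRow (v : Leaf s → F) (S : F × List (Row F s)) :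
    rowSpan S.2 ≤ rowSpan (insertRow v S).2 := by
  apply Submodule.span_mono
  rintro _ ⟨r, hr, rfl⟩
  rw [insertRow]
  split
  · exact ⟨r, hr, rfl⟩
  · exact ⟨_, List.mem_cons_of_mem _ (List.mem_map_of_mem hr), rfl⟩

/-- A vector is discarded only when its remainder vanishes, and then it already lies in the span of
the original vectors. -/
theorem mem_rowSpan_insertRow (v : Leaf s → F) {S : F × List (Row F s)}
    (h : RowsReduced S.1 S.2) : v ∈ rowSpan (insertRow v S).2 := by
  rw [insertRow]
  split
  · rename_i hn
    obtain ⟨d, rows⟩ := S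
    obtain ⟨n, p, V, R, rfl, hR⟩ := h
    have h1 := findLeaf_none hn
    rw [remainderOf_eq] at h1
    have h2 := hR.mem_of_remainder h1
    refine Submodule.span_mono ?_ h2
    rintro _ ⟨i, rfl⟩
    exact ⟨_, List.mem_ofFn.2 ⟨i, rfl⟩, rfl⟩
  · exact Submodule.subset_span ⟨_, List.mem_cons_self, rfl⟩

/-- Different rows have different pivots, so there are at most as many as leaves. -/
theorem RowsReduced.length_le {d : F} {rows : List (Row F s)} (h : RowsReduced d rows) :
    rows.length ≤ s.numLeaves := by
  obtain ⟨n, p, V, R, rfl, hR⟩ := h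
  rw [List.length_ofFn]
  have h1 : Function.Injective fun i => (⟨(p i).index, (p i).index_lt⟩ : Fin s.numLeaves) :=
    fun i j hij => hR.injective (Leaf.index_injective (Fin.mk.inj hij))
  simpa using Fintype.card_le_of_injective _ h1

end Rows

namespace NCFormula

/-! ### The span of the reached states, and the zero test -/

section Closure

variable {F : Type*} [Field F]

abbrev Basis (G : NCFormula F ℕ) := F × List (Row F (.node .leaf G.shape))

/-- Insert the successors of a state. -/
noncomputable def insertNext (G : NCFormula F ℕ) (v : G.State) (L : List ℕ) (S : G.Basis) :
    G.Basis :=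
  L.foldl (fun S x => insertRow (G.next x v) S) S

/-- Insert the successors of all given rows. -/
noncomputable def insertAll (G : NCFormula F ℕ) (L : List ℕ)
    (rows : List (Row F (.node .leaf G.shape))) (S : G.Basis) : G.Basis :=
  rows.foldl (fun S r => G.insertNext r.orig L S) S

noncomputable def closure (G : NCFormula F ℕ) (L : List ℕ) (k : ℕ) (S : G.Basis) : G.Basis :=
  (fun S : G.Basis => G.insertAll L S.2 S)^[k] S

noncomputable def initBasis (G : NCFormula F ℕ) : G.Basis :=
  insertRow (G.reach []) (1, [])

theorem rowsReduced_nil {s : Shape} : RowsReduced (1 : F) ([] : List (Row F s)) :=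
  ⟨0, nofun, nofun, nofun, rfl, isReduced_empty _ _ _⟩

/-- The invariant of the closure process. -/
structure BasisInv (G : NCFormula F ℕ) (P : G.State → Prop) (S : G.Basis) : Prop where
  reduced : RowsReduced S.1 S.2
  orig : ∀ r ∈ S.2, P r.orig

theorem BasisInv.mono {G : NCFormula F ℕ} {P Q : G.State → Prop} {S : G.Basis}
    (h : G.BasisInv P S) (hPQ : ∀ v, P v → Q v) : G.BasisInv Q S :=
  ⟨h.reduced, fun r hr => hPQ _ (h.orig r hr)⟩

theorem BasisInv.insertRow {G : NCFormula F ℕ} {P : G.State → Prop} {S : G.Basis}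
    (h : G.BasisInv P S) {v : G.State} (hv : P v) : G.BasisInv P (insertRow v S) :=
  ⟨h.reduced.insertRow v, insertRow_orig h.orig hv⟩

theorem BasisInv.insertNext {G : NCFormula F ℕ} {P : G.State → Prop} {S : G.Basis}
    (h : G.BasisInv P S) {v : G.State} {L : List ℕ} (hv : ∀ x ∈ L, P (G.next x v)) :
    G.BasisInv P (G.insertNext v L S) := by
  induction L generalizing S with
  | nil => exact h
  | cons x L ih =>
    exact ih (h.insertRow (hv x List.mem_cons_self)) fun y hy => hv y (List.mem_cons_of_mem _ hy)

theorem BasisInv.insertAll {G : NCFormula F ℕ} {P : G.State → Prop} {S : G.Basis}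
    (h : G.BasisInv P S) {L : List ℕ} {rows : List (Row F (.node .leaf G.shape))}
    (hv : ∀ r ∈ rows, ∀ x ∈ L, P (G.next x r.orig)) :
    G.BasisInv P (G.insertAll L rows S) := by
  induction rows generalizing S with
  | nil => exact h
  | cons r rows ih =>
    exact ih (h.insertNext (hv r List.mem_cons_self)) fun y hy => hv y (List.mem_cons_of_mem _ hy)

theorem le_insertNext (G : NCFormula F ℕ) (v : G.State) (L : List ℕ) (S : G.Basis) :
    rowSpan S.2 ≤ rowSpan (G.insertNext v L S).2 := by
  induction L generalizing S with
  | nil => exact le_rfl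
  | cons x L ih => exact (rowSpan_le_insertRow _ S).trans (ih _)

theorem le_insertAll (G : NCFormula F ℕ) (L : List ℕ)
    (rows : List (Row F (.node .leaf G.shape))) (S : G.Basis) :
    rowSpan S.2 ≤ rowSpan (G.insertAll L rows S).2 := by
  induction rows generalizing S with
  | nil => exact le_rfl
  | cons x L ih => exact (G.le_insertNext _ _ S).trans (ih _)

theorem mem_insertNext {G : NCFormula F ℕ} {v : G.State} {L : List ℕ} {S : G.Basis}
    (h : RowsReduced S.1 S.2) {x : ℕ} (hx : x ∈ L) :
    G.next x v ∈ rowSpan (G.insertNext v L S).2 := by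
  induction L generalizing S with
  | nil => cases hx
  | cons y L ih =>
    rcases List.mem_cons.1 hx with rfl | hx
    · exact G.le_insertNext v L _ (mem_rowSpan_insertRow _ h)
    · exact ih (h.insertRow _) hx

theorem mem_insertAll {G : NCFormula F ℕ} {L : List ℕ}
    {rows : List (Row F (.node .leaf G.shape))} {S : G.Basis}
    (h : RowsReduced S.1 S.2) {x : ℕ} (hx : x ∈ L) {r : Row F (.node .leaf G.shape)}
    (hr : r ∈ rows) : G.next x r.orig ∈ rowSpan (G.insertAll L rows S).2 := by
  induction rows generalizing S with
  | nil => cases hr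
  | cons y rows ih =>
    rcases List.mem_cons.1 hr with rfl | hr
    · exact G.le_insertAll L rows _ (mem_insertNext h hx)
    · refine ih (S := G.insertNext y.orig L S) ?_ hr
      exact (BasisInv.insertNext (P := fun _ => True) ⟨h, fun _ _ => trivial⟩
        fun _ _ => trivial).reduced

/-- The states that are reached by words of bounded length. -/
def ReachedIn (G : NCFormula F ℕ) (k : ℕ) (v : G.State) : Prop :=
  ∃ w : List ℕ, w.length ≤ k ∧ v = G.reach w

theorem ReachedIn.next {G : NCFormula F ℕ} {k : ℕ} {v : G.State} (h : G.ReachedIn k v) (x : ℕ) :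
    G.ReachedIn (k + 1) (G.next x v) := by
  obtain ⟨w, hw, rfl⟩ := h
  exact ⟨w ++ [x], by simpa using hw, (G.reach_concat w x).symm⟩

theorem ReachedIn.mono {G : NCFormula F ℕ} {k k' : ℕ} (hk : k ≤ k') {v : G.State}
    (h : G.ReachedIn k v) : G.ReachedIn k' v :=
  h.imp fun _ hw => ⟨hw.1.trans hk, hw.2⟩

theorem initBasis_inv (G : NCFormula F ℕ) : G.BasisInv (G.ReachedIn 0) G.initBasis :=
  BasisInv.insertRow (S := (1, [])) ⟨rowsReduced_nil, nofun⟩ ⟨[], le_rfl, rfl⟩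

/-- The original vector of a row is a state reached by one word, not merely an element of the span.
This keeps its entries small: successors are always formed from original vectors, never from reduced
ones. -/
theorem closure_inv (G : NCFormula F ℕ) (L : List ℕ) {j : ℕ} {S : G.Basis}
    (h : G.BasisInv (G.ReachedIn j) S) (k : ℕ) :
    G.BasisInv (G.ReachedIn (j + k)) (G.closure L k S) := by
  induction k with
  | zero => exact h
  | succ k ih =>
    rw [closure, Function.iterate_succ_apply']
    exact BasisInv.insertAll (ih.mono fun v hv => hv.mono (Nat.le_succ _))
      fun r hr x _ => (ih.orig r hr).next x

/-- Reading a letter is linear, so it suffices that each round inserts the successors of the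
spanning rows: `next` then maps the span after `k` rounds into the span after `k + 1`. -/
theorem reach_mem_closure (G : NCFormula F ℕ) (L : List ℕ) (k : ℕ) {w : List ℕ}
    (hw : w.length ≤ k) (hL : ∀ x ∈ w, x ∈ L) :
    G.reach w ∈ rowSpan (G.closure L k G.initBasis).2 := by
  induction k generalizing w with
  | zero =>
    obtain rfl := List.eq_nil_of_length_eq_zero (Nat.le_zero.1 hw)
    exact mem_rowSpan_insertRow (S := (1, [])) _ rowsReduced_nil
  | succ k ih =>
    rw [closure, Function.iterate_succ_apply']
    rcases List.eq_nil_or_concat w with rfl | ⟨w, x, rfl⟩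
    · exact G.le_insertAll L _ _ (ih (Nat.zero_le _) nofun)
    · rw [List.concat_eq_append] at *
      rw [reach_concat]
      have h1 := ih (w := w) (by simpa using hw) fun y hy => hL y (by simp [hy])
      have h2 : Submodule.map (G.next x) (rowSpan (G.closure L k G.initBasis).2) ≤
          rowSpan (G.insertAll L (G.closure L k G.initBasis).2 (G.closure L k G.initBasis)).2 := by
        rw [rowSpan, Submodule.map_span, Submodule.span_le]
        rintro _ ⟨_, ⟨r, hr, rfl⟩, rfl⟩
        exact mem_insertAll (G.closure_inv L G.initBasis_inv k).reduced (hL x (by simp)) hr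
      exact h2 ⟨_, h1, rfl⟩

/-- Outputs of rows are coefficients of words, hence vanish with the polynomial. Conversely, a word
with nonzero coefficient has length at most `k` and letters in `L`, so its state lies in the span,
on which `output` vanishes. -/
theorem poly_eq_zero_iff (G : NCFormula F ℕ) {L : List ℕ} (hL : ∀ x ∈ G.vars, x ∈ L) {k : ℕ}
    (hk : G.size ≤ k) :
    G.poly = 0 ↔ ∀ r ∈ (G.closure L k G.initBasis).2, G.output r.orig = 0 := by
  constructor
  · intro h r hr
    obtain ⟨w, -, hw⟩ := (G.closure_inv L G.initBasis_inv k).orig r hr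
    rw [hw, ← series_eq_output, h]
    rfl
  · intro h
    apply series_ext
    intro w
    change _ = 0
    by_contra hw
    refine hw ?_
    have h1 := G.reach_mem_closure L k ((G.length_le_of_series_ne_zero hw).trans hk)
      fun x hx => hL x (G.mem_vars_of_series_ne_zero hw hx)
    have h2 : rowSpan (G.closure L k G.initBasis).2 ≤ LinearMap.ker G.output := by
      rw [rowSpan, Submodule.span_le]
      rintro _ ⟨r, hr, rfl⟩
      exact h r hr
    rw [series_eq_output]
    exact h2 h1

end Closure

end NCFormula

end OrderedFormulas

namespace OrderedFormulas

/-! ### Bounds for the field elements in the computation -/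

section NatNorm

variable {σ : Type*}

/-- The sum of the absolute values of the coefficients. -/
def natNorm (N : MvPolynomial σ ℤ) : ℕ := ∑ m ∈ N.support, (N.coeff m).natAbs

theorem natNorm_eq_sum {N : MvPolynomial σ ℤ} {s : Finset (σ →₀ ℕ)} (h : N.support ⊆ s) :
    natNorm N = ∑ m ∈ s, (N.coeff m).natAbs := by
  apply Finset.sum_subset h
  intro m _ hm
  rw [MvPolynomial.notMem_support_iff.1 hm, Int.natAbs_zero]

theorem natNorm_zero : natNorm (0 : MvPolynomial σ ℤ) = 0 := by simp [natNorm]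

theorem natNorm_add_le (N M : MvPolynomial σ ℤ) : natNorm (N + M) ≤ natNorm N + natNorm M := by
  classical
  rw [natNorm_eq_sum MvPolynomial.support_add, natNorm_eq_sum Finset.subset_union_left,
    natNorm_eq_sum (N := M) Finset.subset_union_right, ← Finset.sum_add_distrib]
  apply Finset.sum_le_sum
  intro m _
  rw [MvPolynomial.coeff_add]
  exact Int.natAbs_add_le _ _

theorem natNorm_neg (N : MvPolynomial σ ℤ) : natNorm (-N) = natNorm N := by
  simp [natNorm]

theorem natNorm_sum_le {ι : Type*} (s : Finset ι) (f : ι → MvPolynomial σ ℤ) :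
    natNorm (∑ i ∈ s, f i) ≤ ∑ i ∈ s, natNorm (f i) := by
  classical
  induction s using Finset.induction_on with
  | empty => simp [natNorm_zero]
  | insert i s hi ih =>
    rw [Finset.sum_insert hi, Finset.sum_insert hi]
    exact (natNorm_add_le _ _).trans (Nat.add_le_add_left ih _)

theorem natNorm_monomial_mul_le (a : σ →₀ ℕ) (c : ℤ) (M : MvPolynomial σ ℤ) :
    natNorm (MvPolynomial.monomial a c * M) ≤ c.natAbs * natNorm M := by
  classical
  have h : (MvPolynomial.monomial a c * M).support ⊆ M.support.image (a + ·) := by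
    intro m hm
    rw [MvPolynomial.mem_support_iff, MvPolynomial.coeff_monomial_mul'] at hm
    split_ifs at hm with ham
    · rw [Finset.mem_image]
      exact ⟨m - a, MvPolynomial.mem_support_iff.2 (right_ne_zero_of_mul hm),
        add_tsub_cancel_of_le ham⟩
    · exact absurd rfl hm
  rw [natNorm_eq_sum h, Finset.sum_image fun x _ y _ hxy => add_left_cancel hxy, natNorm,
    Finset.mul_sum]
  apply Finset.sum_le_sum
  intro m _
  rw [MvPolynomial.coeff_monomial_mul, Int.natAbs_mul]

theorem natNorm_mul_le (N M : MvPolynomial σ ℤ) : natNorm (N * M) ≤ natNorm N * natNorm M := by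
  conv_lhs => rw [MvPolynomial.as_sum N, Finset.sum_mul]
  refine (natNorm_sum_le _ _).trans ?_
  rw [natNorm, Finset.sum_mul]
  exact Finset.sum_le_sum fun a _ => natNorm_monomial_mul_le _ _ _

theorem natNorm_one : natNorm (1 : MvPolynomial σ ℤ) = 1 := by
  rw [natNorm, MvPolynomial.support_one]
  simp

end NatNorm

section IsSmall

variable {F : Type*} [Field F] {k : ℕ} {a : Fin k → F}

/-- `c` is the value at `a` of an integer polynomial of degree at most `e` whose coefficients have
absolute values of sum at most `2 ^ e`. -/
def IsSmall (a : Fin k → F) (e : ℕ) (c : F) : Prop :=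
  ∃ N : MvPolynomial (Fin k) ℤ, N.totalDegree ≤ e ∧ natNorm N ≤ 2 ^ e ∧ MvPolynomial.aeval a N = c

theorem IsSmall.mono {e e' : ℕ} {c : F} (h : IsSmall a e c) (he : e ≤ e') : IsSmall a e' c := by
  obtain ⟨N, h1, h2, h3⟩ := h
  exact ⟨N, h1.trans he, h2.trans (Nat.pow_le_pow_right two_pos he), h3⟩

theorem isSmall_zero (e : ℕ) : IsSmall a e (0 : F) :=
  ⟨0, by simp, by simp [natNorm_zero], by simp⟩

theorem isSmall_one (e : ℕ) : IsSmall a e (1 : F) :=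
  ⟨1, by simp, by simp [natNorm_one, Nat.one_le_two_pow], by simp⟩

theorem isSmall_apply (i : Fin k) : IsSmall a 1 (a i) :=
  ⟨MvPolynomial.X i, by simp, by simp [natNorm, MvPolynomial.X, MvPolynomial.support_monomial],
    by simp⟩

theorem IsSmall.neg {e : ℕ} {c : F} (h : IsSmall a e c) : IsSmall a e (-c) := by
  obtain ⟨N, h1, h2, h3⟩ := h
  exact ⟨-N, by rwa [MvPolynomial.totalDegree_neg], by rwa [natNorm_neg], by rw [map_neg, h3]⟩

theorem IsSmall.add {e : ℕ} {c c' : F} (h : IsSmall a e c) (h' : IsSmall a e c') :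
    IsSmall a (e + 1) (c + c') := by
  obtain ⟨N, h1, h2, h3⟩ := h
  obtain ⟨N', h1', h2', h3'⟩ := h'
  refine ⟨N + N', (MvPolynomial.totalDegree_add _ _).trans ((max_le h1 h1').trans (Nat.le_succ e)),
    (natNorm_add_le _ _).trans ?_, by rw [map_add, h3, h3']⟩
  rw [pow_succ]
  omega

theorem IsSmall.sub {e : ℕ} {c c' : F} (h : IsSmall a e c) (h' : IsSmall a e c') :
    IsSmall a (e + 1) (c - c') := by
  rw [sub_eq_add_neg]
  exact h.add h'.neg

theorem IsSmall.mul {e e' : ℕ} {c c' : F} (h : IsSmall a e c) (h' : IsSmall a e' c') :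
    IsSmall a (e + e') (c * c') := by
  obtain ⟨N, h1, h2, h3⟩ := h
  obtain ⟨N', h1', h2', h3'⟩ := h'
  refine ⟨N * N', (MvPolynomial.totalDegree_mul _ _).trans (Nat.add_le_add h1 h1'),
    (natNorm_mul_le _ _).trans ?_, by rw [map_mul, h3, h3']⟩
  rw [pow_add]
  exact Nat.mul_le_mul h2 h2'

theorem IsSmall.sum {ι : Type*} {s : Finset ι} {f : ι → F} {e j : ℕ}
    (h : ∀ i ∈ s, IsSmall a e (f i)) (hs : s.card ≤ 2 ^ j) :
    IsSmall a (e + j) (∑ i ∈ s, f i) := by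
  choose! N h1 h2 h3 using h
  refine ⟨∑ i ∈ s, N i, ?_, ?_, ?_⟩
  · exact MvPolynomial.totalDegree_finsetSum_le fun i hi => (h1 i hi).trans (Nat.le_add_right _ _)
  · refine (natNorm_sum_le _ _).trans ((Finset.sum_le_card_nsmul _ _ _ h2).trans ?_)
    rw [smul_eq_mul, pow_add, mul_comm]
    exact Nat.mul_le_mul_left _ hs
  · rw [map_sum]
    exact Finset.sum_congr rfl h3

theorem IsSmall.prod {ι : Type*} {s : Finset ι} {f : ι → F} {e : ℕ}
    (h : ∀ i ∈ s, IsSmall a e (f i)) : IsSmall a (s.card * e) (∏ i ∈ s, f i) := by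
  classical
  induction s using Finset.induction_on with
  | empty => exact isSmall_one _
  | insert i s hi ih =>
    rw [Finset.prod_insert hi, Finset.card_insert_of_notMem hi]
    exact ((h i (Finset.mem_insert_self _ _)).mul
      (ih fun i hi => h i (Finset.mem_insert_of_mem hi))).mono (by rw [add_mul]; omega)

theorem IsSmall.det {n e : ℕ} {M : Matrix (Fin n) (Fin n) F} (h : ∀ i j, IsSmall a e (M i j)) :
    IsSmall a (n * e + n * n) M.det := by
  rw [Matrix.det_apply]
  refine IsSmall.sum (fun σ _ => ?_) ?_
  · have h1 : IsSmall a (n * e) (∏ i, M (σ i) i) := by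
      simpa using IsSmall.prod (s := Finset.univ) fun i _ => h (σ i) i
    rcases Int.units_eq_one_or (Equiv.Perm.sign σ) with hs | hs
    · rw [hs, one_smul]; exact h1
    · rw [hs, Units.neg_smul, one_smul]; exact h1.neg
  -- The number of terms satisfies `n! ≤ n ^ n ≤ (2 ^ n) ^ n`, which explains the summand `n * n`.
  · rw [Finset.card_univ, Fintype.card_perm, Fintype.card_fin, pow_mul]
    exact (Nat.factorial_le_pow n).trans (Nat.pow_le_pow_left Nat.lt_two_pow_self.le n)

theorem IsSmall.adjugate {n e : ℕ} {M : Matrix (Fin n) (Fin n) F} (h : ∀ i j, IsSmall a e (M i j))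
    (i j : Fin n) : IsSmall a (n * e + n * n) (M.adjugate i j) := by
  rw [Matrix.adjugate_apply]
  apply IsSmall.det
  intro i' j'
  rw [Matrix.updateRow_apply, Pi.single_apply]
  split_ifs
  · exact isSmall_one e
  · exact isSmall_zero e
  · exact h i' j'

/-- The size of the minors of vectors of size `e` in dimension `m`. -/
def minorBound (m e : ℕ) : ℕ := m * e + m * m

/-- The size of the reduced vectors. -/
def redBound (m e : ℕ) : ℕ := minorBound m e + e + m

/-- The size of the intermediate results of the elimination. -/
def elimBound (m e : ℕ) : ℕ := 2 * redBound m e + e + m + 3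

theorem minorBound_mono {n m : ℕ} (h : n ≤ m) (e : ℕ) : minorBound n e ≤ minorBound m e :=
  Nat.add_le_add (Nat.mul_le_mul_right _ h) (Nat.mul_le_mul h h)

/-- By `IsReduced.eq_sum`, an entry of a reduced row is a sum of `n` products of a cofactor and an
entry of `V`. The bound depends only on `V` and the dimension and does not accumulate over the
insertions. -/
theorem IsReduced.isSmall {κ : Type*} {n m e : ℕ} {p : Fin n → κ} {V R : Fin n → κ → F} {d : F}
    (h : IsReduced p V R d) (hV : ∀ i l, IsSmall a e (V i l)) (hn : n ≤ m) :
    IsSmall a (minorBound m e) d ∧ ∀ i l, IsSmall a (redBound m e) (R i l) := by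
  constructor
  · rw [h.det]
    exact (IsSmall.det fun i j => hV i (p j)).mono (minorBound_mono hn e)
  · intro i l
    rw [h.eq_sum i, Finset.sum_apply]
    refine IsSmall.mono (IsSmall.sum (e := minorBound m e + e) (j := n) (fun k _ => ?_) ?_) ?_
    · exact ((IsSmall.adjugate (fun i j => hV i (p j)) i k).mono (minorBound_mono hn e)).mul
        (hV k l)
    · simpa using Nat.lt_two_pow_self.le
    · unfold redBound; omega

/-- There are few rows, and the pivot minor and the entries of the reduced vectors are small. -/
structure RowsSmall {s : Shape} (a : Fin k → F) (m e : ℕ) (S : F × List (Row F s)) : Prop where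
  length : S.2.length ≤ m
  det : IsSmall a (minorBound m e) S.1
  red : ∀ r ∈ S.2, ∀ l, IsSmall a (redBound m e) (r.red l)

theorem RowsReduced.small {s : Shape} {S : F × List (Row F s)} (h : RowsReduced S.1 S.2) {m e : ℕ}
    (hm : s.numLeaves ≤ m) (hS : ∀ r ∈ S.2, ∀ l, IsSmall a e (r.orig l)) :
    RowsSmall a m e S := by
  have hl := h.length_le
  obtain ⟨d, rows⟩ := S
  obtain ⟨n, p, V, R, rfl, hR⟩ := h
  rw [List.length_ofFn] at hl
  have h1 := hR.isSmall (m := m) (e := e) (fun i l => hS _ (List.mem_ofFn.2 ⟨i, rfl⟩) l)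
    (hl.trans hm)
  refine ⟨by simpa using hl.trans hm, h1.1, ?_⟩
  intro r hr l
  obtain ⟨i, rfl⟩ := List.mem_ofFn.1 hr
  exact h1.2 i l

namespace NCFormula

/-- Each node raises the bound by at most one: a constant leaf multiplies by one constant, a plus
gate adds once. At a product gate the growth in `f` precedes that in `g`, so the sizes add up and
nothing doubles. -/
theorem step_isSmall (G : NCFormula F ℕ) (hG : G.AllLeaves (fun _ => True) (IsSmall a 1)) {e : ℕ}
    (x : ℕ) {v : Leaf G.shape → F} {c : F} (hv : ∀ l, IsSmall a e (v l)) (hc : IsSmall a e c) :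
    (∀ l, IsSmall a (e + G.size) ((G.step x v c).1 l)) ∧
      IsSmall a (e + G.size) (G.step x v c).2 := by
  induction G generalizing e c with
  | var y =>
    constructor
    · intro l
      simp only [step]
      split_ifs
      · exact hc.mono (Nat.le_add_right _ _)
      · exact isSmall_zero _
    · exact (hv .here).mono (Nat.le_add_right _ _)
  | const b =>
    exact ⟨fun l => (by cases l), hc.mul hG⟩
  | unary op f ih =>
    have h := ih hG hv hc
    exact ⟨fun l => (h.1 l).mono (Nat.le_succ _), h.2.mono (Nat.le_succ _)⟩
  | binary op f g ihf ihg =>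
    have hf := ihf hG.1 (fun l => hv (.inl l)) hc
    cases op with
    | plus =>
      have hg := ihg hG.2 (fun l => hv (.inr l)) hc
      refine ⟨fun l => ?_, ?_⟩
      · cases l with
        | inl l => exact (hf.1 l).mono (by simp only [size]; omega)
        | inr l => exact (hg.1 l).mono (by simp only [size]; omega)
      · exact ((hf.2.mono (by omega : _ ≤ e + f.size + g.size)).add
          (hg.2.mono (by omega))).mono (by simp only [size]; omega)
    | times =>
      have hg := ihg hG.2 (fun l => (hv (.inr l)).mono (Nat.le_add_right e f.size)) hf.2
      refine ⟨fun l => ?_, hg.2.mono (by simp only [size]; omega)⟩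
      cases l with
      | inl l => exact (hf.1 l).mono (by simp only [size]; omega)
      | inr l => exact (hg.1 l).mono (by simp only [size]; omega)

theorem reach_isSmall (G : NCFormula F ℕ) (hG : G.AllLeaves (fun _ => True) (IsSmall a 1))
    (w : List ℕ) (l : Leaf (.node .leaf G.shape)) : IsSmall a (w.length * G.size) (G.reach w l) := by
  induction w using List.reverseRecOn generalizing l with
  | nil =>
    rcases l with _ | ⟨⟨⟩⟩ | l
    · exact isSmall_one _
    · exact isSmall_zero _
  | append_singleton w x ih =>
    rw [reach_concat, List.length_append, List.length_singleton, add_mul, one_mul]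
    rcases l with _ | ⟨⟨⟩⟩ | l
    · exact isSmall_zero _
    · exact (G.step_isSmall hG x (fun l => ih (.inr l)) (ih (.inl .here))).1 l

end NCFormula

theorem monotone_eval (p : Polynomial ℕ) : Monotone fun n => p.eval n := by
  intro x y hxy
  simp only [Polynomial.eval_eq_sum_range]
  exact Finset.sum_le_sum fun i _ => Nat.mul_le_mul_left _ (Nat.pow_le_pow_left hxy i)

theorem EfficientlyRepresented.bound {len : F → ℕ} {q : Polynomial ℕ}
    (hq : ∀ (k : ℕ) (a : Fin k → F) (N : MvPolynomial (Fin k) ℤ),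
    len (MvPolynomial.aeval a N) ≤
      q.eval (N.totalDegree + Nat.size (∑ m ∈ N.support, (N.coeff m).natAbs) + ∑ i, len (a i)))
    {e : ℕ} {c : F} (hc : IsSmall a e c) : len c ≤ q.eval (2 * e + 1 + ∑ i, len (a i)) := by
  obtain ⟨N, h1, h2, rfl⟩ := hc
  refine (hq k a N).trans ?_
  -- A number of at most `2 ^ e` has at most `e + 1` bits. Together with the degree this makes `2 *
  -- e + 1`.
  have h3 : Nat.size (natNorm N) ≤ e + 1 :=
    Nat.size_le.2 (lt_of_le_of_lt h2 (Nat.pow_lt_pow_right one_lt_two (Nat.lt_succ_self e)))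
  apply monotone_eval q
  unfold natNorm at h3
  omega

end IsSmall

end OrderedFormulas

namespace OrderedFormulas

/-! ### A calculus for the values and costs of programs -/

section WeakestPrecondition

variable {F : Type*} [Field F]

/-- The function number `k` of the program maps `v` to `w` within `B` steps. -/
def Returns (len : F → ℕ) (P : Program) (k : ℕ) (v w : Data F) (B : ℕ) : Prop :=
  ∃ body t, P[k]? = some body ∧ Eval len P [v] body w t ∧ t ≤ B

theorem Returns.mono {len : F → ℕ} {P : Program} {k : ℕ} {v w : Data F} {B B' : ℕ}
    (h : Returns len P k v w B) (hB : B ≤ B') : Returns len P k v w B' := by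
  obtain ⟨body, t, h1, h2, h3⟩ := h
  exact ⟨body, t, h1, h2, h3.trans hB⟩

/-- Case distinction according to a truth value. -/
def Data.branch (v : Data F) (p q : Prop) : Prop :=
  match v with
  | .nil => q
  | .elt _ => p
  | .pair _ _ => p

/-- Weakest preconditions; the number passed to the postcondition is a bound for the cost. -/
def Expr.wp (len : F → ℕ) (P : Program) : Expr → List (Data F) → (Data F → ℕ → Prop) → Prop
  | .loc i, env, Q => Q (env.getD i .nil) 1
  | .nil, _, Q => Q .nil 1
  | .zero, _, Q => Q (.elt 0) (1 + len 0)
  | .one, _, Q => Q (.elt 1) (1 + len 1)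
  | .pair e₁ e₂, env, Q =>
    e₁.wp len P env fun v₁ t₁ => e₂.wp len P env fun v₂ t₂ => Q (.pair v₁ v₂) (t₁ + t₂ + 1)
  | .head e, env, Q => e.wp len P env fun v t => Q v.head (t + 1)
  | .tail e, env, Q => e.wp len P env fun v t => Q v.tail (t + 1)
  | .arith op e₁ e₂, env, Q =>
    e₁.wp len P env fun v₁ t₁ => e₂.wp len P env fun v₂ t₂ => Q (Data.arith op v₁ v₂)
      (t₁ + t₂ + 1 + v₁.eltSize len + v₂.eltSize len + (Data.arith op v₁ v₂).eltSize len)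
  | .test op e, env, Q => e.wp len P env fun v t => Q (Data.test op v) (t + 1 + v.eltSize len)
  | .cond c e₁ e₂, env, Q => c.wp len P env fun b t =>
    b.branch (e₁.wp len P env fun v t' => Q v (t + t' + 1))
      (e₂.wp len P env fun v t' => Q v (t + t' + 1))
  | .letIn e₁ e₂, env, Q => e₁.wp len P env fun v₁ t₁ =>
    e₂.wp len P (v₁ :: env) fun v₂ t₂ => Q v₂ (t₁ + t₂ + 1)
  | .call k e, env, Q => e.wp len P env fun v t =>
    ∃ w B, Returns len P k v w B ∧ Q w (t + B + 1)

/-- A call contributes the bound of its specification instead of its exact cost, so the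
postcondition is obtained for some `T` that is at least the true cost `t`. -/
theorem Expr.wp_sound {len : F → ℕ} {P : Program} (e : Expr) {env : List (Data F)}
    {Q : Data F → ℕ → Prop} (h : e.wp len P env Q) :
    ∃ v t T, Eval len P env e v t ∧ t ≤ T ∧ Q v T := by
  induction e generalizing env Q with
  | loc i => exact ⟨_, _, _, .loc env i, le_rfl, h⟩
  | nil => exact ⟨_, _, _, .nil env, le_rfl, h⟩
  | zero => exact ⟨_, _, _, .zero env, le_rfl, h⟩
  | one => exact ⟨_, _, _, .one env, le_rfl, h⟩
  | pair e₁ e₂ ih₁ ih₂ =>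
    obtain ⟨v₁, t₁, T₁, h₁, hT₁, h⟩ := ih₁ h
    obtain ⟨v₂, t₂, T₂, h₂, hT₂, h⟩ := ih₂ h
    exact ⟨_, _, _, .pair h₁ h₂, by omega, h⟩
  | head e ih =>
    obtain ⟨v₁, t₁, T₁, h₁, hT₁, h⟩ := ih h
    exact ⟨_, _, _, .head h₁, by omega, h⟩
  | tail e ih =>
    obtain ⟨v₁, t₁, T₁, h₁, hT₁, h⟩ := ih h
    exact ⟨_, _, _, .tail h₁, by omega, h⟩
  | arith op e₁ e₂ ih₁ ih₂ =>
    obtain ⟨v₁, t₁, T₁, h₁, hT₁, h⟩ := ih₁ h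
    obtain ⟨v₂, t₂, T₂, h₂, hT₂, h⟩ := ih₂ h
    exact ⟨_, _, _, .arith h₁ h₂, by omega, h⟩
  | test op e ih =>
    obtain ⟨v₁, t₁, T₁, h₁, hT₁, h⟩ := ih h
    exact ⟨_, _, _, .test h₁, by omega, h⟩
  | cond c e₁ e₂ ihc ih₁ ih₂ =>
    obtain ⟨b, t₁, T₁, h₁, hT₁, h⟩ := ihc h
    cases b with
    | nil =>
      obtain ⟨v₂, t₂, T₂, h₂, hT₂, h⟩ := ih₂ h
      exact ⟨_, _, _, .condFalse h₁ h₂, by omega, h⟩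
    | elt a =>
      obtain ⟨v₂, t₂, T₂, h₂, hT₂, h⟩ := ih₁ h
      exact ⟨_, _, _, .condTrue h₁ nofun h₂, by omega, h⟩
    | pair u v =>
      obtain ⟨v₂, t₂, T₂, h₂, hT₂, h⟩ := ih₁ h
      exact ⟨_, _, _, .condTrue h₁ nofun h₂, by omega, h⟩
  | letIn e₁ e₂ ih₁ ih₂ =>
    obtain ⟨v₁, t₁, T₁, h₁, hT₁, h⟩ := ih₁ h
    obtain ⟨v₂, t₂, T₂, h₂, hT₂, h⟩ := ih₂ h
    exact ⟨_, _, _, .letIn h₁ h₂, by omega, h⟩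
  | call k e ih =>
    obtain ⟨v₁, t₁, T₁, h₁, hT₁, w, B, ⟨body, t, hb, ht, htB⟩, h⟩ := ih h
    exact ⟨_, _, _, .call h₁ hb ht, by omega, h⟩

/-- The pattern of all verifications below: unfolding `wp` leaves one existential per call, filled
by an earlier specification or by an induction hypothesis for a recursive call, and then an
inequality of costs. -/
theorem Returns.of_wp {len : F → ℕ} {P : Program} {k : ℕ} {body : Expr} (hk : P[k]? = some body)
    {v w : Data F} {B : ℕ} (h : body.wp len P [v] fun w' t => w' = w ∧ t ≤ B) :
    Returns len P k v w B := by
  obtain ⟨v', t, T, h1, h2, rfl, h3⟩ := body.wp_sound h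
  exact ⟨body, t, hk, h1, h2.trans h3⟩

end WeakestPrecondition

section Evaluation

variable {F : Type*}

namespace Data

@[simp] theorem branch_nil (p q : Prop) : (nil : Data F).branch p q = q := rfl
@[simp] theorem branch_pair (u v : Data F) (p q : Prop) : (pair u v).branch p q = p := rfl
@[simp] theorem branch_true (p q : Prop) : (ofBool true : Data F).branch p q = p := rfl
@[simp] theorem branch_false (p q : Prop) : (ofBool false : Data F).branch p q = q := rfl
@[simp] theorem head_pair (u v : Data F) : (pair u v).head = u := rfl
@[simp] theorem tail_pair (u v : Data F) : (pair u v).tail = v := rfl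
@[simp] theorem eltSize_elt (len : F → ℕ) (a : F) : (elt a).eltSize len = len a := rfl
@[simp] theorem eltSize_nil (len : F → ℕ) : (nil : Data F).eltSize len = 0 := rfl
@[simp] theorem eltSize_pair (len : F → ℕ) (u v : Data F) : (pair u v).eltSize len = 0 := rfl
theorem branch_ofBool (b : Bool) (p q : Prop) :
    (ofBool b : Data F).branch p q ↔ (b = true → p) ∧ (b = false → q) := by
  cases b <;> simp [branch, ofBool]

variable [Field F]

@[simp] theorem test_isPair_pair (u v : Data F) : test .isPair (pair u v) = ofBool true := rfl
@[simp] theorem test_isPair_nil : test .isPair (nil : Data F) = ofBool false := rfl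
@[simp] theorem test_isPair_elt (a : F) : test .isPair (elt a) = ofBool false := rfl
@[simp] theorem test_isElt_elt (a : F) : test .isElt (elt a) = ofBool true := rfl
@[simp] theorem test_isElt_nil : test .isElt (nil : Data F) = ofBool false := rfl
open Classical in
@[simp] theorem test_isZero_elt (a : F) : test .isZero (elt a) = ofBool (decide (a = 0)) := rfl
@[simp] theorem arith_add (a b : F) : arith .add (elt a) (elt b) = elt (a + b) := rfl
@[simp] theorem arith_sub (a b : F) : arith .sub (elt a) (elt b) = elt (a - b) := rfl
@[simp] theorem arith_mul (a b : F) : arith .mul (elt a) (elt b) = elt (a * b) := rfl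
@[simp] theorem arith_div (a b : F) : arith .div (elt a) (elt b) = elt (a / b) := rfl

end Data

end Evaluation

/-! ### The program -/

namespace Expr

def tt : Expr := .pair .nil .nil

/-- Case distinction according to the kind `c` of the root of a formula. -/
def formulaCases (c var const unary binary : Expr) : Expr :=
  .cond c (.cond (.head c) (.cond (.tail c) binary const) unary) var

/-- Equality of trees without field elements: `(u . v)`. -/
def eqBody : Expr :=
  .cond (.test .isPair (.head (.loc 0)))
    (.cond (.test .isPair (.tail (.loc 0)))
      (.cond (.call 1 (.pair (.head (.head (.loc 0))) (.head (.tail (.loc 0)))))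
        (.call 1 (.pair (.tail (.head (.loc 0))) (.tail (.tail (.loc 0))))) .nil) .nil)
    (.cond (.test .isPair (.tail (.loc 0))) .nil tt)

/-- Zeroing of a variable: `(x . G)`. -/
def zeroVarBody : Expr :=
  formulaCases (.head (.tail (.loc 0)))
    (.cond (.call 1 (.pair (.tail (.tail (.loc 0))) (.head (.loc 0))))
      (.pair (.pair tt .nil) .zero) (.tail (.loc 0)))
    (.tail (.loc 0))
    (.pair (.head (.tail (.loc 0))) (.pair (.head (.tail (.tail (.loc 0))))
      (.call 2 (.pair (.head (.loc 0)) (.tail (.tail (.tail (.loc 0))))))))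
    (.pair (.head (.tail (.loc 0))) (.pair (.head (.tail (.tail (.loc 0))))
      (.pair (.call 2 (.pair (.head (.loc 0)) (.head (.tail (.tail (.tail (.loc 0)))))))
        (.call 2 (.pair (.head (.loc 0)) (.tail (.tail (.tail (.tail (.loc 0))))))))))

/-- A step of the position automaton: `(x . (G . (v . a)))`. -/
def stepBody : Expr :=
  formulaCases (.head (.head (.tail (.loc 0))))
    (.pair (.cond (.call 1 (.pair (.tail (.head (.tail (.loc 0)))) (.head (.loc 0))))
      (.tail (.tail (.tail (.loc 0)))) .zero) (.head (.tail (.tail (.loc 0)))))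
    (.pair .nil (.arith .mul (.tail (.tail (.tail (.loc 0)))) (.tail (.head (.tail (.loc 0))))))
    (.call 3 (.pair (.head (.loc 0)) (.pair (.tail (.tail (.head (.tail (.loc 0)))))
      (.tail (.tail (.loc 0))))))
    (.letIn (.call 3 (.pair (.head (.loc 0)) (.pair (.head (.tail (.tail (.head (.tail (.loc 0))))))
        (.pair (.head (.head (.tail (.tail (.loc 0))))) (.tail (.tail (.tail (.loc 0))))))))
      (.letIn (.call 3 (.pair (.head (.loc 1))
          (.pair (.tail (.tail (.tail (.head (.tail (.loc 1))))))
            (.pair (.tail (.head (.tail (.tail (.loc 1)))))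
              (.cond (.head (.tail (.head (.tail (.loc 1))))) (.tail (.loc 0))
                (.tail (.tail (.tail (.loc 1)))))))))
        (.pair (.pair (.head (.loc 1)) (.head (.loc 0)))
          (.cond (.head (.tail (.head (.tail (.loc 2))))) (.tail (.loc 0))
            (.arith .add (.tail (.loc 1)) (.tail (.loc 0)))))))

/-- The zero vector indexed by the leaves: `G`. -/
def zeroVectorBody : Expr :=
  formulaCases (.head (.loc 0)) .zero .nil (.call 4 (.tail (.tail (.loc 0))))
    (.pair (.call 4 (.head (.tail (.tail (.loc 0))))) (.call 4 (.tail (.tail (.tail (.loc 0))))))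

/-- The vector `(α u - β v) / δ`: `(α . (u . (β . (v . δ))))`. -/
def combBody : Expr :=
  .cond (.test .isPair (.head (.tail (.loc 0))))
    (.pair
      (.call 5 (.pair (.head (.loc 0)) (.pair (.head (.head (.tail (.loc 0))))
        (.pair (.head (.tail (.tail (.loc 0))))
          (.pair (.head (.head (.tail (.tail (.tail (.loc 0))))))
            (.tail (.tail (.tail (.tail (.loc 0))))))))))
      (.call 5 (.pair (.head (.loc 0)) (.pair (.tail (.head (.tail (.loc 0))))
        (.pair (.head (.tail (.tail (.loc 0))))
          (.pair (.tail (.head (.tail (.tail (.tail (.loc 0))))))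
            (.tail (.tail (.tail (.tail (.loc 0)))))))))))
    (.cond (.test .isElt (.head (.tail (.loc 0))))
      (.arith .div
        (.arith .sub (.arith .mul (.head (.loc 0)) (.head (.tail (.loc 0))))
          (.arith .mul (.head (.tail (.tail (.loc 0)))) (.head (.tail (.tail (.tail (.loc 0)))))))
        (.tail (.tail (.tail (.tail (.loc 0))))))
      .nil)

/-- The entry of a vector at a leaf: `(l . v)`. -/
def entryBody : Expr :=
  .cond (.head (.loc 0))
    (.cond (.head (.head (.loc 0)))
      (.call 6 (.pair (.tail (.head (.loc 0))) (.tail (.tail (.loc 0)))))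
      (.call 6 (.pair (.tail (.head (.loc 0))) (.head (.tail (.loc 0))))))
    (.tail (.loc 0))

/-- The first leaf with a nonzero entry: `v`. -/
def findLeafBody : Expr :=
  .cond (.test .isPair (.loc 0))
    (.letIn (.call 7 (.head (.loc 0)))
      (.cond (.loc 0) (.pair .nil (.pair .nil (.tail (.loc 0))))
        (.letIn (.call 7 (.tail (.loc 1)))
          (.cond (.loc 0) (.pair .nil (.pair tt (.tail (.loc 0)))) .nil))))
    (.cond (.test .isElt (.loc 0)) (.cond (.test .isZero (.loc 0)) .nil tt) .nil)

/-- Reduction of a vector: `(v . (rows . acc))`. -/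
def reduceBody : Expr :=
  .cond (.head (.tail (.loc 0)))
    (.call 8 (.pair (.head (.loc 0)) (.pair (.tail (.head (.tail (.loc 0))))
      (.call 5 (.pair .one (.pair (.tail (.tail (.loc 0)))
        (.pair (.call 6 (.pair (.head (.head (.head (.tail (.loc 0))))) (.head (.loc 0))))
          (.pair (.tail (.tail (.head (.head (.tail (.loc 0)))))) .one))))))))
    (.tail (.tail (.loc 0)))

/-- Update of all rows: `(j . (w . (wj . (d . rows))))`. -/
def updateBody : Expr :=
  .cond (.tail (.tail (.tail (.tail (.loc 0)))))
    (.letIn (.head (.tail (.tail (.tail (.tail (.loc 0))))))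
      (.pair
        (.pair (.head (.loc 0)) (.pair (.head (.tail (.loc 0)))
          (.call 5 (.pair (.head (.tail (.tail (.loc 1)))) (.pair (.tail (.tail (.loc 0)))
            (.pair (.call 6 (.pair (.head (.loc 1)) (.tail (.tail (.loc 0)))))
              (.pair (.head (.tail (.loc 1))) (.head (.tail (.tail (.tail (.loc 1))))))))))))
        (.call 9 (.pair (.head (.loc 1)) (.pair (.head (.tail (.loc 1)))
          (.pair (.head (.tail (.tail (.loc 1))))
            (.pair (.head (.tail (.tail (.tail (.loc 1)))))
              (.tail (.tail (.tail (.tail (.tail (.loc 1)))))))))))))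
    .nil

/-- Insertion of a vector: `(v . (d . rows))`. -/
def insertBody : Expr :=
  .letIn (.call 8 (.pair (.head (.loc 0)) (.pair (.tail (.tail (.loc 0)))
      (.call 5 (.pair (.head (.tail (.loc 0))) (.pair (.head (.loc 0))
        (.pair .zero (.pair (.head (.loc 0)) .one))))))))
    (.letIn (.call 7 (.loc 0))
      (.cond (.loc 0)
        (.letIn (.call 6 (.pair (.tail (.loc 0)) (.loc 1)))
          (.pair (.loc 0)
            (.pair (.pair (.tail (.loc 1)) (.pair (.head (.loc 3)) (.loc 2)))
              (.call 9 (.pair (.tail (.loc 1)) (.pair (.loc 2) (.pair (.loc 0)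
                (.tail (.loc 3)))))))))
        (.tail (.loc 2))))

/-- Insertion of the successors of a state: `(G . (v . (L . S)))`. -/
def insertNextBody : Expr :=
  .cond (.head (.tail (.tail (.loc 0))))
    (.call 11 (.pair (.head (.loc 0)) (.pair (.head (.tail (.loc 0)))
      (.pair (.tail (.head (.tail (.tail (.loc 0)))))
        (.call 10 (.pair
          (.pair .zero (.head (.call 3 (.pair (.head (.head (.tail (.tail (.loc 0)))))
            (.pair (.head (.loc 0)) (.pair (.tail (.head (.tail (.loc 0))))
              (.head (.head (.tail (.loc 0))))))))))
          (.tail (.tail (.tail (.loc 0))))))))))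
    (.tail (.tail (.tail (.loc 0))))

/-- Insertion of the successors of all rows: `(G . (L . (rows . S)))`. -/
def insertAllBody : Expr :=
  .cond (.head (.tail (.tail (.loc 0))))
    (.call 12 (.pair (.head (.loc 0)) (.pair (.head (.tail (.loc 0)))
      (.pair (.tail (.head (.tail (.tail (.loc 0)))))
        (.call 11 (.pair (.head (.loc 0))
          (.pair (.head (.tail (.head (.head (.tail (.tail (.loc 0)))))))
            (.pair (.head (.tail (.loc 0))) (.tail (.tail (.tail (.loc 0))))))))))))
    (.tail (.tail (.tail (.loc 0))))

/-- Iteration, as often as the tree `T` has inner nodes: `(T . (G . (L . S)))`. -/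
def closureBody : Expr :=
  .cond (.test .isPair (.head (.loc 0)))
    (.call 13 (.pair (.tail (.head (.loc 0))) (.pair (.head (.tail (.loc 0)))
      (.pair (.head (.tail (.tail (.loc 0))))
        (.call 13 (.pair (.head (.head (.loc 0))) (.pair (.head (.tail (.loc 0)))
          (.pair (.head (.tail (.tail (.loc 0))))
            (.call 12 (.pair (.head (.tail (.loc 0))) (.pair (.head (.tail (.tail (.loc 0))))
              (.pair (.tail (.tail (.tail (.tail (.loc 0)))))
                (.tail (.tail (.tail (.loc 0))))))))))))))))
    (.tail (.tail (.tail (.loc 0))))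

/-- The outputs of all rows vanish: `(G . rows)`. -/
def outputsZeroBody : Expr :=
  .cond (.tail (.loc 0))
    (.cond (.test .isZero (.tail (.call 3 (.pair .nil (.pair (.head (.loc 0))
        (.pair (.tail (.head (.tail (.head (.tail (.loc 0))))))
          (.head (.head (.tail (.head (.tail (.loc 0))))))))))))
      (.call 14 (.pair (.head (.loc 0)) (.tail (.tail (.loc 0))))) .nil)
    tt

/-- The formula computes zero: `(G . L)`. -/
def isZeroBody : Expr :=
  .call 14 (.pair (.head (.loc 0)) (.tail (.call 13 (.pair (.head (.loc 0)) (.pair (.head (.loc 0))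
    (.pair (.tail (.loc 0)) (.call 10 (.pair (.pair .one (.call 4 (.head (.loc 0))))
      (.pair .one .nil)))))))))

/-- The variable does not occur: `(x . (G . L))`. -/
def notOccursBody : Expr :=
  .call 15 (.pair
    (.pair (.pair tt (.pair tt .nil)) (.pair .nil (.pair (.head (.tail (.loc 0)))
      (.pair (.pair tt (.pair tt .nil)) (.pair (.pair tt .nil)
        (.pair (.pair (.pair tt .nil) (.arith .sub .zero .one))
          (.call 2 (.pair (.head (.loc 0)) (.head (.tail (.loc 0)))))))))))
    (.tail (.tail (.loc 0))))

/-- Zeroing of the variables in a list that do not occur: `(X . (G . L))`. -/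
def cleanBody : Expr :=
  .cond (.head (.loc 0))
    (.call 16 (.pair (.tail (.head (.loc 0)))
      (.pair (.cond (.call 17 (.pair (.head (.head (.loc 0))) (.tail (.loc 0))))
        (.call 2 (.pair (.head (.head (.loc 0))) (.head (.tail (.loc 0)))))
        (.head (.tail (.loc 0)))) (.tail (.tail (.loc 0))))))
    (.head (.tail (.loc 0)))

/-- No variable of a list occurs: `(X . (f . L))`. -/
def noneOccursBody : Expr :=
  .cond (.head (.loc 0))
    (.cond (.call 17 (.pair (.head (.head (.loc 0))) (.tail (.loc 0))))
      (.call 18 (.pair (.tail (.head (.loc 0))) (.tail (.loc 0)))) .nil)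
    tt

/-- There is no descent: `(X . (f . (g . L)))`. -/
def noDescentBody : Expr :=
  .cond (.head (.loc 0))
    (.cond
      (.cond (.call 17 (.pair (.head (.head (.loc 0))) (.tail (.tail (.loc 0))))) tt
        (.call 18 (.pair (.tail (.head (.loc 0)))
          (.pair (.head (.tail (.loc 0))) (.tail (.tail (.tail (.loc 0))))))))
      (.call 19 (.pair (.tail (.head (.loc 0))) (.tail (.loc 0)))) .nil)
    tt

/-- The main function: `(G . L)`. -/
def processBody : Expr :=
  formulaCases (.head (.head (.loc 0))) (.head (.loc 0)) (.head (.loc 0))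
    (.letIn (.call 0 (.pair (.tail (.tail (.head (.loc 0)))) (.tail (.loc 0))))
      (.cond (.loc 0) (.pair (.head (.head (.loc 1))) (.pair (.head (.tail (.head (.loc 1))))
        (.loc 0))) .nil))
    (.letIn (.call 0 (.pair (.head (.tail (.tail (.head (.loc 0))))) (.tail (.loc 0))))
      (.cond (.loc 0)
        (.letIn (.call 0 (.pair (.tail (.tail (.tail (.head (.loc 1))))) (.tail (.loc 1))))
          (.cond (.loc 0)
            (.cond (.head (.tail (.head (.loc 2))))
              (.cond (.call 19 (.pair (.tail (.loc 2)) (.pair (.loc 1) (.pair (.loc 0)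
                  (.tail (.loc 2))))))
                (.pair (.head (.head (.loc 2))) (.pair (.head (.tail (.head (.loc 2))))
                  (.pair (.call 16 (.pair (.tail (.loc 2)) (.pair (.loc 1) (.tail (.loc 2)))))
                    (.call 16 (.pair (.tail (.loc 2)) (.pair (.loc 0) (.tail (.loc 2))))))))
                .nil)
              (.pair (.head (.head (.loc 2))) (.pair (.head (.tail (.head (.loc 2))))
                (.pair (.loc 1) (.loc 0)))))
            .nil))
        .nil))

end Expr

/-- The functions of the algorithm. -/
def program : Program :=
  [.processBody, .eqBody, .zeroVarBody, .stepBody, .zeroVectorBody, .combBody, .entryBody,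
    .findLeafBody, .reduceBody, .updateBody, .insertBody, .insertNextBody, .insertAllBody,
    .closureBody, .outputsZeroBody, .isZeroBody, .cleanBody, .notOccursBody, .noneOccursBody,
    .noDescentBody]

/-! ### Representation of the objects -/

section Encoding

variable {F : Type*}

/-- Trees without field elements. -/
def Data.Pure : Data F → Prop
  | .nil => True
  | .elt _ => False
  | .pair u v => u.Pure ∧ v.Pure

def Leaf.encode : {s : Shape} → Leaf s → Data F
  | _, .here => .nil
  | _, .inl l => .pair .nil l.encode
  | _, .inr l => .pair (.pair .nil .nil) l.encode

/-- A vector indexed by the leaves of a tree. -/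
def fill : (s : Shape) → (Leaf s → F) → Data F
  | .empty, _ => .nil
  | .leaf, v => .elt (v .here)
  | .node s t, v => .pair (fill s fun l => v (.inl l)) (fill t fun l => v (.inr l))

/-- The leaf `Leaf.here` is coded by `nil`; the additional pair separates it from `none`. -/
def encodeOption {s : Shape} : Option (Leaf s) → Data F
  | none => .nil
  | some l => .pair .nil l.encode

def Row.encode {s : Shape} (r : Row F s) : Data F :=
  .pair r.piv.encode (.pair (fill s r.orig) (fill s r.red))

def encodeRows {s : Shape} (rows : List (Row F s)) : Data F := .ofList (rows.map Row.encode)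

def encodeBasis {s : Shape} (S : F × List (Row F s)) : Data F :=
  .pair (.elt S.1) (encodeRows S.2)

def encodeVars (L : List ℕ) : Data F := .ofList (L.map Data.ofNat)

theorem Data.ofNat_pure (n : ℕ) : (Data.ofNat n : Data F).Pure := by
  unfold Data.ofNat
  induction n.bits with
  | nil => trivial
  | cons b l ih => exact ⟨by cases b <;> simp [Data.ofBool, Pure], ih⟩

theorem Data.ofNat_injective : Function.Injective (Data.ofNat : ℕ → Data F) := by
  have h1 : Function.Injective (Data.ofBool : Bool → Data F) := by
    intro a b h
    cases a <;> cases b <;> simp_all [Data.ofBool]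
  have h2 : Function.Injective (Data.ofList : List (Data F) → Data F) := by
    intro l
    induction l with
    | nil => intro l' h; cases l' <;> simp_all [Data.ofList]
    | cons x l ih =>
      intro l' h
      cases l' with
      | nil => simp [Data.ofList] at h
      | cons y l' =>
        simp only [Data.ofList, Data.pair.injEq] at h
        rw [h.1, ih h.2]
  intro m n h
  have h3 := List.map_injective_iff.2 h1 (h2 h)
  exact Nat.eq_of_testBit_eq fun i => by rw [Nat.testBit_eq_inth, Nat.testBit_eq_inth, h3]

/-- The tags of nodes as lists of bits, lowest bit first; `Expr.formulaCases` branches on whether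
the list is empty, on the first bit, and on whether there is a second one. -/
theorem Data.ofNat_zero : (Data.ofNat 0 : Data F) = .nil := by simp [Data.ofNat, Data.ofList]
theorem Data.ofNat_one : (Data.ofNat 1 : Data F) = .pair (.pair .nil .nil) .nil := by
  simp [Data.ofNat, Data.ofList, Data.ofBool]
theorem Data.ofNat_two : (Data.ofNat 2 : Data F) = .pair .nil (.pair (.pair .nil .nil) .nil) := by
  rw [Data.ofNat, show Nat.bits 2 = [false, true] from (Nat.bit0_bits 1 one_ne_zero).trans
    (by rw [Nat.one_bits])]
  rfl
theorem Data.ofNat_three :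
    (Data.ofNat 3 : Data F) = .pair (.pair .nil .nil) (.pair (.pair .nil .nil) .nil) := by
  rw [Data.ofNat, show Nat.bits 3 = [true, true] from (Nat.bit1_bits 1).trans
    (by rw [Nat.one_bits])]
  rfl

end Encoding

end OrderedFormulas

namespace OrderedFormulas

/-! ### Verification of the functions on trees and vectors -/

section LowLevel

variable {F : Type*} [Field F] {len : F → ℕ}

open Classical in
-- Purity is needed because the function only tests for pairs, so it would identify a field element
-- with `nil`. The recursion stops at the first difference, hence the size of `u` alone bounds the
-- cost.
theorem returns_eq (u v : Data F) (hu : u.Pure) (hv : v.Pure) :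
    Returns len program 1 (.pair u v) (.ofBool (decide (u = v))) (40 * u.size len) := by
  induction u generalizing v with
  | nil =>
    apply Returns.of_wp rfl
    cases v with
    | nil =>
      simp [Expr.eqBody, Expr.tt, Expr.wp, Data.size, Data.ofBool]
    | elt a => cases hv
    | pair v₁ v₂ =>
      simp [Expr.eqBody, Expr.tt, Expr.wp, Data.size, Data.ofBool]
  | elt a => cases hu
  | pair u₁ u₂ ih₁ ih₂ =>
    apply Returns.of_wp rfl
    cases v with
    | nil =>
      simp [Expr.eqBody, Expr.tt, Expr.wp, Data.size, Data.ofBool]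
      omega
    | elt a => cases hv
    | pair v₁ v₂ =>
      simp only [Expr.eqBody, Expr.wp, List.getD_cons_zero, Data.head_pair, Data.tail_pair,
        Data.test_isPair_pair, Data.branch_true, Data.eltSize_pair]
      refine ⟨_, _, ih₁ v₁ hu.1 hv.1, ?_⟩
      by_cases h₁ : u₁ = v₁
      · subst h₁
        simp only [decide_true, Data.branch_true]
        refine ⟨_, _, ih₂ v₂ hu.2 hv.2, ?_, ?_⟩
        · simp
        · simp only [Data.size]; omega
      · simp only [h₁, decide_false, Data.branch_false]
        refine ⟨?_, ?_⟩
        · simp [h₁, Data.ofBool]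
        · simp only [Data.size]; omega

theorem returns_zeroVar {n N : ℕ} (h0 : len 0 ≤ N) (hn : n ≤ N) (x : ℕ) (G : NCFormula F ℕ)
    (hG : G.AllLeaves (fun i => (Data.ofNat i : Data F).size len ≤ n) fun _ => True) :
    Returns len program 2 (.pair (.ofNat x) G.encode) (G.zeroVar x).encode
      (G.size * (50 * N + 100)) := by
  induction G with
  | var y =>
    apply Returns.of_wp rfl
    simp only [Expr.zeroVarBody, Expr.formulaCases, Expr.tt, NCFormula.encode, Data.ofNat_zero,
      Expr.wp, List.getD_cons_zero, Data.head_pair, Data.tail_pair, Data.branch_nil]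
    refine ⟨_, _, returns_eq _ _ (Data.ofNat_pure y) (Data.ofNat_pure x), ?_⟩
    have hy : (Data.ofNat y : Data F).size len ≤ n := hG
    rw [Data.branch_ofBool, NCFormula.zeroVar]
    simp only [decide_eq_true_eq, decide_eq_false_iff_not, Data.ofNat_injective.eq_iff,
      NCFormula.size]
    constructor
    · intro h
      rw [if_pos h]
      refine ⟨?_, by omega⟩
      rw [NCFormula.encode, Data.ofNat_one]
    · intro h
      rw [if_neg h]
      refine ⟨?_, by omega⟩
      rw [NCFormula.encode, Data.ofNat_zero]
  | const a =>
    apply Returns.of_wp rfl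
    simp only [Expr.zeroVarBody, Expr.formulaCases, Expr.tt, NCFormula.encode, Data.ofNat_one,
      Expr.wp, List.getD_cons_zero, Data.head_pair, Data.tail_pair, Data.branch_nil,
      Data.branch_pair, NCFormula.zeroVar, true_and, NCFormula.size]
    omega
  | unary op f ih =>
    apply Returns.of_wp rfl
    simp only [Expr.zeroVarBody, Expr.formulaCases, Expr.tt, NCFormula.encode, Data.ofNat_two,
      Expr.wp, List.getD_cons_zero, Data.head_pair, Data.tail_pair, Data.branch_nil,
      Data.branch_pair, NCFormula.zeroVar, NCFormula.size]
    refine ⟨_, _, ih hG, rfl, ?_⟩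
    simp only [add_mul, one_mul]
    omega
  | binary op f g ihf ihg =>
    apply Returns.of_wp rfl
    simp only [Expr.zeroVarBody, Expr.formulaCases, Expr.tt, NCFormula.encode, Data.ofNat_three,
      Expr.wp, List.getD_cons_zero, Data.head_pair, Data.tail_pair,
      Data.branch_pair, NCFormula.zeroVar, NCFormula.size]
    refine ⟨_, _, ihf hG.1, _, _, ihg hG.2, rfl, ?_⟩
    simp only [add_mul, one_mul]
    omega

theorem returns_zeroVector {N : ℕ} (h0 : len 0 ≤ N) (G : NCFormula F ℕ) :
    Returns len program 4 G.encode (fill G.shape fun _ => 0) (G.size * (N + 50)) := by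
  induction G with
  | var y =>
    apply Returns.of_wp rfl
    simp only [Expr.zeroVectorBody, Expr.formulaCases, NCFormula.encode, Data.ofNat_zero,
      Expr.wp, List.getD_cons_zero, Data.head_pair, Data.branch_nil,
      NCFormula.size, NCFormula.shape, fill, true_and]
    omega
  | const a =>
    apply Returns.of_wp rfl
    simp only [Expr.zeroVectorBody, Expr.formulaCases, NCFormula.encode, Data.ofNat_one,
      Expr.wp, List.getD_cons_zero, Data.head_pair, Data.tail_pair, Data.branch_nil,
      Data.branch_pair, NCFormula.size, NCFormula.shape, fill, true_and]
    omega
  | unary op f ih =>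
    apply Returns.of_wp rfl
    simp only [Expr.zeroVectorBody, Expr.formulaCases, NCFormula.encode, Data.ofNat_two,
      Expr.wp, List.getD_cons_zero, Data.head_pair, Data.tail_pair, Data.branch_nil,
      Data.branch_pair, NCFormula.size, NCFormula.shape]
    refine ⟨_, _, ih, rfl, ?_⟩
    simp only [add_mul, one_mul]
    omega
  | binary op f g ihf ihg =>
    apply Returns.of_wp rfl
    simp only [Expr.zeroVectorBody, Expr.formulaCases, NCFormula.encode, Data.ofNat_three,
      Expr.wp, List.getD_cons_zero, Data.head_pair, Data.tail_pair,
      Data.branch_pair, NCFormula.size, NCFormula.shape]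
    refine ⟨_, _, ihf, _, _, ihg, rfl, ?_⟩
    simp only [add_mul, one_mul]
    omega

/-- All intermediate results of computing `(α u - β v) / δ` have size at most `N`. -/
structure CombBounded (len : F → ℕ) (N : ℕ) (α u β v δ : F) : Prop where
  left : len α ≤ N
  fst : len u ≤ N
  right : len β ≤ N
  snd : len v ≤ N
  den : len δ ≤ N
  mul_left : len (α * u) ≤ N
  mul_right : len (β * v) ≤ N
  sub : len (α * u - β * v) ≤ N
  quot : len ((α * u - β * v) / δ) ≤ N

theorem returns_comb {N : ℕ} {s : Shape} {α β δ : F} {u v : Leaf s → F}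
    (h : ∀ l, CombBounded len N α (u l) β (v l) δ) :
    Returns len program 5
      (.pair (.elt α) (.pair (fill s u) (.pair (.elt β) (.pair (fill s v) (.elt δ)))))
      (fill s fun l => (α * u l - β * v l) / δ) (s.size * (20 * N + 100)) := by
  induction s with
  | empty =>
    apply Returns.of_wp rfl
    simp only [Expr.combBody, Expr.wp, fill, List.getD_cons_zero, Data.head_pair, Data.tail_pair,
      Data.branch_false, Data.test_isPair_nil, Data.test_isElt_nil, Data.eltSize_nil, Shape.size,
      true_and]
    omega
  | leaf =>
    have h := h .here
    have h1 := h.left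
    have h2 := h.fst
    have h3 := h.right
    have h4 := h.snd
    have h5 := h.den
    have h6 := h.mul_left
    have h7 := h.mul_right
    have h8 := h.sub
    have h9 := h.quot
    apply Returns.of_wp rfl
    simp only [Expr.combBody, Expr.wp, fill, List.getD_cons_zero, Data.head_pair, Data.tail_pair,
      Data.branch_false, Data.branch_true, Data.test_isPair_elt, Data.test_isElt_elt,
      Data.arith_mul, Data.arith_sub, Data.arith_div, Data.eltSize_elt, Shape.size, true_and]
    omega
  | node s t ihs iht =>
    apply Returns.of_wp rfl
    simp only [Expr.combBody, Expr.wp, fill, List.getD_cons_zero, Data.head_pair, Data.tail_pair,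
      Data.branch_true, Data.test_isPair_pair, Data.eltSize_pair, Shape.size]
    refine ⟨_, _, ihs fun l => h (.inl l), _, _, iht fun l => h (.inr l), rfl, ?_⟩
    simp only [add_mul, one_mul]
    omega

theorem returns_entry {s : Shape} (l : Leaf s) (v : Leaf s → F) :
    Returns len program 6 (.pair l.encode (fill s v)) (.elt (v l)) (50 * s.size) := by
  induction l with
  | here =>
    apply Returns.of_wp rfl
    simp only [Expr.entryBody, Expr.wp, fill, Leaf.encode, List.getD_cons_zero, Data.head_pair,
      Data.tail_pair, Data.branch_nil, Shape.size, true_and]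
    omega
  | inl l ih =>
    apply Returns.of_wp rfl
    simp only [Expr.entryBody, Expr.wp, fill, Leaf.encode, List.getD_cons_zero, Data.head_pair,
      Data.tail_pair, Data.branch_nil, Data.branch_pair, Shape.size]
    refine ⟨_, _, ih _, rfl, ?_⟩
    omega
  | inr l ih =>
    apply Returns.of_wp rfl
    simp only [Expr.entryBody, Expr.wp, fill, Leaf.encode, List.getD_cons_zero, Data.head_pair,
      Data.tail_pair, Data.branch_pair, Shape.size]
    refine ⟨_, _, ih _, rfl, ?_⟩
    omega

theorem returns_findLeaf {N : ℕ} {s : Shape} {v : Leaf s → F} (h : ∀ l, len (v l) ≤ N) :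
    Returns len program 7 (fill s v) (encodeOption (findLeaf s v)) (s.size * (3 * N + 50)) := by
  induction s with
  | empty =>
    apply Returns.of_wp rfl
    simp only [Expr.findLeafBody, Expr.wp, fill, List.getD_cons_zero, findLeaf, encodeOption,
      Data.branch_false, Data.test_isPair_nil, Data.test_isElt_nil, Data.eltSize_nil, Shape.size,
      true_and]
    omega
  | leaf =>
    have h1 := h .here
    apply Returns.of_wp rfl
    simp only [Expr.findLeafBody, Expr.tt, Expr.wp, fill, List.getD_cons_zero, findLeaf,
      Data.branch_false, Data.branch_true, Data.test_isPair_elt, Data.test_isElt_elt,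
      Data.test_isZero_elt, Data.eltSize_elt, Shape.size]
    by_cases h0 : v .here = 0
    · simp only [h0, if_true, decide_true, Data.branch_true, encodeOption, true_and]
      rw [h0] at h1
      omega
    · simp only [h0, if_false, decide_false, Data.branch_false, encodeOption, true_and, Leaf.encode]
      omega
  | node s t ihs iht =>
    apply Returns.of_wp rfl
    simp only [Expr.findLeafBody, Expr.tt, Expr.wp, fill, List.getD_cons_zero, List.getD_cons_succ,
      findLeaf, Data.branch_true, Data.test_isPair_pair, Data.eltSize_pair, Shape.size,
      Data.head_pair, Data.tail_pair]
    refine ⟨_, _, ihs fun l => h (.inl l), ?_⟩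
    cases h1 : findLeaf s fun l => v (.inl l) with
    | some l =>
      simp only [encodeOption, Data.branch_pair, Data.tail_pair, Leaf.encode, true_and]
      simp only [add_mul, one_mul]
      omega
    | none =>
      simp only [encodeOption, Data.branch_nil]
      refine ⟨_, _, iht fun l => h (.inr l), ?_⟩
      simp only [add_mul, one_mul]
      cases h2 : findLeaf t fun l => v (.inr l) with
      | some l =>
        simp only [encodeOption, Data.branch_pair, Data.tail_pair, Leaf.encode, true_and,
          Option.map_some]
        omega
      | none =>
        simp only [encodeOption, Data.branch_nil, true_and, Option.map_none]
        omega

end LowLevel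

end OrderedFormulas

namespace OrderedFormulas

/-! ### Verification of the automaton step and of the elimination -/

section Vectors

variable {F : Type*} [Field F] {len : F → ℕ} {k : ℕ} {a : Fin k → F}

theorem returns_step {n N E : ℕ} (hN : ∀ c, IsSmall a E c → len c ≤ N) (hn : n ≤ N) (x : ℕ)
    (G : NCFormula F ℕ)
    (hG : G.AllLeaves (fun i => (Data.ofNat i : Data F).size len ≤ n) (IsSmall a 1)) {e : ℕ}
    {v : Leaf G.shape → F} {c : F} (hv : ∀ l, IsSmall a e (v l)) (hc : IsSmall a e c)
    (he : e + G.size ≤ E) :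
    Returns len program 3
      (.pair (.ofNat x) (.pair G.encode (.pair (fill G.shape v) (.elt c))))
      (.pair (fill G.shape (G.step x v c).1) (.elt (G.step x v c).2)) (G.size * (50 * N + 200)) := by
  have hlen : ∀ c, IsSmall a 1 c → len c ≤ N := fun c h => hN c (h.mono (by
    have : 1 ≤ G.size := by cases G <;> simp [NCFormula.size]
    omega))
  induction G generalizing e c with
  | var y =>
    apply Returns.of_wp rfl
    simp only [Expr.stepBody, Expr.formulaCases, NCFormula.encode, Data.ofNat_zero,
      Expr.wp, List.getD_cons_zero, Data.head_pair, Data.tail_pair, Data.branch_nil]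
    refine ⟨_, _, returns_eq _ _ (Data.ofNat_pure y) (Data.ofNat_pure x), ?_⟩
    have hy : (Data.ofNat y : Data F).size len ≤ n := hG
    have h0 : len 0 ≤ N := hlen 0 (isSmall_zero _)
    rw [Data.branch_ofBool]
    simp only [decide_eq_true_eq, decide_eq_false_iff_not, Data.ofNat_injective.eq_iff,
      NCFormula.size, NCFormula.shape, NCFormula.step, fill]
    constructor
    · intro h
      rw [if_pos h.symm]
      exact ⟨rfl, by omega⟩
    · intro h
      rw [if_neg (Ne.symm h)]
      exact ⟨rfl, by omega⟩
  | const b =>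
    have h1 := hlen b hG
    have h2 := hN c (hc.mono (by omega))
    have h3 := hN (c * b) ((hc.mul hG).mono he)
    apply Returns.of_wp rfl
    simp only [Expr.stepBody, Expr.formulaCases, NCFormula.encode, Data.ofNat_one,
      Expr.wp, List.getD_cons_zero, Data.head_pair, Data.tail_pair, Data.branch_nil,
      Data.branch_pair, Data.arith_mul, Data.eltSize_elt, NCFormula.size, NCFormula.shape,
      NCFormula.step, fill, true_and]
    omega
  | unary op f ih =>
    apply Returns.of_wp rfl
    simp only [Expr.stepBody, Expr.formulaCases, NCFormula.encode, Data.ofNat_two,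
      Expr.wp, List.getD_cons_zero, Data.head_pair, Data.tail_pair, Data.branch_nil,
      Data.branch_pair]
    have hs : f.size + 1 = (NCFormula.unary op f).size := rfl
    refine ⟨_, _, ih hG hv hc (by omega), rfl, ?_⟩
    simp only [NCFormula.size, add_mul, one_mul]
    omega
  | binary op f g ihf ihg =>
    have hs : f.size + g.size + 1 = (NCFormula.binary op f g).size := rfl
    have hf := f.step_isSmall (hG.1.mono (fun _ _ => trivial) fun _ h => h) x
      (fun l => hv (.inl l)) hc
    have rf := ihf hG.1 (fun l => hv (.inl l)) hc (by omega)
    apply Returns.of_wp rfl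
    cases op with
    | plus =>
      have hg := g.step_isSmall (hG.2.mono (fun _ _ => trivial) fun _ h => h) x
        (fun l => hv (.inr l)) hc
      have rg := ihg hG.2 (fun l => hv (.inr l)) hc (by omega)
      simp only [Expr.stepBody, Expr.formulaCases, NCFormula.encode, Data.ofNat_three,
        Expr.wp, List.getD_cons_zero, List.getD_cons_succ, Data.head_pair, Data.tail_pair,
        Data.branch_nil, Data.branch_pair, GateOp.encode, Data.ofNat_zero, NCFormula.shape, fill]
      refine ⟨_, _, rf, ?_⟩
      simp only [Data.head_pair, Data.tail_pair]
      refine ⟨_, _, rg, ?_⟩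
      simp only [Data.head_pair, Data.tail_pair, Data.arith_add, Data.eltSize_elt]
      refine ⟨rfl, ?_⟩
      have h1 := hN _ (hf.2.mono (by omega))
      have h2 := hN _ (hg.2.mono (by omega))
      have h3 := hN _ (((hf.2.mono (by omega : _ ≤ e + f.size + g.size)).add
          (hg.2.mono (by omega))).mono (by omega))
      simp only [NCFormula.size, add_mul, one_mul]
      omega
    | times =>
      have rg := ihg hG.2 (fun l => (hv (.inr l)).mono (Nat.le_add_right e f.size)) hf.2
        (by omega)
      simp only [Expr.stepBody, Expr.formulaCases, NCFormula.encode, Data.ofNat_three,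
        Expr.wp, List.getD_cons_zero, List.getD_cons_succ, Data.head_pair, Data.tail_pair,
        Data.branch_pair, GateOp.encode, Data.ofNat_one, NCFormula.shape, fill]
      refine ⟨_, _, rf, ?_⟩
      simp only [Data.head_pair, Data.tail_pair]
      refine ⟨_, _, rg, ?_⟩
      simp only [Data.head_pair, Data.tail_pair]
      refine ⟨rfl, ?_⟩
      simp only [NCFormula.size, add_mul, one_mul]
      omega

/-- The cost of an elimination step with one row. -/
def rowCost (N : ℕ) : ℕ := N * (20 * N + 150) + 10 * N + 200

variable {s : Shape}

theorem comb_entry_cost_le {N : ℕ} (hs : s.size ≤ N) :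
    s.size * (20 * N + 100) + 50 * s.size + 10 * N + 200 ≤ rowCost N := by
  have h := Nat.mul_le_mul_right (20 * N + 150) hs
  have h1 : s.size * (20 * N + 150) = s.size * (20 * N + 100) + 50 * s.size := by ring
  unfold rowCost
  omega

/-- Each row subtracts a product of size at most `e + redBound m e`, independently of the
accumulator, so the bound grows by 1 per row. -/
theorem reduceBy_isSmall {m e g : ℕ} {v acc : Leaf s → F} {rows : List (Row F s)}
    (hrows : ∀ r ∈ rows, ∀ l, IsSmall a (redBound m e) (r.red l)) (hv : ∀ l, IsSmall a e (v l))
    (hacc : ∀ l, IsSmall a g (acc l)) (hg : e + redBound m e ≤ g) (l : Leaf s) :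
    IsSmall a (g + rows.length) (reduceBy v rows acc l) := by
  induction rows generalizing g acc with
  | nil => exact hacc l
  | cons r rows ih =>
    have h := ih (g := g + 1) (acc := fun l => (1 * acc l - v r.piv * r.red l) / 1)
      (fun r hr => hrows r (List.mem_cons_of_mem _ hr)) (fun l => ?_) (by omega)
    · exact h.mono (by simp only [List.length_cons]; omega)
    · rw [div_one, one_mul]
      exact (hacc l).sub (((hv _).mul (hrows r List.mem_cons_self l)).mono hg)

theorem returns_reduce {m e g N E : ℕ} (hN : ∀ c, IsSmall a E c → len c ≤ N) (hs : s.size ≤ N)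
    {v acc : Leaf s → F} {rows : List (Row F s)}
    (hrows : ∀ r ∈ rows, ∀ l, IsSmall a (redBound m e) (r.red l)) (hv : ∀ l, IsSmall a e (v l))
    (hacc : ∀ l, IsSmall a g (acc l)) (hg : e + redBound m e ≤ g) (hE : g + rows.length + 1 ≤ E) :
    Returns len program 8 (.pair (fill s v) (.pair (encodeRows rows) (fill s acc)))
      (fill s (reduceBy v rows acc)) (rows.length * rowCost N + 20) := by
  induction rows generalizing g acc with
  | nil =>
    apply Returns.of_wp rfl
    simp only [Expr.reduceBody, Expr.wp, encodeRows, List.map_nil, Data.ofList, reduceBy,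
      List.foldl_nil, List.getD_cons_zero, Data.head_pair, Data.tail_pair, Data.branch_nil,
      true_and]
    omega
  | cons r rows ih =>
    rw [List.length_cons] at hE
    have hr := hrows r List.mem_cons_self
    have hacc' : ∀ l, IsSmall a (g + 1) ((1 * acc l - v r.piv * r.red l) / 1) := fun l => by
      rw [div_one, one_mul]
      exact (hacc l).sub (((hv _).mul (hr l)).mono hg)
    have h := ih (g := g + 1) (acc := fun l => (1 * acc l - v r.piv * r.red l) / 1)
      (fun r hr => hrows r (List.mem_cons_of_mem _ hr)) hacc' (by omega) (by omega)
    have hcomb : ∀ l, CombBounded len N 1 (acc l) (v r.piv) (r.red l) 1 := fun l =>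
      { left := hN _ (isSmall_one _)
        fst := hN _ ((hacc l).mono (by omega))
        right := hN _ ((hv _).mono (by omega))
        snd := hN _ ((hr l).mono (by omega))
        den := hN _ (isSmall_one _)
        mul_left := hN _ (by rw [one_mul]; exact (hacc l).mono (by omega))
        mul_right := hN _ (((hv _).mul (hr l)).mono (by omega))
        sub := hN _ (by have := hacc' l; rw [div_one] at this; exact this.mono (by omega))
        quot := hN _ ((hacc' l).mono (by omega)) }
    have h1 : len 1 ≤ N := hN _ (isSmall_one _)
    have hc := comb_entry_cost_le hs
    apply Returns.of_wp rfl
    simp only [Expr.reduceBody, Expr.wp, encodeRows, List.map_cons, Data.ofList, Row.encode,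
      List.getD_cons_zero, Data.head_pair, Data.tail_pair, Data.branch_pair]
    refine ⟨_, _, returns_entry r.piv v, _, _, returns_comb hcomb, _, _, h, rfl, ?_⟩
    simp only [List.length_cons, add_mul, one_mul]
    omega

theorem returns_update {N : ℕ} (hs : s.size ≤ N) {j : Leaf s} {w : Leaf s → F} {d : F}
    {rows : List (Row F s)}
    (h : ∀ r ∈ rows, ∀ l, CombBounded len N (w j) (r.red l) (r.red j) (w l) d) :
    Returns len program 9
      (.pair j.encode (.pair (fill s w) (.pair (.elt (w j)) (.pair (.elt d) (encodeRows rows)))))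
      (encodeRows (rows.map (updateRow j w d))) (rows.length * rowCost N + 20) := by
  induction rows with
  | nil =>
    apply Returns.of_wp rfl
    simp only [Expr.updateBody, Expr.wp, encodeRows, List.map_nil, Data.ofList,
      List.getD_cons_zero, Data.tail_pair, Data.branch_nil,
      true_and]
    omega
  | cons r rows ih =>
    have hc := comb_entry_cost_le hs
    apply Returns.of_wp rfl
    simp only [Expr.updateBody, Expr.wp, encodeRows, List.map_cons, Data.ofList, Row.encode,
      List.getD_cons_zero, List.getD_cons_succ, Data.head_pair, Data.tail_pair, Data.branch_pair]
    refine ⟨_, _, returns_entry j r.red, _, _, returns_comb (h r List.mem_cons_self), _, _,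
      ih fun r hr => h r (List.mem_cons_of_mem _ hr), rfl, ?_⟩
    simp only [List.length_cons, add_mul, one_mul]
    omega

def insertCost (N : ℕ) : ℕ := 2 * (N * rowCost N) + 2 * rowCost N + N * (3 * N + 50) + 10 * N + 200

/-- The cost is uniform in the history of the elimination: the entries before and after the
insertion are bounded through the original vectors (`hs1`, `hs2`), and `elimBound` covers what
occurs in between. -/
theorem returns_insertRow {m e N E : ℕ} (hN : ∀ c, IsSmall a E c → len c ≤ N) (hs : s.size ≤ N)
    (hm : m ≤ N) (hsm : s.numLeaves ≤ m) (hE : elimBound m e ≤ E) {v : Leaf s → F}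
    {S : F × List (Row F s)} (hR : RowsReduced S.1 S.2)
    (hS : ∀ r ∈ S.2, ∀ l, IsSmall a e (r.orig l)) (hv : ∀ l, IsSmall a e (v l)) :
    Returns len program 10 (.pair (fill s v) (encodeBasis S)) (encodeBasis (insertRow v S))
      (insertCost N) := by
  have hs1 := hR.small (a := a) hsm hS
  have hs2 := (hR.insertRow v).small (a := a) hsm
    (insertRow_orig (P := fun v => ∀ l, IsSmall a e (v l)) hS hv)
  have hl := hs1.length
  have hrb : minorBound m e + e + m = redBound m e := rfl
  have heb : 2 * redBound m e + e + m + 3 = elimBound m e := rfl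
  have h0 : len 0 ≤ N := hN _ (isSmall_zero _)
  have h1 : len 1 ≤ N := hN _ (isSmall_one _)
  have hstart : ∀ l, IsSmall a (redBound m e + 1) (S.1 * v l - 0 * v l) := fun l =>
    IsSmall.sub ((hs1.det.mul (hv l)).mono (by omega)) (by rw [zero_mul]; exact isSmall_zero _)
  have hcomb : ∀ l, CombBounded len N S.1 (v l) 0 (v l) 1 := fun l =>
    { left := hN _ (hs1.det.mono (by omega))
      fst := hN _ ((hv l).mono (by omega))
      right := h0
      snd := hN _ ((hv l).mono (by omega))
      den := h1
      mul_left := hN _ ((hs1.det.mul (hv l)).mono (by omega))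
      mul_right := hN _ (by rw [zero_mul]; exact isSmall_zero _)
      sub := hN _ ((hstart l).mono (by omega))
      quot := hN _ (by rw [div_one]; exact (hstart l).mono (by omega)) }
  have hacc : ∀ l, IsSmall a (e + redBound m e + 1) ((S.1 * v l - 0 * v l) / 1) := fun l => by
    rw [div_one]
    exact (hstart l).mono (by omega)
  have hw : ∀ l, IsSmall a (e + redBound m e + 1 + m) (remainderOf v S l) := fun l =>
    (reduceBy_isSmall hs1.red hv hacc (by omega) l).mono (by omega)
  have hred := returns_reduce hN hs hs1.red hv hacc (by omega) (by omega)
  have hfind := returns_findLeaf (v := remainderOf v S) fun l => hN _ ((hw l).mono (by omega))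
  have c1 := comb_entry_cost_le hs
  have c2 : s.size * (3 * N + 50) ≤ N * (3 * N + 50) := Nat.mul_le_mul_right _ hs
  have c3 : S.2.length * rowCost N ≤ N * rowCost N := Nat.mul_le_mul_right _ (hl.trans hm)
  apply Returns.of_wp rfl
  simp only [Expr.insertBody, Expr.wp, encodeBasis, List.getD_cons_zero, List.getD_cons_succ,
    Data.head_pair, Data.tail_pair]
  refine ⟨_, _, returns_comb hcomb, _, _, hred, _, _, hfind, ?_⟩
  rw [insertRow] at hs2 ⊢
  cases hj : findLeaf s (remainderOf v S) with
  | none =>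
    simp only [encodeOption, Data.branch_nil, true_and, insertCost]
    omega
  | some j =>
    rw [hj] at hs2
    have hupd : ∀ r ∈ S.2, ∀ l,
        CombBounded len N (remainderOf v S j) (r.red l) (r.red j) (remainderOf v S l) S.1 :=
      fun r hr l =>
      -- The largest intermediate values are products of an entry of the remainder, of size
      -- `redBound m e + e + m + 1`, with an entry of a reduced row, of size `redBound m e`, and
      -- their differences.
      { left := hN _ ((hw j).mono (by omega))
        fst := hN _ ((hs1.red r hr l).mono (by omega))
        right := hN _ ((hs1.red r hr j).mono (by omega))
        snd := hN _ ((hw l).mono (by omega))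
        den := hN _ (hs1.det.mono (by omega))
        mul_left := hN _ (((hw j).mul (hs1.red r hr l)).mono (by omega))
        mul_right := hN _ (((hs1.red r hr j).mul (hw l)).mono (by omega))
        sub := hN _ ((IsSmall.sub (((hw j).mul (hs1.red r hr l)).mono
          (by omega : _ ≤ 2 * redBound m e + e + m + 1))
          (((hs1.red r hr j).mul (hw l)).mono (by omega))).mono (by omega))
        -- A quotient has no evident bound as such; it is small because it is an entry of a reduced
        -- row of the new basis, hence a combination with cofactors as coefficients.
        quot := hN _ ((hs2.red _ (List.mem_cons_of_mem _ (List.mem_map_of_mem hr)) l).mono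
          (by omega)) }
    simp only [encodeOption, Data.branch_pair, Data.tail_pair]
    refine ⟨_, _, returns_entry j _, _, _, returns_update hs hupd, ?_, ?_⟩
    · simp only [encodeRows, List.map_cons, Data.ofList, Row.encode]
      rfl
    · simp only [insertCost]
      omega

end Vectors

end OrderedFormulas

/-! ### Verification of the zero test -/

namespace OrderedFormulas

/-- The number of inner nodes. -/
def Data.numPairs {F : Type*} : Data F → ℕ
  | .pair u v => u.numPairs + v.numPairs + 1
  | _ => 0

theorem Data.numPairs_le_size {F : Type*} (len : F → ℕ) (u : Data F) : u.numPairs ≤ u.size len := by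
  induction u with
  | nil => exact Nat.zero_le _
  | elt a => exact Nat.zero_le _
  | pair u v ihu ihv => simp only [numPairs, size]; omega

namespace NCFormula

variable {F : Type*}

/-- The code of the formula is the clock of the closure: it has at least as many inner nodes as the
degree requires rounds, and by `numPairs_encode_le` only polynomially many. -/
theorem size_le_numPairs_encode (G : NCFormula F ℕ) : G.size ≤ G.encode.numPairs := by
  induction G with
  | var x => simp only [encode, Data.numPairs, size]; omega
  | const a => simp only [encode, Data.numPairs, size]; omega
  | unary op f ih => simp only [encode, Data.numPairs, size]; omega
  | binary op f g ihf ihg => simp only [encode, Data.numPairs, size]; omega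

theorem numPairs_encode_le {len : F → ℕ} {n : ℕ} {pc : F → Prop} (G : NCFormula F ℕ)
    (hG : G.AllLeaves (fun i => (Data.ofNat i : Data F).size len ≤ n) pc) :
    G.encode.numPairs ≤ G.size * (n + 20) := by
  induction G with
  | var x =>
    have h := (Data.ofNat x : Data F).numPairs_le_size len
    have hx : (Data.ofNat x : Data F).size len ≤ n := hG
    simp only [encode, Data.numPairs, size, Data.ofNat_zero]
    omega
  | const a =>
    simp only [encode, Data.numPairs, size, Data.ofNat_one]
    omega
  | unary op f ih =>
    have := ih hG
    cases op <;>
    · simp only [encode, GateOp.encode, Data.numPairs, size, Data.ofNat_zero, Data.ofNat_one,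
        Data.ofNat_two, add_mul, one_mul]
      omega
  | binary op f g ihf ihg =>
    have := ihf hG.1
    have := ihg hG.2
    cases op <;>
    · simp only [encode, GateOp.encode, Data.numPairs, size, Data.ofNat_zero, Data.ofNat_one,
        Data.ofNat_three, add_mul, one_mul]
      omega

theorem size_encode_le {len : F → ℕ} {n N : ℕ} (G : NCFormula F ℕ)
    (hG : G.AllLeaves (fun i => (Data.ofNat i : Data F).size len ≤ n) fun c => len c ≤ N) :
    G.encode.size len ≤ G.size * (n + N + 20) := by
  induction G with
  | var x =>
    have hx : (Data.ofNat x : Data F).size len ≤ n := hG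
    simp only [encode, Data.size, size, Data.ofNat_zero]
    omega
  | const a =>
    have ha : len a ≤ N := hG
    simp only [encode, Data.size, size, Data.ofNat_one]
    omega
  | unary op f ih =>
    have := ih hG
    cases op <;>
    · simp only [encode, GateOp.encode, Data.size, size, Data.ofNat_zero, Data.ofNat_one,
        Data.ofNat_two, add_mul, one_mul]
      omega
  | binary op f g ihf ihg =>
    have := ihf hG.1
    have := ihg hG.2
    cases op <;>
    · simp only [encode, GateOp.encode, Data.size, size, Data.ofNat_zero, Data.ofNat_one,
        Data.ofNat_three, add_mul, one_mul]
      omega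

end NCFormula

section ZeroTest

variable {F : Type*} [Field F] {k : ℕ}

/-- The parameters of the algorithm: `L` is the list of variables, whose codes have size at most
`n`; formulas have size less than `m`; the automata have states of size `e`, and all field elements
that are computed have size `E` as values of polynomials, and size `N` in the representation. -/
structure Parameters (len : F → ℕ) (a : Fin k → F) (L : List ℕ) (n m e E N : ℕ) : Prop where
  len_le : ∀ c, IsSmall a E c → len c ≤ N
  mem_le : ∀ x ∈ L, (Data.ofNat x : Data F).size len ≤ n
  length_le : L.length ≤ N
  le_n : n ≤ N
  le_m : m + 2 ≤ N
  le_e : m * (n + 20) * m ≤ e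
  le_E : elimBound m e + m ≤ E

/-- The formulas for which the parameters are made. -/
structure Fits (a : Fin k → F) (L : List ℕ) (m : ℕ) (G : NCFormula F ℕ) : Prop where
  size_lt : G.size + 1 ≤ m
  leaves : G.AllLeaves (· ∈ L) (IsSmall a 1)

variable {len : F → ℕ} {a : Fin k → F} {L : List ℕ} {n m e E N : ℕ}

theorem Parameters.leaves (h : Parameters len a L n m e E N) {G : NCFormula F ℕ}
    (hG : Fits a L m G) :
    G.AllLeaves (fun i => (Data.ofNat i : Data F).size len ≤ n) (IsSmall a 1) :=
  hG.leaves.mono h.mem_le fun _ h => h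

theorem Parameters.len_zero_le (h : Parameters len a L n m e E N) : len 0 ≤ N :=
  h.len_le _ (isSmall_zero _)

theorem Parameters.len_one_le (h : Parameters len a L n m e E N) : len 1 ≤ N :=
  h.len_le _ (isSmall_one _)

theorem Parameters.le_E' (h : Parameters len a L n m e E N) : e + m + 1 ≤ E := by
  have := h.le_E
  unfold elimBound at this
  omega

def VectorSmall {s : Shape} (a : Fin k → F) (e : ℕ) (v : Leaf s → F) : Prop :=
  ∀ l, IsSmall a e (v l)

theorem returns_insertRow_state (h : Parameters len a L n m e E N) {G : NCFormula F ℕ}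
    (hG : Fits a L m G) {S : G.Basis} (hS : G.BasisInv (VectorSmall a e) S) {v : G.State}
    (hv : VectorSmall a e v) :
    Returns len program 10 (.pair (fill _ v) (encodeBasis S)) (encodeBasis (insertRow v S))
      (insertCost N) := by
  have h1 := G.size_shape_le
  have h2 := G.shape.numLeaves_le_size
  have h3 := hG.size_lt
  have h4 := h.le_m
  have h5 := h.le_E
  refine returns_insertRow (a := a) (m := m) (e := e) h.len_le ?_ ?_ ?_ ?_ hS.reduced hS.orig hv
  · simp only [Shape.size]; omega
  · omega
  · simp only [Shape.numLeaves]; omega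
  · omega

def nextCost (N : ℕ) : ℕ := N * (50 * N + 200) + insertCost N + 2 * N + 100

theorem step_cost_le (h : Parameters len a L n m e E N) {G : NCFormula F ℕ} (hG : Fits a L m G) :
    G.size * (50 * N + 200) ≤ N * (50 * N + 200) := by
  have h3 := hG.size_lt
  have h4 := h.le_m
  exact Nat.mul_le_mul_right _ (by omega)

theorem returns_insertNext (h : Parameters len a L n m e E N) {G : NCFormula F ℕ}
    (hG : Fits a L m G) {X : List ℕ} {S : G.Basis} (hS : G.BasisInv (VectorSmall a e) S)
    {v : G.State} (hv : VectorSmall a e v) (hX : ∀ x ∈ X, VectorSmall a e (G.next x v)) :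
    Returns len program 11
      (.pair G.encode (.pair (fill _ v) (.pair (encodeVars X) (encodeBasis S))))
      (encodeBasis (G.insertNext v X S)) (X.length * nextCost N + 20) := by
  induction X generalizing S with
  | nil =>
    apply Returns.of_wp rfl
    simp only [Expr.insertNextBody, Expr.wp, encodeVars, List.map_nil, Data.ofList,
      List.getD_cons_zero, Data.head_pair, Data.tail_pair, Data.branch_nil,
      NCFormula.insertNext, List.foldl_nil, true_and]
    omega
  | cons x X ih =>
    have hx := hX x List.mem_cons_self
    have hstep := returns_step h.len_le h.le_n x G (h.leaves hG) (e := e)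
      (v := fun l => v (.inr l)) (c := v (.inl .here)) (fun l => hv _) (hv _)
      (by have := hG.size_lt; have := h.le_E'; omega)
    have hins := returns_insertRow_state h hG hS hx
    have hrec := ih (hS.insertRow hx) fun y hy => hX y (List.mem_cons_of_mem _ hy)
    have hfill : fill _ (G.next x v) = .pair (.elt 0)
      (fill G.shape (G.step x (fun l => v (.inr l)) (v (.inl .here))).1) := rfl
    rw [hfill] at hins
    have c1 := step_cost_le h hG
    have c2 := h.len_zero_le
    apply Returns.of_wp rfl
    rw [fill, fill] at hrec ⊢
    simp only [Expr.insertNextBody, Expr.wp, encodeVars, List.map_cons, Data.ofList,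
      List.getD_cons_zero, Data.head_pair, Data.tail_pair, Data.branch_pair]
    refine ⟨_, _, hstep, _, _, hins, _, _, hrec, rfl, ?_⟩
    simp only [List.length_cons, add_mul, one_mul, nextCost]
    simp only [nextCost] at *
    omega

def roundCost (N : ℕ) : ℕ := N * nextCost N + 100

theorem returns_insertAll (h : Parameters len a L n m e E N) {G : NCFormula F ℕ}
    (hG : Fits a L m G) {rows : List (Row F (.node .leaf G.shape))} {S : G.Basis}
    (hS : G.BasisInv (VectorSmall a e) S) (hv : ∀ r ∈ rows, VectorSmall a e r.orig)
    (hX : ∀ r ∈ rows, ∀ x ∈ L, VectorSmall a e (G.next x r.orig)) :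
    Returns len program 12
      (.pair G.encode (.pair (encodeVars L) (.pair (encodeRows rows) (encodeBasis S))))
      (encodeBasis (G.insertAll L rows S)) (rows.length * roundCost N + 20) := by
  induction rows generalizing S with
  | nil =>
    apply Returns.of_wp rfl
    simp only [Expr.insertAllBody, Expr.wp, encodeRows, List.map_nil, Data.ofList,
      List.getD_cons_zero, Data.head_pair, Data.tail_pair, Data.branch_nil,
      NCFormula.insertAll, List.foldl_nil, true_and]
    omega
  | cons r rows ih =>
    have hr := hv r List.mem_cons_self
    have hx := hX r List.mem_cons_self
    have hnext := returns_insertNext h hG hS hr hx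
    have hrec := ih (hS.insertNext hx) (fun y hy => hv y (List.mem_cons_of_mem _ hy))
      fun y hy => hX y (List.mem_cons_of_mem _ hy)
    have c1 := Nat.mul_le_mul_right (nextCost N) h.length_le
    apply Returns.of_wp rfl
    simp only [Expr.insertAllBody, Expr.wp, encodeRows, List.map_cons, Data.ofList,
      List.getD_cons_zero, Data.head_pair, Data.tail_pair, Data.branch_pair, Row.encode]
    refine ⟨_, _, hnext, _, _, hrec, rfl, ?_⟩
    simp only [List.length_cons, add_mul, one_mul, roundCost]
    simp only [roundCost] at *
    omega

def closureCost (N : ℕ) : ℕ := N * roundCost N + 200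

theorem reachedIn_small {G : NCFormula F ℕ} (hG : Fits a L m G) {j : ℕ} (hj : j * m ≤ e)
    {v : G.State} (hv : G.ReachedIn j v) : VectorSmall a e v := by
  obtain ⟨w, hw, rfl⟩ := hv
  exact fun l => (G.reach_isSmall (hG.leaves.mono (fun _ _ => trivial) fun _ h => h) w l).mono
    ((Nat.mul_le_mul hw (by have := hG.size_lt; omega)).trans hj)

/-- The index `j` counts the rounds already made. The condition on `j + T.numPairs` keeps all states
that will be reached within the size `e` for which the elimination is bounded. -/
theorem returns_closure (h : Parameters len a L n m e E N) {G : NCFormula F ℕ}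
    (hG : Fits a L m G) {j : ℕ} {S : G.Basis} (hS : G.BasisInv (G.ReachedIn j) S) (T : Data F)
    (hj : (j + T.numPairs) * m ≤ e) :
    Returns len program 13
      (.pair T (.pair G.encode (.pair (encodeVars L) (encodeBasis S))))
      (encodeBasis (G.closure L T.numPairs S)) (T.size len * closureCost N) := by
  induction T generalizing j S with
  | nil =>
    apply Returns.of_wp rfl
    simp only [Expr.closureBody, Expr.wp, Data.numPairs, List.getD_cons_zero, Data.head_pair,
      Data.tail_pair, Data.branch_false, Data.test_isPair_nil, Data.eltSize_nil,
      NCFormula.closure, Function.iterate_zero, id, true_and, Data.size, closureCost]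
    omega
  | elt c =>
    -- The clock may contain field elements; testing one for being a pair costs its length, which is
    -- part of `T.size`.
    have c1 := Nat.le_mul_of_pos_right (len c) (show 0 < closureCost N by unfold closureCost; omega)
    apply Returns.of_wp rfl
    simp only [Expr.closureBody, Expr.wp, Data.numPairs, List.getD_cons_zero, Data.head_pair,
      Data.tail_pair, Data.branch_false, Data.test_isPair_elt, Data.eltSize_elt,
      NCFormula.closure, Function.iterate_zero, id, true_and, Data.size, add_mul, one_mul]
    have c2 : 200 ≤ closureCost N := Nat.le_add_left _ _
    omega
  | pair u v ihu ihv =>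
    have hn : (Data.pair u v).numPairs = u.numPairs + v.numPairs + 1 := rfl
    have hj1 : (j + 1) * m ≤ e := (Nat.mul_le_mul_right m (by omega)).trans hj
    have hj0 : j * m ≤ e := (Nat.mul_le_mul_right m (by omega)).trans hj
    have hall := returns_insertAll h hG (hS.mono fun v hv => reachedIn_small hG hj0 hv)
      (rows := S.2) (fun r hr => reachedIn_small hG hj0 (hS.orig r hr))
      fun r hr x _ => reachedIn_small hG hj1 ((hS.orig r hr).next x)
    have hS1 : G.BasisInv (G.ReachedIn (j + 1)) (G.insertAll L S.2 S) := G.closure_inv L hS 1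
    have hu := ihu hS1 ((Nat.mul_le_mul_right m (by omega)).trans hj)
    have hS2 := G.closure_inv L hS1 u.numPairs
    have hv := ihv hS2 ((Nat.mul_le_mul_right m (by omega)).trans hj)
    have c1 : S.2.length * roundCost N ≤ N * roundCost N := by
      apply Nat.mul_le_mul_right
      have h1 := hS.reduced.length_le
      have h2 := G.size_shape_le
      have h3 := G.shape.numLeaves_le_size
      have h4 := hG.size_lt
      have h5 := h.le_m
      simp only [Shape.numLeaves] at h1
      omega
    -- One round for the node itself, then the rounds of `u`, then those of `v`.
    have hcl : G.closure L (Data.pair u v).numPairs S =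
        G.closure L v.numPairs (G.closure L u.numPairs (G.insertAll L S.2 S)) := by
      rw [hn, add_comm u.numPairs]
      simp only [NCFormula.closure]
      rw [Function.iterate_add_apply, Function.iterate_add_apply]
      rfl
    rw [hcl]
    apply Returns.of_wp rfl
    simp only [Expr.closureBody, Expr.wp, List.getD_cons_zero, Data.head_pair,
      Data.tail_pair, Data.branch_true, Data.test_isPair_pair, Data.eltSize_pair, encodeBasis]
    refine ⟨_, _, hall, _, _, hu, _, _, hv, rfl, ?_⟩
    simp only [Data.size, add_mul, one_mul]
    have c2 : N * roundCost N + 200 = closureCost N := rfl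
    omega

def outputsCost (N : ℕ) : ℕ := N * (50 * N + 200) + N + 100

open Classical in
theorem returns_outputsZero (h : Parameters len a L n m e E N) {G : NCFormula F ℕ}
    (hG : Fits a L m G) {rows : List (Row F (.node .leaf G.shape))}
    (hv : ∀ r ∈ rows, VectorSmall a e r.orig) :
    Returns len program 14 (.pair G.encode (encodeRows rows))
      (.ofBool (decide (∀ r ∈ rows, G.output r.orig = 0))) (rows.length * outputsCost N + 20) := by
  induction rows with
  | nil =>
    apply Returns.of_wp rfl
    simp only [Expr.outputsZeroBody, Expr.tt, Expr.wp, encodeRows, List.map_nil, Data.ofList,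
      List.getD_cons_zero, Data.tail_pair, Data.branch_nil]
    refine ⟨by simp [Data.ofBool], by omega⟩
  | cons r rows ih =>
    have hr := hv r List.mem_cons_self
    have hE : e + G.size ≤ E := by
      have := hG.size_lt
      have := h.le_E'
      omega
    have hstep := returns_step h.len_le h.le_n 0 G (h.leaves hG) (e := e)
      (v := fun l => r.orig (.inr l)) (c := r.orig (.inl .here)) (fun l => hr _) (hr _) hE
    have hlen := h.len_le _ ((G.step_isSmall (hG.leaves.mono (fun _ _ => trivial) fun _ h => h) 0
      (v := fun l => r.orig (.inr l)) (c := r.orig (.inl .here)) (fun l => hr _) (hr _)).2.mono hE)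
    have hrec := ih fun y hy => hv y (List.mem_cons_of_mem _ hy)
    have c1 := step_cost_le h hG
    have c2 : outputsCost N = N * (50 * N + 200) + N + 100 := rfl
    have hout : (G.step 0 (fun l => r.orig (.inr l)) (r.orig (.inl .here))).2 = G.output r.orig :=
      rfl
    rw [hout] at hstep hlen
    -- The program passes `nil` as the irrelevant letter, and `nil` is the code of 0.
    rw [Data.ofNat_zero] at hstep
    apply Returns.of_wp rfl
    simp only [Expr.outputsZeroBody, Expr.tt, Expr.wp, encodeRows, List.map_cons, Data.ofList,
      List.getD_cons_zero, Data.head_pair, Data.tail_pair, Data.branch_pair, Row.encode, fill]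
    refine ⟨_, _, hstep, ?_⟩
    simp only [Data.tail_pair, Data.test_isZero_elt, Data.eltSize_elt]
    by_cases h0 : G.output r.orig = 0
    · simp only [h0, decide_true, Data.branch_true]
      rw [h0] at hlen
      refine ⟨_, _, hrec, ?_, ?_⟩
      · simp [h0]
      · simp only [List.length_cons, add_mul, one_mul]
        omega
    · simp only [h0, decide_false, Data.branch_false]
      refine ⟨?_, ?_⟩
      · simp [h0, Data.ofBool]
      · simp only [List.length_cons, add_mul, one_mul]
        omega

def isZeroCost (N : ℕ) : ℕ :=
  N * (N + 50) + insertCost N + N * (2 * N + 20) * closureCost N + N * outputsCost N + 2 * N + 200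

open Classical in
theorem returns_isZero (h : Parameters len a L n m e E N) {G : NCFormula F ℕ}
    (hG : Fits a L m G) :
    Returns len program 15 (.pair G.encode (encodeVars L)) (.ofBool (decide (G.poly = 0)))
      (isZeroCost N) := by
  have hsz := hG.size_lt
  have hm := h.le_m
  -- There are at most `m * (n + 20)` rounds, and each letter raises the size of a state by at most
  -- `m`; this is the choice of `e` in `Parameters`.
  have hpairs : G.encode.numPairs * m ≤ e := by
    have h1 := G.numPairs_encode_le (h.leaves hG)
    have h2 : G.size * (n + 20) ≤ m * (n + 20) := Nat.mul_le_mul_right _ (by omega)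
    exact (Nat.mul_le_mul_right m (h1.trans h2)).trans h.le_e
  have hvec := returns_zeroVector (len := len) h.len_zero_le G
  have hinit : G.BasisInv (VectorSmall a e) (1, []) :=
    ⟨NCFormula.rowsReduced_nil, nofun⟩
  have hreach : VectorSmall a e (G.reach []) :=
    reachedIn_small hG (j := 0) (by omega) ⟨[], le_rfl, rfl⟩
  have hins := returns_insertRow_state h hG hinit hreach
  have hfill : fill _ (G.reach []) = .pair (.elt 1) (fill G.shape fun _ => 0) := rfl
  rw [hfill] at hins
  have hcl := returns_closure h hG G.initBasis_inv G.encode (by rwa [zero_add])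
  have hinv := G.closure_inv L G.initBasis_inv G.encode.numPairs
  have hout := returns_outputsZero h hG (rows := (G.closure L G.encode.numPairs G.initBasis).2)
    fun r hr => reachedIn_small hG (by rwa [zero_add]) (hinv.orig r hr)
  have hiff := G.poly_eq_zero_iff (fun x hx => hG.leaves.of_mem_vars hx)
    G.size_le_numPairs_encode
  have c1 : G.size * (N + 50) ≤ N * (N + 50) := Nat.mul_le_mul_right _ (by omega)
  have c2 : G.encode.size len * closureCost N ≤ N * (2 * N + 20) * closureCost N := by
    apply Nat.mul_le_mul_right
    have h1 := G.size_encode_le ((h.leaves hG).mono (fun _ h => h) fun c hc =>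
      h.len_le c (hc.mono (by have := h.le_E'; omega)))
    exact h1.trans (Nat.mul_le_mul (by omega) (by have := h.le_n; omega))
  have c3 : (G.closure L G.encode.numPairs G.initBasis).2.length * outputsCost N ≤
      N * outputsCost N := by
    apply Nat.mul_le_mul_right
    have h1 := hinv.reduced.length_le
    have h2 := G.size_shape_le
    have h3 := G.shape.numLeaves_le_size
    simp only [Shape.numLeaves] at h1
    omega
  have c4 := h.len_one_le
  apply Returns.of_wp rfl
  simp only [Expr.isZeroBody, Expr.wp, List.getD_cons_zero, Data.head_pair, Data.tail_pair]
  refine ⟨_, _, hvec, _, _, hins, _, _, hcl, ?_⟩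
  simp only [encodeBasis, Data.tail_pair]
  refine ⟨_, _, hout, ?_, ?_⟩
  · simp only [hiff]
  · simp only [isZeroCost]
    omega

end ZeroTest

end OrderedFormulas

namespace OrderedFormulas

/-! ### Verification of the occurrence tests and of the main function -/

section Main

variable {F : Type*} [Field F] {k : ℕ} {len : F → ℕ} {a : Fin k → F} {L : List ℕ}
  {n m e E N : ℕ}

/-- The formulas whose variables can be tested for occurrence. -/
structure FitsTwice (a : Fin k → F) (L : List ℕ) (m : ℕ) (G : NCFormula F ℕ) : Prop where
  size_le : 2 * G.size + 4 ≤ m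
  leaves : G.AllLeaves (· ∈ L) (IsSmall a 1)

/-- A formula computing the difference of `G` and `G(0/x)`. -/
def NCFormula.zeroVarDiff (G : NCFormula F ℕ) (x : ℕ) : NCFormula F ℕ :=
  .binary .plus G (.binary .times (.const (0 - 1)) (G.zeroVar x))

theorem NCFormula.zeroVarDiff_poly_eq_zero_iff (G : NCFormula F ℕ) (x : ℕ) :
    (G.zeroVarDiff x).poly = 0 ↔ ¬ OccursIn x G.poly := by
  rw [← poly_zeroVar_eq_iff, zeroVarDiff, poly, poly, poly]
  have h : (MonoidAlgebra.single 1 (0 - 1) : NCPoly F ℕ) = -1 := by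
    rw [zero_sub, MonoidAlgebra.single_neg, MonoidAlgebra.one_def]
  rw [h, neg_one_mul, ← sub_eq_add_neg, sub_eq_zero, eq_comm]

/-- The difference contains `G` twice and three more nodes; one further unit is the entrance of the
automaton. This is the origin of `2 * G.size + 4`. -/
theorem FitsTwice.zeroVarDiff {G : NCFormula F ℕ} (hG : FitsTwice a L m G) (x : ℕ) :
    Fits a L m (G.zeroVarDiff x) := by
  have h := hG.size_le
  refine ⟨?_, hG.leaves, ?_, hG.leaves.zeroVar (isSmall_zero _) x⟩
  · simp only [NCFormula.zeroVarDiff, NCFormula.size, NCFormula.size_zeroVar]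
    omega
  · change IsSmall a 1 (0 - 1)
    exact (isSmall_zero 0).sub (isSmall_one 0)

theorem FitsTwice.zeroVar {G : NCFormula F ℕ} (hG : FitsTwice a L m G) (x : ℕ) :
    FitsTwice a L m (G.zeroVar x) :=
  ⟨by rw [NCFormula.size_zeroVar]; exact hG.size_le, hG.leaves.zeroVar (isSmall_zero _) x⟩

theorem returns_zeroVar' (h : Parameters len a L n m e E N) {G : NCFormula F ℕ}
    (hG : FitsTwice a L m G) (x : ℕ) :
    Returns len program 2 (.pair (.ofNat x) G.encode) (G.zeroVar x).encode
      (N * (50 * N + 100)) := by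
  have h1 := hG.size_le
  have h2 := h.le_m
  exact (returns_zeroVar h.len_zero_le h.le_n x G
    (hG.leaves.mono h.mem_le fun _ _ => trivial)).mono (Nat.mul_le_mul_right _ (by omega))

def occursCost (N : ℕ) : ℕ := N * (50 * N + 100) + isZeroCost N + 10 * N + 200

open Classical in
theorem returns_notOccurs (h : Parameters len a L n m e E N) {G : NCFormula F ℕ}
    (hG : FitsTwice a L m G) (x : ℕ) :
    Returns len program 17 (.pair (.ofNat x) (.pair G.encode (encodeVars L)))
      (.ofBool (decide (¬ OccursIn x G.poly))) (occursCost N) := by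
  have hz := returns_isZero h (hG.zeroVarDiff x)
  -- The code of the difference is spelled out as the tree that the program assembles.
  rw [NCFormula.zeroVarDiff, NCFormula.encode, NCFormula.encode, NCFormula.encode,
    Data.ofNat_three, Data.ofNat_one, GateOp.encode, GateOp.encode, Data.ofNat_zero,
    Data.ofNat_one, ← NCFormula.zeroVarDiff] at hz
  have c1 := h.len_zero_le
  have c2 := h.len_one_le
  have c3 : len (0 - 1) ≤ N := h.len_le _
    (((isSmall_zero 0).sub (isSmall_one 0)).mono (by have := h.le_E'; omega))
  apply Returns.of_wp rfl
  simp only [Expr.notOccursBody, Expr.tt, Expr.wp, List.getD_cons_zero, Data.head_pair,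
    Data.tail_pair, Data.arith_sub, Data.eltSize_elt]
  refine ⟨_, _, returns_zeroVar' h hG x, _, _, hz, ?_, ?_⟩
  · simp only [G.zeroVarDiff_poly_eq_zero_iff]
  · simp only [occursCost]
    omega

def cleanCost (N : ℕ) : ℕ := occursCost N + N * (50 * N + 100) + 200

theorem returns_clean (h : Parameters len a L n m e E N) {X : List ℕ} {G : NCFormula F ℕ}
    (hG : FitsTwice a L m G) :
    Returns len program 16 (.pair (encodeVars X) (.pair G.encode (encodeVars L)))
      (NCFormula.clean X G).encode (X.length * cleanCost N + 20) := by
  induction X generalizing G with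
  | nil =>
    apply Returns.of_wp rfl
    simp only [Expr.cleanBody, Expr.wp, encodeVars, List.map_nil, Data.ofList,
      List.getD_cons_zero, Data.head_pair, Data.tail_pair, Data.branch_nil,
      NCFormula.clean, true_and]
    omega
  | cons x X ih =>
    have hc : cleanCost N = occursCost N + N * (50 * N + 100) + 200 := rfl
    apply Returns.of_wp rfl
    simp only [Expr.cleanBody, Expr.wp, encodeVars, List.map_cons, Data.ofList,
      List.getD_cons_zero, Data.head_pair, Data.tail_pair, Data.branch_pair]
    refine ⟨_, _, returns_notOccurs h hG x, ?_⟩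
    rw [NCFormula.clean]
    by_cases hx : OccursIn x G.poly
    · simp only [hx, not_true_eq_false, decide_false, Data.branch_false, if_true]
      refine ⟨_, _, ih hG, rfl, ?_⟩
      simp only [List.length_cons, add_mul, one_mul]
      omega
    · simp only [hx, not_false_eq_true, decide_true, Data.branch_true, if_false]
      refine ⟨_, _, returns_zeroVar' h hG x, _, _, ih (hG.zeroVar x), rfl, ?_⟩
      simp only [List.length_cons, add_mul, one_mul]
      omega

open Classical in
theorem returns_noneOccurs (h : Parameters len a L n m e E N) {X : List ℕ} {G : NCFormula F ℕ}
    (hG : FitsTwice a L m G) :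
    Returns len program 18 (.pair (encodeVars X) (.pair G.encode (encodeVars L)))
      (.ofBool (decide (∀ x ∈ X, ¬ OccursIn x G.poly))) (X.length * cleanCost N + 20) := by
  induction X with
  | nil =>
    apply Returns.of_wp rfl
    simp only [Expr.noneOccursBody, Expr.tt, Expr.wp, encodeVars, List.map_nil, Data.ofList,
      List.getD_cons_zero, Data.head_pair, Data.branch_nil]
    exact ⟨by simp [Data.ofBool], by omega⟩
  | cons x X ih =>
    have hc : cleanCost N = occursCost N + N * (50 * N + 100) + 200 := rfl
    apply Returns.of_wp rfl
    simp only [Expr.noneOccursBody, Expr.tt, Expr.wp, encodeVars, List.map_cons, Data.ofList,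
      List.getD_cons_zero, Data.head_pair, Data.tail_pair, Data.branch_pair]
    refine ⟨_, _, returns_notOccurs h hG x, ?_⟩
    simp only [List.length_cons, add_mul, one_mul]
    by_cases hx : OccursIn x G.poly
    · simp only [hx, not_true_eq_false, decide_false, Data.branch_false]
      exact ⟨by simp [hx, Data.ofBool], by omega⟩
    · simp only [hx, not_false_eq_true, decide_true, Data.branch_true]
      refine ⟨_, _, ih, ?_, by omega⟩
      simp [hx]

def descentCost (N : ℕ) : ℕ := occursCost N + N * cleanCost N + 200

open Classical in
theorem returns_noDescent (h : Parameters len a L n m e E N) {X : List ℕ} {f g : NCFormula F ℕ}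
    (hX : X.length ≤ N) (hf : FitsTwice a L m f) (hg : FitsTwice a L m g) :
    Returns len program 19
      (.pair (encodeVars X) (.pair f.encode (.pair g.encode (encodeVars L))))
      (.ofBool (decide (NCFormula.NoDescent X f g))) (X.length * descentCost N + 20) := by
  induction X with
  | nil =>
    apply Returns.of_wp rfl
    simp only [Expr.noDescentBody, Expr.tt, Expr.wp, encodeVars, List.map_nil, Data.ofList,
      List.getD_cons_zero, Data.head_pair, Data.branch_nil]
    exact ⟨by simp [Data.ofBool, NCFormula.NoDescent], by omega⟩
  | cons y X ih =>
    rw [List.length_cons] at hX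
    have hrec := ih (by omega)
    have hc : descentCost N = occursCost N + N * cleanCost N + 200 := rfl
    have c1 : X.length * cleanCost N ≤ N * cleanCost N := Nat.mul_le_mul_right _ (by omega)
    have hcons : NCFormula.NoDescent (y :: X) f g ↔
        (OccursIn y g.poly → ∀ x ∈ X, ¬ OccursIn x f.poly) ∧ NCFormula.NoDescent X f g := by
      unfold NCFormula.NoDescent
      rw [List.pairwise_cons]
      exact and_congr_left fun _ => ⟨fun h hy x hx => h x hx hy, fun h x hx hy => h hy x hx⟩
    apply Returns.of_wp rfl
    simp only [Expr.noDescentBody, Expr.tt, Expr.wp, encodeVars, List.map_cons, Data.ofList,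
      List.getD_cons_zero, Data.head_pair, Data.tail_pair, Data.branch_pair]
    refine ⟨_, _, returns_notOccurs h hg y, ?_⟩
    simp only [List.length_cons, add_mul, one_mul]
    by_cases hy : OccursIn y g.poly
    · simp only [hy, not_true_eq_false, decide_false, Data.branch_false]
      refine ⟨_, _, returns_noneOccurs h (X := X) hf, ?_⟩
      by_cases hx : ∀ x ∈ X, ¬ OccursIn x f.poly
      · rw [decide_eq_true hx, Data.branch_true]
        refine ⟨_, _, hrec, ?_, by omega⟩
        congr 1
        rw [decide_eq_decide, hcons]
        exact ⟨fun h => ⟨fun _ => hx, h⟩, fun h => h.2⟩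
      · rw [decide_eq_false hx, Data.branch_false]
        refine ⟨?_, by omega⟩
        rw [decide_eq_false fun h => hx ((hcons.1 h).1 hy)]
        rfl
    · simp only [hy, not_false_eq_true, decide_true, Data.branch_true]
      refine ⟨_, _, hrec, ?_, by omega⟩
      congr 1
      rw [decide_eq_decide, hcons]
      exact ⟨fun h => ⟨fun h' => absurd h' hy, h⟩, fun h => h.2⟩

def processCost (N : ℕ) : ℕ := N * descentCost N + 2 * (N * cleanCost N) + 300

theorem FitsTwice.of_process {G G' : NCFormula F ℕ} (hG : FitsTwice a L m G)
    (h : NCFormula.process L G = some G') : FitsTwice a L m G' := by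
  obtain ⟨-, h2, -, -, h5⟩ := NCFormula.process_sound h
  exact ⟨by rw [h2]; exact hG.size_le, h5 _ _ (isSmall_zero _) hG.leaves⟩

open Classical in
-- Every node is processed once, and the processed subformulas obey the same bounds by
-- `FitsTwice.of_process`. Hence one cost per node suffices, covering a descent test and two
-- cleanings.
theorem returns_process (h : Parameters len a L n m e E N) (G : NCFormula F ℕ)
    (hG : FitsTwice a L m G) :
    Returns len program 0 (.pair G.encode (encodeVars L))
      (encodeOutput (NCFormula.process L G)) (G.size * processCost N) := by
  have hc : processCost N = N * descentCost N + 2 * (N * cleanCost N) + 300 := rfl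
  induction G with
  | var x =>
    apply Returns.of_wp rfl
    simp only [Expr.processBody, Expr.formulaCases, NCFormula.encode, Data.ofNat_zero,
      Expr.wp, List.getD_cons_zero, Data.head_pair, Data.branch_nil, NCFormula.process,
      encodeOutput, true_and, NCFormula.size]
    omega
  | const b =>
    apply Returns.of_wp rfl
    simp only [Expr.processBody, Expr.formulaCases, NCFormula.encode, Data.ofNat_one,
      Expr.wp, List.getD_cons_zero, Data.head_pair, Data.tail_pair, Data.branch_nil,
      Data.branch_pair, NCFormula.process, encodeOutput, true_and, NCFormula.size]
    omega
  | unary op f ih =>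
    have hs : (NCFormula.unary op f).size = f.size + 1 := rfl
    have hsz := hG.size_le
    have hf : FitsTwice a L m f := ⟨by omega, hG.leaves⟩
    apply Returns.of_wp rfl
    simp only [Expr.processBody, Expr.formulaCases, NCFormula.encode, Data.ofNat_two,
      Expr.wp, List.getD_cons_zero, List.getD_cons_succ, Data.head_pair, Data.tail_pair,
      Data.branch_nil, Data.branch_pair, NCFormula.process]
    refine ⟨_, _, ih hf, ?_⟩
    rw [hs]
    simp only [add_mul, one_mul]
    cases hp : NCFormula.process L f with
    | none =>
      simp only [encodeOutput, Data.branch_nil, Option.map_none, true_and]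
      omega
    | some f' =>
      -- The code of a formula is always a pair, so a successful result is never confused with
      -- `nil`.
      have hpair : ∀ p q : Prop, f'.encode.branch p q = p := fun p q => by cases f' <;> rfl
      simp only [encodeOutput, hpair, Option.map_some, NCFormula.encode, Data.ofNat_two, true_and]
      omega
  | binary op f g ihf ihg =>
    have hs : (NCFormula.binary op f g).size = f.size + g.size + 1 := rfl
    have hsz := hG.size_le
    have hf : FitsTwice a L m f := ⟨by omega, hG.leaves.1⟩
    have hg : FitsTwice a L m g := ⟨by omega, hG.leaves.2⟩
    have hL := h.length_le
    apply Returns.of_wp rfl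
    simp only [Expr.processBody, Expr.formulaCases, NCFormula.encode, Data.ofNat_three,
      Expr.wp, List.getD_cons_zero, List.getD_cons_succ, Data.head_pair, Data.tail_pair,
      Data.branch_pair]
    refine ⟨_, _, ihf hf, ?_⟩
    rw [hs]
    simp only [add_mul, one_mul]
    cases hpf : NCFormula.process L f with
    | none =>
      have hp : NCFormula.process L (.binary op f g) = none := by
        cases op <;> rw [NCFormula.process, hpf] <;> rfl
      simp only [hp, encodeOutput, Data.branch_nil, true_and]
      omega
    | some f' =>
      have hf' := hf.of_process hpf
      have hpair : ∀ p q : Prop, f'.encode.branch p q = p := fun p q => by cases f' <;> rfl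
      rw [show encodeOutput (some f') = f'.encode from rfl, hpair]
      refine ⟨_, _, ihg hg, ?_⟩
      cases hpg : NCFormula.process L g with
      | none =>
        have hp : NCFormula.process L (.binary op f g) = none := by
          cases op <;> rw [NCFormula.process, hpf, hpg] <;> rfl
        simp only [hp, encodeOutput, Data.branch_nil, true_and]
        omega
      | some g' =>
        have hg' := hg.of_process hpg
        have hpair : ∀ p q : Prop, g'.encode.branch p q = p := fun p q => by cases g' <;> rfl
        rw [show encodeOutput (some g') = g'.encode from rfl, hpair]
        cases op with
        | plus =>
          have hp : NCFormula.process L (.binary .plus f g) = some (.binary .plus f' g') := by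
            rw [NCFormula.process, hpf, hpg]; rfl
          simp only [hp, encodeOutput, GateOp.encode, Data.ofNat_zero, Data.branch_nil, NCFormula.encode,
            Data.ofNat_three, true_and]
          omega
        | times =>
          simp only [GateOp.encode, Data.ofNat_one, Data.branch_pair]
          refine ⟨_, _, returns_noDescent h hL hf' hg', ?_⟩
          have c1 := Nat.mul_le_mul_right (descentCost N) hL
          have c2 := Nat.mul_le_mul_right (cleanCost N) hL
          by_cases hd : NCFormula.NoDescent L f' g'
          · have hp : NCFormula.process L (.binary .times f g) =
                some (.binary .times (NCFormula.clean L f') (NCFormula.clean L g')) := by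
              rw [NCFormula.process, hpf, hpg]
              simp only [Option.bind_some, if_pos hd]
            rw [decide_eq_true hd, Data.branch_true]
            refine ⟨_, _, returns_clean h hf', _, _, returns_clean h hg', ?_, by omega⟩
            simp only [hp, encodeOutput, NCFormula.encode, GateOp.encode, Data.ofNat_one, Data.ofNat_three]
          · have hp : NCFormula.process L (.binary .times f g) = none := by
              rw [NCFormula.process, hpf, hpg]
              simp only [Option.bind_some, if_neg hd]
            rw [decide_eq_false hd, Data.branch_false]
            refine ⟨?_, by omega⟩
            simp only [hp, encodeOutput]

end Main

/-! ### Polynomial bounds in the length of the input -/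

section PolyBounded

/-- Functions that are bounded by a polynomial. -/
def PolyBounded (f : ℕ → ℕ) : Prop := ∃ p : Polynomial ℕ, ∀ n, f n ≤ p.eval n

namespace PolyBounded

theorem const (c : ℕ) : PolyBounded fun _ => c := ⟨.C c, fun n => by simp⟩

theorem id : PolyBounded fun n => n := ⟨.X, fun n => by simp⟩

theorem add {f g : ℕ → ℕ} (hf : PolyBounded f) (hg : PolyBounded g) :
    PolyBounded fun n => f n + g n := by
  obtain ⟨p, hp⟩ := hf
  obtain ⟨q, hq⟩ := hg
  exact ⟨p + q, fun n => by rw [Polynomial.eval_add]; exact Nat.add_le_add (hp n) (hq n)⟩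

theorem mul {f g : ℕ → ℕ} (hf : PolyBounded f) (hg : PolyBounded g) :
    PolyBounded fun n => f n * g n := by
  obtain ⟨p, hp⟩ := hf
  obtain ⟨q, hq⟩ := hg
  exact ⟨p * q, fun n => by rw [Polynomial.eval_mul]; exact Nat.mul_le_mul (hp n) (hq n)⟩

theorem comp {f g : ℕ → ℕ} (hf : PolyBounded f) (hg : PolyBounded g) :
    PolyBounded fun n => f (g n) := by
  obtain ⟨p, hp⟩ := hf
  obtain ⟨q, hq⟩ := hg
  exact ⟨p.comp q, fun n => by
    rw [Polynomial.eval_comp]; exact (hp _).trans (monotone_eval p (hq n))⟩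

theorem eval (p : Polynomial ℕ) : PolyBounded fun n => p.eval n := ⟨p, fun _ => le_rfl⟩

end PolyBounded

theorem polyBounded_rowCost : PolyBounded rowCost := by
  unfold rowCost
  repeat with_reducible first
    | exact PolyBounded.const _
    | exact PolyBounded.id
    | apply PolyBounded.add
    | apply PolyBounded.mul

theorem polyBounded_insertCost : PolyBounded insertCost := by
  unfold insertCost
  repeat with_reducible first
    | exact PolyBounded.const _
    | exact PolyBounded.id
    | exact polyBounded_rowCost
    | apply PolyBounded.add
    | apply PolyBounded.mul

theorem polyBounded_nextCost : PolyBounded nextCost := by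
  unfold nextCost
  repeat with_reducible first
    | exact PolyBounded.const _
    | exact PolyBounded.id
    | exact polyBounded_insertCost
    | apply PolyBounded.add
    | apply PolyBounded.mul

theorem polyBounded_roundCost : PolyBounded roundCost := by
  unfold roundCost
  repeat with_reducible first
    | exact PolyBounded.const _
    | exact PolyBounded.id
    | exact polyBounded_nextCost
    | apply PolyBounded.add
    | apply PolyBounded.mul

theorem polyBounded_closureCost : PolyBounded closureCost := by
  unfold closureCost
  repeat with_reducible first
    | exact PolyBounded.const _
    | exact PolyBounded.id
    | exact polyBounded_roundCost
    | apply PolyBounded.add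
    | apply PolyBounded.mul

theorem polyBounded_outputsCost : PolyBounded outputsCost := by
  unfold outputsCost
  repeat with_reducible first
    | exact PolyBounded.const _
    | exact PolyBounded.id
    | apply PolyBounded.add
    | apply PolyBounded.mul

theorem polyBounded_isZeroCost : PolyBounded isZeroCost := by
  unfold isZeroCost
  repeat with_reducible first
    | exact PolyBounded.const _
    | exact PolyBounded.id
    | exact polyBounded_insertCost
    | exact polyBounded_closureCost
    | exact polyBounded_outputsCost
    | apply PolyBounded.add
    | apply PolyBounded.mul

theorem polyBounded_occursCost : PolyBounded occursCost := by
  unfold occursCost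
  repeat with_reducible first
    | exact PolyBounded.const _
    | exact PolyBounded.id
    | exact polyBounded_isZeroCost
    | apply PolyBounded.add
    | apply PolyBounded.mul

theorem polyBounded_cleanCost : PolyBounded cleanCost := by
  unfold cleanCost
  repeat with_reducible first
    | exact PolyBounded.const _
    | exact PolyBounded.id
    | exact polyBounded_occursCost
    | apply PolyBounded.add
    | apply PolyBounded.mul

theorem polyBounded_descentCost : PolyBounded descentCost := by
  unfold descentCost
  repeat with_reducible first
    | exact PolyBounded.const _
    | exact PolyBounded.id
    | exact polyBounded_occursCost
    | exact polyBounded_cleanCost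
    | apply PolyBounded.add
    | apply PolyBounded.mul

theorem polyBounded_processCost : PolyBounded processCost := by
  unfold processCost
  repeat with_reducible first
    | exact PolyBounded.const _
    | exact PolyBounded.id
    | exact polyBounded_descentCost
    | exact polyBounded_cleanCost
    | apply PolyBounded.add
    | apply PolyBounded.mul

/-- The parameters of the algorithm as functions of the length of the input. -/
def stateBound (n : ℕ) : ℕ := (2 * n + 4) * (n + 20) * (2 * n + 4)

def smallBound (n : ℕ) : ℕ := elimBound (2 * n + 4) (stateBound n) + (2 * n + 4)

/-- The argument of `q` is that of `EfficientlyRepresented.bound`, with `n` bounding the total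
length of the constants. The summand `3 * n + 6` secures `m + 2 ≤ N` for `m = 2 * n + 4`, and that
`n` and the number of variables are at most `N`. -/
def lenBound (q : Polynomial ℕ) (n : ℕ) : ℕ := q.eval (2 * smallBound n + 1 + n) + (3 * n + 6)

theorem polyBounded_stateBound : PolyBounded stateBound := by
  unfold stateBound
  repeat with_reducible first
    | exact PolyBounded.const _
    | exact PolyBounded.id
    | apply PolyBounded.add
    | apply PolyBounded.mul

theorem polyBounded_smallBound : PolyBounded smallBound := by
  unfold smallBound elimBound redBound minorBound
  repeat with_reducible first
    | exact PolyBounded.const _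
    | exact PolyBounded.id
    | exact polyBounded_stateBound
    | apply PolyBounded.add
    | apply PolyBounded.mul

theorem polyBounded_lenBound (q : Polynomial ℕ) : PolyBounded (lenBound q) :=
  .add (.comp (.eval q) (.add (.add (.mul (.const 2) polyBounded_smallBound) (.const 1)) .id))
    (.add (.mul (.const 3) .id) (.const 6))

end PolyBounded

namespace NCFormula

variable {F : Type*}

/-- The constants of the formula. -/
def consts : NCFormula F ℕ → List F
  | var _ => []
  | const a => [a]
  | unary _ f => f.consts
  | binary _ f g => f.consts ++ g.consts

theorem allLeaves_self (G : NCFormula F ℕ) : G.AllLeaves (· ∈ G.vars) (· ∈ G.consts) := by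
  induction G with
  | var x => exact Finset.mem_singleton_self x
  | const a => exact List.mem_singleton_self a
  | unary op f ih => exact ih
  | binary op f g ihf ihg =>
    exact ⟨ihf.mono (fun _ => Finset.mem_union_left _) fun _ => List.mem_append_left _,
      ihg.mono (fun _ => Finset.mem_union_right _) fun _ => List.mem_append_right _⟩

theorem sum_consts_le (len : F → ℕ) (G : NCFormula F ℕ) :
    (G.consts.map len).sum ≤ G.encode.size len := by
  induction G with
  | var x => exact Nat.zero_le _
  | const a => simp only [consts, encode, Data.size, List.map_cons, List.map_nil, List.sum_cons,
      List.sum_nil]; omega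
  | unary op f ih => simp only [consts, encode, Data.size]; omega
  | binary op f g ihf ihg =>
    simp only [consts, encode, Data.size, List.map_append, List.sum_append]; omega

end NCFormula

theorem size_mem_ofList {F : Type*} (len : F → ℕ) {l : List (Data F)} {d : Data F} (h : d ∈ l) :
    d.size len ≤ (Data.ofList l).size len := by
  induction l with
  | nil => cases h
  | cons x l ih =>
    simp only [Data.ofList, Data.size]
    rcases List.mem_cons.1 h with rfl | h
    · omega
    · have := ih h; omega

theorem length_le_size_ofList {F : Type*} (len : F → ℕ) (l : List (Data F)) :
    l.length ≤ (Data.ofList l).size len := by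
  induction l with
  | nil => exact Nat.zero_le _
  | cons x l ih => simp only [Data.ofList, Data.size, List.length_cons]; omega

/-- The elements `a` are the constants of the input formula, listed with repetition: each has its
own node in the code, so the sum of their lengths is at most the length of the input. -/
theorem parameters_of_input {F : Type*} [Field F] {len : F → ℕ} {q : Polynomial ℕ}
    (hq : ∀ (k : ℕ) (a : Fin k → F) (N : MvPolynomial (Fin k) ℤ),
    len (MvPolynomial.aeval a N) ≤
      q.eval (N.totalDegree + Nat.size (∑ m ∈ N.support, (N.coeff m).natAbs) + ∑ i, len (a i)))
    (Φ : NCFormula F ℕ) (L : List ℕ) {n : ℕ}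
    (hn : (Data.pair Φ.encode (encodeVars L)).size len = n) :
    Parameters len Φ.consts.get L n (2 * n + 4) (stateBound n) (smallBound n) (lenBound q n) := by
  rw [Data.size] at hn
  have hlen : lenBound q n = q.eval (2 * smallBound n + 1 + n) + (3 * n + 6) := rfl
  refine ⟨fun c hc => ?_, fun x hx => ?_, ?_, by omega, by omega, le_rfl, le_rfl⟩
  · refine (EfficientlyRepresented.bound hq hc).trans ?_
    have h1 : ∑ i, len (Φ.consts.get i) = (Φ.consts.map len).sum := by
      rw [← List.sum_ofFn]
      conv_rhs => rw [← List.ofFn_get Φ.consts, List.map_ofFn]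
      rfl
    have h2 := Φ.sum_consts_le len
    rw [h1, hlen]
    exact (monotone_eval q (by omega)).trans (Nat.le_add_right _ _)
  · have := size_mem_ofList len (List.mem_map_of_mem (f := Data.ofNat) hx)
    unfold encodeVars at hn
    omega
  · have := length_le_size_ofList len (L.map (Data.ofNat (F := F)))
    rw [List.length_map] at this
    unfold encodeVars at hn
    omega

end OrderedFormulas

/-! ### The proposition -/

theorem proposition4p2 {F : Type*} [Field F] (len : F → ℕ)
    (hlen : OrderedFormulas.EfficientlyRepresented len) :
    ∃ (P : OrderedFormulas.Program) (p : Polynomial ℕ),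
      ∀ (Φ : OrderedFormulas.NCFormula F ℕ) (ord : LinearOrder ℕ),
        ∃ (answer : Option (OrderedFormulas.NCFormula F ℕ)) (t : ℕ),
          P.Runs len (OrderedFormulas.encodeInput Φ ord) (OrderedFormulas.encodeOutput answer) t ∧
          t ≤ p.eval ((OrderedFormulas.encodeInput Φ ord).size len) ∧
          (¬ Φ.IsOrdered ord → answer = none) ∧
          (Φ.IsOrdered ord → ∃ Ψ : OrderedFormulas.NCFormula F ℕ,
            answer = some Ψ ∧ Ψ.IsSyntacticOrdered ord ∧ Ψ.size = Φ.size ∧ Ψ.poly = Φ.poly ∧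
            Φ.ZeroesOutTo Ψ) := by
  open OrderedFormulas in
  obtain ⟨q, hq⟩ := hlen
  -- The summand 2 pays for the outermost call and for reading its argument.
  have hcost : PolyBounded fun n => n * processCost (lenBound q n) + 2 :=
    ((PolyBounded.id.mul (polyBounded_processCost.comp (polyBounded_lenBound q))).add
      (.const 2))
  obtain ⟨p, hp⟩ := hcost
  refine ⟨program, p, fun Φ ord => ?_⟩
  set L := Φ.vars.sort ord.le with hL
  have hmem : ∀ x ∈ Φ.vars, x ∈ L := fun x hx => (Finset.mem_sort _).2 hx
  have hsort : L.Pairwise fun a b => ord.le a b ∧ a ≠ b :=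
    (Finset.pairwise_sort _ _).and (Finset.sort_nodup _ _)
  have hin : encodeInput Φ ord = .pair Φ.encode (encodeVars L) := rfl
  rw [hin]
  set n := (Data.pair Φ.encode (encodeVars L)).size len with hn
  have hpar := parameters_of_input hq Φ L hn.symm
  have hsize : Φ.size ≤ n := by
    have h1 := Φ.size_le_numPairs_encode
    have h2 := Φ.encode.numPairs_le_size len
    rw [Data.size] at hn
    omega
  have hfit : FitsTwice Φ.consts.get L (2 * n + 4) Φ := by
    refine ⟨by omega, Φ.allLeaves_self.mono hmem fun c hc => ?_⟩
    obtain ⟨i, rfl⟩ := List.get_of_mem hc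
    exact isSmall_apply i
  obtain ⟨body, t, hb, ht, htB⟩ := returns_process hpar Φ hfit
  refine ⟨NCFormula.process L Φ, 1 + t + 1, .call (.loc _ 0) hb ht, ?_, ?_, ?_⟩
  · have hpn : n * processCost (lenBound q n) + 2 ≤ p.eval n := hp n
    have := Nat.mul_le_mul_right (processCost (lenBound q n)) hsize
    omega
  · intro h
    cases hpr : NCFormula.process L Φ with
    | none => rfl
    | some Ψ => exact absurd ((NCFormula.process_complete hsort hmem).2 Ψ hpr).1 h
  · intro h
    obtain ⟨Ψ, hΨ⟩ := (NCFormula.process_complete hsort hmem).1 h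
    obtain ⟨h1, h2, -, h4, -⟩ := NCFormula.process_sound hΨ
    exact ⟨Ψ, hΨ, ((NCFormula.process_complete hsort hmem).2 Ψ hΨ).2, h2, h1, h4⟩
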